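/- Let $n\ge 2$. For $u\in W^{1,p}(\mathbb R^n)$, $1<p<n$ (real-valued), let $\nabla u$ be the weak gradient, $\|u\|_{W^{1,p}}=\|u\|_{L^p}+\|\nabla u\|_{L^p}$, and let $$\tilde u(x)=\limsup_{r\to 0^+}\frac1{|B(x,r)|}\int_{B(x,r)}u(z)\,dz\in[-\infty,\infty],\qquad x\in\mathbb R^n,$$ be its precise representative. For a Borel probability measure $\mu$ on $\mathbb R^n$ let $\mu_t(E)=\mu(E/t)$, $t>0$. For a function $v:\mathbb R^n\to[-\infty,\infty]$ defined at every point put $$\mathcal S_\mu v(x)=\sup_{t>0}\int_{\mathbb R^n}|v(z+x)|\,d\mu_t(z),$$ (integrals of non-measurable nonnegative functions, which occur only in (3), being read as lower integrals) and write $\mathcal S_\mu u:=\mathcal S_\mu\tilde u$ for $u\in W^{1,p}$. Further let $$\mathcal M u(x)=\sup_{r>0}\frac1{|B(x,r)|}\int_{B(x,r)}|u(z)|\,dz,\qquad \mathcal I|\nabla u|(x)=\int_{\mathbb R^n}\frac{|\nabla u(z)|}{|x-z|^{n-1}}\,dz,\qquad p^*=\frac{np}{n-p}.$$ Call $\mu$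 spherical-like with constants $R,M\in\mathbb R$ if $\operatorname{supp}\mu\subset\overline B(0,R)$ and $\mu(B(x,r))\le M r^{n-1}$ for all $x\in\mathbb R^n$, $r>0$. (1) There is a constant $C(n)>0$, depending only on $n$, such that for every Borel probability measure $\mu$ that is spherical-like with constants $R,M$, every $1<p<n$ and every $u\in W^{1,p}(\mathbb R^n)$, $$\mathcal S_\mu u(x)\le C(n)\,R^{n-1}M\,\bigl(\mathcal M u(x)+\mathcal I|\nabla u|(x)\bigr)\qquad\text{for every }x\in\mathbb R^n .$$ (2) For every spherical-like $\mu$ and every $1<p<n$ the operator $\mathcal S_\mu:W^{1,p}(\mathbb R^n)\to L^{p^*}(\mathbb R^n)$ is bounded: there is $K<\infty$ such that for all $u\in W^{1,p}(\mathbb R^n)$ the function $\mathcal S_\mu u$ is Lebesgue measurable and $\|\mathcal S_\mu u\|_{L^{p^*}}\le K\|u\|_{W^{1,p}}$. (3) This covers the spherical maximal operator and averages over boundaries of cubes: the normalized $(n-1)$-dimensional Hausdorff measures $\sigma$ on the unit sphere and $\tau$ on the boundary of $[-1,1]^n$ are spherical-like for suitable $R,M$, and for every $v:\mathbb R^n\to[-\infty,\infty]$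 and every $x\in\mathbb R^n$, $\mathcal S_\sigma v(x)$ is the supremum over $t>0$ of the $\mathcal H^{n-1}$-average of $|v|$ over the sphere of centre $x$ and radius $t$, while $\mathcal S_\tau v(x)$ is the supremum over $t>0$ of the $\mathcal H^{n-1}$-average of $|v|$ over the boundary of the cube $\{z:\max_i|z_i-x_i|\le t\}$. -/

import Mathlib

open MeasureTheory Filter Topology
open scoped ENNReal NNReal ContDiff

noncomputable section

namespace SphericalLike

/-- `ℝⁿ` with its Euclidean norm. -/
abbrev Rn (n : ℕ) : Type := EuclideanSpace ℝ (Fin n)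

/-- `g` is the weak gradient of `u` on `ℝⁿ`: the distributional derivative of `u` in every
direction `e` is `⟪g, e⟫`. -/
structure IsWeakGradient {n : ℕ} (u : Rn n → ℝ) (g : Rn n → Rn n) : Prop where
  locInt : LocallyIntegrable u volume
  locInt_grad : LocallyIntegrable g volume
  integral_eq : ∀ φ : Rn n → ℝ, ContDiff ℝ ∞ φ → HasCompactSupport φ → ∀ e : Rn n,
    ∫ x, u x * fderiv ℝ φ x e = -∫ x, inner ℝ (g x) e * φ x

/-- `u` belongs to `W^{1,p}(ℝⁿ)` and its weak gradient is (a.e.) `g`. -/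
structure IsSobolev {n : ℕ} (p : ℝ) (u : Rn n → ℝ) (g : Rn n → Rn n) : Prop where
  memLp : MemLp u (ENNReal.ofReal p) volume
  memLp_grad : MemLp g (ENNReal.ofReal p) volume
  weakGradient : IsWeakGradient u g

/-- The Sobolev norm `‖u‖_p + ‖∇u‖_p`, where `g` is the weak gradient of `u`. -/
def sobolevNorm {n : ℕ} (p : ℝ) (u : Rn n → ℝ) (g : Rn n → Rn n) : ℝ≥0∞ :=
  eLpNorm u (ENNReal.ofReal p) volume + eLpNorm g (ENNReal.ofReal p) volume

/-- The precise representative `x ↦ limsup_{r → 0⁺} ⨍_{B(x,r)} u`, defined at every point, with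
values in `[-∞, ∞]`. It depends only on the a.e. equivalence class of `u`. -/
def preciseRep {n : ℕ} (u : Rn n → ℝ) (x : Rn n) : EReal :=
  limsup (fun r : ℝ => ((⨍ z in Metric.ball x r, u z : ℝ) : EReal)) (𝓝[>] 0)

/-- `μ` is a probability measure with support in `closedBall 0 R` and `μ(B(x,r)) ≤ M r^{n-1}`. -/
structure IsSphericalLike {n : ℕ} (μ : Measure (Rn n)) (R M : ℝ) : Prop where
  isProbabilityMeasure : IsProbabilityMeasure μ
  support_subset : μ.support ⊆ Metric.closedBall 0 R
  measure_ball_le : ∀ (x : Rn n) (r : ℝ), 0 < r →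
    μ (Metric.ball x r) ≤ ENNReal.ofReal (M * r ^ (n - 1))

/-- The rescaled measure `μ_t`, `μ_t(E) = μ(E / t)`: the image of `μ` under `z ↦ t z`. -/
def rescale {n : ℕ} (μ : Measure (Rn n)) (t : ℝ) : Measure (Rn n) :=
  μ.map (fun z => t • z)

/-- The maximal operator `S_μ v (x) = sup_{t > 0} ∫ |v(z + x)| dμ_t(z)`, for a function `v` that is
defined at every point. -/
def maximalOp {n : ℕ} (μ : Measure (Rn n)) (v : Rn n → EReal) (x : Rn n) : ℝ≥0∞ :=
  ⨆ (t : ℝ) (_ : 0 < t), ∫⁻ z, (v (z + x)).abs ∂(rescale μ t)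

/-- The Hardy–Littlewood maximal function. -/
def hardyLittlewood {n : ℕ} (u : Rn n → ℝ) (x : Rn n) : ℝ≥0∞ :=
  ⨆ (r : ℝ) (_ : 0 < r), ⨍⁻ z in Metric.ball x r, ‖u z‖ₑ ∂volume

/-- The Riesz potential `I|g| (x) = ∫ |g(z)| / |x - z|^{n-1} dz`. -/
def rieszPotential {n : ℕ} (g : Rn n → Rn n) (x : Rn n) : ℝ≥0∞ :=
  ∫⁻ z, ‖g z‖ₑ / ‖x - z‖ₑ ^ (n - 1)

/-- The operator `S`, acting on precise representatives, is bounded from `W^{1,p}(ℝⁿ)` to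
`L^{p*}(ℝⁿ)`, where `p* = np / (n - p)`. -/
def BoundedSobolevLebesgue {n : ℕ} (p : ℝ) (S : (Rn n → EReal) → Rn n → ℝ≥0∞) : Prop :=
  ∃ K : ℝ≥0, ∀ (u : Rn n → ℝ) (g : Rn n → Rn n), IsSobolev p u g →
    MemLp (S (preciseRep u)) (ENNReal.ofReal (n * p / (n - p))) volume ∧
    eLpNorm (S (preciseRep u)) (ENNReal.ofReal (n * p / (n - p))) volume ≤ K * sobolevNorm p u g

/-- The closed cube with centre `x`, side length `2t` and sides parallel to the axes. -/
def cube {n : ℕ} (x : Rn n) (t : ℝ) : Set (Rn n) :=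
  {z | ∀ i, |z i - x i| ≤ t}

/-- `(n-1)`-dimensional Hausdorff measure on `A`, normalized to have total mass one. -/
def normalizedHausdorff {n : ℕ} (A : Set (Rn n)) : Measure (Rn n) :=
  ProbabilityTheory.cond (Measure.hausdorffMeasure ((n : ℝ) - 1)) A

/-- The spherical maximal operator. -/
def sphericalMaximal {n : ℕ} (v : Rn n → EReal) (x : Rn n) : ℝ≥0∞ :=
  ⨆ (t : ℝ) (_ : 0 < t), ⨍⁻ z in Metric.sphere x t, (v z).abs
    ∂(Measure.hausdorffMeasure ((n : ℝ) - 1))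

/-- The maximal operator of averages over boundaries of cubes. -/
def cubeBoundaryMaximal {n : ℕ} (v : Rn n → EReal) (x : Rn n) : ℝ≥0∞ :=
  ⨆ (t : ℝ) (_ : 0 < t), ⨍⁻ z in frontier (cube x t), (v z).abs
    ∂(Measure.hausdorffMeasure ((n : ℝ) - 1))

end SphericalLike

end

/-!
The pointwise bound rests on the trace inequality of Meyers and Ziemer: if every ball satisfies
`ν (B(x,r)) ≤ A r ^ (n-1)`, then `∫ |f| dν ≤ C(n) A ∫ |∇f|` for compactly supported `f` of class
`C¹`. By the coarea formula, used here in smoothed form, it suffices to treat the superlevel sets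
`{f > s}`: each of their points is the centre of a ball which the superlevel set fills to an
intermediate proportion, the relative isoperimetric inequality bounds `r ^ (n-1)` by the perimeter
in that ball, and a Vitali selection adds these bounds up.

With a cutoff at distance `2 t R` from `x`, the trace inequality for the measure `x + μ_t` bounds
the integral of a mollification of `u` by integrals of `|u|` and `|∇u|` over a ball of radius
comparable to `t R`, hence by `𝓜u(x) + 𝓘|∇u|(x)`. The estimate survives the passage to the precise
representative because the oscillation of the averages of `u` over balls of radius at most `ρ` is
controlled by a Riesz potential of `|∇u|` truncated at `ρ`, and the integral of the latter against
a measure with the above growth tends to zero with `ρ`.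

Since `𝓜u` is itself dominated by `𝓘|∇u|`, the `L^{p*}` bound is the Hardy–Littlewood–Sobolev
inequality, obtained from Hedberg's pointwise estimate and the maximal theorem. Measurability holds
because the averages of the mollifications are lower semicontinuous in `x` and converge locally
uniformly, so that `S_μ u` is lower semicontinuous.
-/

noncomputable section

namespace SphericalLike

open Module Metric

section FundamentalTheorem

variable {E F : Type*} [NormedAddCommGroup E] [NormedSpace ℝ E] [NormedAddCommGroup F]
  [NormedSpace ℝ F] [CompleteSpace F] {v : E → F}

theorem enorm_sub_le_lintegral_fderiv (hv : ContDiff ℝ 1 v) (y z : E) {r ρ : ℝ} (h : r ≤ ρ) :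
    ‖v (y + ρ • z) - v (y + r • z)‖ₑ ≤
      ∫⁻ s in Set.Ioc r ρ, ‖fderiv ℝ v (y + s • z)‖ₑ * ‖z‖ₑ := by
  have hder (s : ℝ) : HasDerivAt (fun s : ℝ ↦ v (y + s • z)) (fderiv ℝ v (y + s • z) z) s := by
    have hline : HasDerivAt (fun s : ℝ ↦ y + s • z) z s := by
      simpa using ((hasDerivAt_id s).smul_const z).const_add y
    exact (hv.differentiable one_ne_zero _).hasFDerivAt.comp_hasDerivAt s hline
  have hcont : Continuous fun s : ℝ ↦ fderiv ℝ v (y + s • z) z := by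
    have := hv.continuous_fderiv one_ne_zero
    fun_prop
  rw [← intervalIntegral.integral_eq_sub_of_hasDerivAt (fun s _ ↦ hder s)
    (hcont.intervalIntegrable _ _), intervalIntegral.integral_of_le h]
  exact (enorm_integral_le_lintegral_enorm _).trans
    (lintegral_mono fun s ↦ ContinuousLinearMap.le_opENorm _ _)

variable [MeasurableSpace E] [BorelSpace E] [FiniteDimensional ℝ E]

theorem lintegral_ball_enorm_add_sub_le (μ : Measure E) [μ.IsAddHaarMeasure] (hv : ContDiff ℝ 1 v)
    (x e : E) (r : ℝ) :
    ∫⁻ z in ball x r, ‖v (z + e) - v z‖ₑ ∂μ ≤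
      ‖e‖ₑ * ∫⁻ z in ball x (r + ‖e‖), ‖fderiv ℝ v z‖ₑ ∂μ := by
  have hmeas : Measurable fun q : E × ℝ ↦ ‖fderiv ℝ v (q.1 + q.2 • e)‖ₑ * ‖e‖ₑ :=
    ((hv.continuous_fderiv one_ne_zero).comp (by fun_prop)).enorm.measurable.mul_const _
  have htranslate (s : ℝ) (hs : s ∈ Set.Ioc (0 : ℝ) 1) :
      ∫⁻ z in ball x r, ‖fderiv ℝ v (z + s • e)‖ₑ * ‖e‖ₑ ∂μ ≤
        ‖e‖ₑ * ∫⁻ z in ball x (r + ‖e‖), ‖fderiv ℝ v z‖ₑ ∂μ := by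
    have hsub : ball x r ⊆ (fun z ↦ z + s • e) ⁻¹' ball x (r + ‖e‖) := fun z hz ↦ by
      have hse : ‖s • e‖ ≤ ‖e‖ := by
        rw [norm_smul, Real.norm_of_nonneg hs.1.le]
        exact mul_le_of_le_one_left (norm_nonneg e) hs.2
      have := dist_triangle (z + s • e) z x
      rw [dist_self_add_left] at this
      exact mem_ball.2 (by linarith [mem_ball.1 hz])
    rw [lintegral_mul_const' _ _ enorm_ne_top, mul_comm]
    refine mul_le_mul_right ?_ _
    refine (lintegral_mono_set hsub).trans_eq ?_
    exact (measurePreserving_add_right μ (s • e)).setLIntegral_comp_preimage_emb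
      (measurableEmbedding_addRight _) (fun z ↦ ‖fderiv ℝ v z‖ₑ) _
  calc ∫⁻ z in ball x r, ‖v (z + e) - v z‖ₑ ∂μ
      ≤ ∫⁻ z in ball x r, (∫⁻ s in Set.Ioc (0 : ℝ) 1, ‖fderiv ℝ v (z + s • e)‖ₑ * ‖e‖ₑ) ∂μ :=
        lintegral_mono fun z ↦ by
          simpa using enorm_sub_le_lintegral_fderiv hv z e zero_le_one
    _ = ∫⁻ s in Set.Ioc (0 : ℝ) 1, (∫⁻ z in ball x r, ‖fderiv ℝ v (z + s • e)‖ₑ * ‖e‖ₑ ∂μ) :=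
        lintegral_lintegral_swap hmeas.aemeasurable
    _ ≤ ∫⁻ _ in Set.Ioc (0 : ℝ) 1, (‖e‖ₑ * ∫⁻ z in ball x (r + ‖e‖), ‖fderiv ℝ v z‖ₑ ∂μ) :=
        setLIntegral_mono' measurableSet_Ioc htranslate
    _ = ‖e‖ₑ * ∫⁻ z in ball x (r + ‖e‖), ‖fderiv ℝ v z‖ₑ ∂μ := by simp

theorem lintegral_ball_lintegral_ball_enorm_sub_le (μ : Measure E) [μ.IsAddHaarMeasure]
    (hv : ContDiff ℝ 1 v) (x : E) (r : ℝ) :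
    ∫⁻ z in ball x r, ∫⁻ w in ball x r, ‖v w - v z‖ₑ ∂μ ∂μ ≤
      μ (ball 0 (2 * r)) * (ENNReal.ofReal (2 * r) *
        ∫⁻ w in ball x (3 * r), ‖fderiv ℝ v w‖ₑ ∂μ) := by
  have hcont : Continuous fun q : E × E ↦ ‖v (q.1 + q.2) - v q.1‖ₑ :=
    ((hv.continuous.comp (by fun_prop)).sub (hv.continuous.comp (by fun_prop))).enorm
  have hshift (z : E) (hz : z ∈ ball x r) : ∫⁻ w in ball x r, ‖v w - v z‖ₑ ∂μ ≤
      ∫⁻ e in ball 0 (2 * r), ‖v (z + e) - v z‖ₑ ∂μ := by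
    rw [← (measurePreserving_add_left μ z).setLIntegral_comp_preimage_emb
      (measurableEmbedding_addLeft z)]
    refine lintegral_mono_set fun e he ↦ ?_
    have := dist_triangle_right (z + e) z x
    rw [dist_self_add_left] at this
    exact mem_ball_zero_iff.2 (by linarith [mem_ball.1 hz, mem_ball.1 he])
  calc ∫⁻ z in ball x r, ∫⁻ w in ball x r, ‖v w - v z‖ₑ ∂μ ∂μ
      ≤ ∫⁻ z in ball x r, ∫⁻ e in ball 0 (2 * r), ‖v (z + e) - v z‖ₑ ∂μ ∂μ :=
        setLIntegral_mono' measurableSet_ball hshift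
    _ = ∫⁻ e in ball 0 (2 * r), ∫⁻ z in ball x r, ‖v (z + e) - v z‖ₑ ∂μ ∂μ :=
        lintegral_lintegral_swap hcont.aemeasurable
    _ ≤ ∫⁻ _ in ball (0 : E) (2 * r), ENNReal.ofReal (2 * r) *
          ∫⁻ w in ball x (3 * r), ‖fderiv ℝ v w‖ₑ ∂μ ∂μ := by
        refine setLIntegral_mono' measurableSet_ball fun e he ↦ ?_
        have he' : ‖e‖ < 2 * r := mem_ball_zero_iff.1 he
        refine (lintegral_ball_enorm_add_sub_le μ hv x e r).trans ?_
        rw [← ofReal_norm]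
        gcongr
        linarith
    _ = _ := by rw [setLIntegral_const, mul_comm]

end FundamentalTheorem

section Isoperimetry

variable {E : Type*} [NormedAddCommGroup E] [NormedSpace ℝ E] [FiniteDimensional ℝ E]
  [MeasurableSpace E] [BorelSpace E] {μ : Measure E} [μ.IsAddHaarMeasure]

theorem measure_ball_eq (x : E) {r : ℝ} (hr : 0 < r) :
    μ (ball x r) = ENNReal.ofReal r ^ finrank ℝ E * μ (ball 0 1) := by
  rw [Measure.addHaar_ball_of_pos μ x hr, ENNReal.ofReal_pow hr.le]

theorem measure_ball_two_mul (x : E) {r : ℝ} (hr : 0 < r) :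
    μ (ball x (2 * r)) = 2 ^ finrank ℝ E * μ (ball x r) := by
  rw [measure_ball_eq x hr, measure_ball_eq x (by positivity), ENNReal.ofReal_mul zero_le_two,
    mul_pow, ENNReal.ofReal_ofNat, mul_assoc]

theorem exists_radius_le [Nontrivial E] {c : ℝ≥0∞} (hc : c ≠ ⊤) :
    ∃ R : ℝ, ∀ (y : E) (r : ℝ), μ (ball y r) ≤ c → r ≤ R := by
  have : NoncompactSpace E := NormedSpace.noncompactSpace ℝ E
  have hlim : Tendsto (fun k : ℕ ↦ μ (ball 0 k)) atTop (𝓝 ⊤) := by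
    rw [← measure_univ_of_isAddLeftInvariant μ, ← iUnion_ball_nat (0 : E)]
    exact tendsto_measure_iUnion_atTop fun k l hkl ↦ ball_subset_ball (by exact_mod_cast hkl)
  obtain ⟨k, hk⟩ := (hlim.eventually (lt_mem_nhds hc.lt_top)).exists
  refine ⟨k, fun y r hr ↦ le_of_not_gt fun hkr ↦ hr.not_gt (hk.trans_le ?_)⟩
  rw [← Measure.addHaar_ball_center μ y]
  exact measure_mono (ball_subset_ball hkr.le)

theorem measure_mul_measure_le {v : E → ℝ} (hv : ContDiff ℝ 1 v) {x : E} {r : ℝ} {S T : Set E}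
    (hS : MeasurableSet S) (hT : MeasurableSet T) (hSx : S ⊆ ball x r) (hTx : T ⊆ ball x r)
    (hvS : ∀ z ∈ S, v z = 1) (hvT : ∀ z ∈ T, v z = 0) :
    μ S * μ T ≤ μ (ball 0 (2 * r)) * (ENNReal.ofReal (2 * r) *
      ∫⁻ w in ball x (3 * r), ‖fderiv ℝ v w‖ₑ ∂μ) :=
  calc μ S * μ T = ∫⁻ z in S, ∫⁻ w in T, ‖v w - v z‖ₑ ∂μ ∂μ := by
        have hinner (z : E) (hz : z ∈ S) : ∫⁻ w in T, ‖v w - v z‖ₑ ∂μ = μ T := by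
          rw [setLIntegral_congr_fun (g := fun _ ↦ 1) hT fun w hw ↦ by
            simp [hvS z hz, hvT w hw], setLIntegral_one]
        rw [setLIntegral_congr_fun hS hinner, setLIntegral_const, mul_comm]
    _ ≤ ∫⁻ z in ball x r, ∫⁻ w in ball x r, ‖v w - v z‖ₑ ∂μ ∂μ :=
        (lintegral_mono_set hSx).trans (lintegral_mono fun z ↦ lintegral_mono_set hTx)
    _ ≤ _ := lintegral_ball_lintegral_ball_enorm_sub_le μ hv x r

theorem ofReal_pow_mul_measure_ball_le [Nontrivial E] {v : E → ℝ} (hv : ContDiff ℝ 1 v) {y : E}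
    {r : ℝ} (hr : 0 < r) {a b : ℝ≥0∞} {S T : Set E} (hS : MeasurableSet S) (hT : MeasurableSet T)
    (hSy : S ⊆ ball y r) (hTy : T ⊆ ball y r)
    (hvS : ∀ z ∈ S, v z = 1) (hvT : ∀ z ∈ T, v z = 0) (hSa : μ (ball y r) ≤ a * μ S)
    (hTb : μ (ball y r) ≤ b * μ T) :
    ENNReal.ofReal r ^ (finrank ℝ E - 1) * μ (ball 0 1) ≤
      a * b * 2 ^ (finrank ℝ E + 1) * ∫⁻ w in ball y (3 * r), ‖fderiv ℝ v w‖ₑ ∂μ := by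
  set I := ∫⁻ w in ball y (3 * r), ‖fderiv ℝ v w‖ₑ ∂μ
  have hball : μ (ball y r) * μ (ball y r) ≤
      μ (ball y r) * (a * b * 2 ^ (finrank ℝ E + 1) * (ENNReal.ofReal r * I)) :=
    calc μ (ball y r) * μ (ball y r) ≤ (a * μ S) * (b * μ T) := mul_le_mul' hSa hTb
      _ = a * b * (μ S * μ T) := by ring
      _ ≤ a * b * (μ (ball 0 (2 * r)) * (ENNReal.ofReal (2 * r) * I)) :=
          mul_le_mul_right (measure_mul_measure_le hv hS hT hSy hTy hvS hvT) _
      _ = _ := by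
          rw [measure_ball_two_mul 0 hr, Measure.addHaar_ball_center μ y,
            ENNReal.ofReal_mul zero_le_two, ENNReal.ofReal_ofNat]
          ring
  have hpos : μ (ball y r) ≠ 0 := (measure_ball_pos μ y hr).ne'
  rw [ENNReal.mul_le_mul_iff_right hpos measure_ball_lt_top.ne, measure_ball_eq y hr,
    ← mul_pow_sub_one finrank_pos.ne' (ENNReal.ofReal r)] at hball
  refine (ENNReal.mul_le_mul_iff_right (ENNReal.ofReal_pos.2 hr).ne' ENNReal.ofReal_ne_top).1 ?_
  calc _ = _ := (mul_assoc _ _ _).symm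
    _ ≤ _ := hball
    _ = _ := by ring

theorem exists_radius_of_intermediate_density [Nontrivial E] {S : Set E} (hS : IsOpen S)
    (hfin : μ S ≠ ⊤) {y : E} (hy : y ∈ S) :
    ∃ r : ℝ, 0 < r ∧ 2 * μ (S ∩ ball y r) ≤ μ (ball y r) ∧
      μ (ball y r) < 2 ^ (finrank ℝ E + 1) * μ (S ∩ ball y r) := by
  let D : Set ℝ := {r | 0 < r ∧ μ (ball y r) < 2 * μ (S ∩ ball y r)}
  obtain ⟨ε, hε, hball⟩ := Metric.isOpen_iff.1 hS y hy
  have hεD : ε ∈ D := by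
    refine ⟨hε, ?_⟩
    rw [Set.inter_eq_right.2 hball, two_mul]
    exact ENNReal.lt_add_right measure_ball_lt_top.ne (measure_ball_pos μ y hε).ne'
  have hbdd : BddAbove D := by
    obtain ⟨R, hR⟩ := exists_radius_le (μ := μ) (c := 2 * μ S) (ENNReal.mul_ne_top (by simp) hfin)
    exact ⟨R, fun r hr ↦ hR y r (hr.2.le.trans (by gcongr; exact Set.inter_subset_left))⟩
  have hsup : 0 < sSup D := hε.trans_le (le_csSup hbdd hεD)
  obtain ⟨r, ⟨hr, hrD⟩, hlt⟩ := exists_lt_of_lt_csSup ⟨ε, hεD⟩ (half_lt_self hsup)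
  have h2r : 0 < 2 * r := by positivity
  refine ⟨2 * r, h2r, ?_, ?_⟩
  · exact not_lt.1 fun h ↦ (le_csSup hbdd ⟨h2r, h⟩).not_gt (by linarith)
  · calc μ (ball y (2 * r)) = 2 ^ finrank ℝ E * μ (ball y r) := measure_ball_two_mul y hr
      _ < 2 ^ finrank ℝ E * (2 * μ (S ∩ ball y r)) :=
          (ENNReal.mul_lt_mul_iff_right (by simp) (by simp)).2 hrD
      _ = 2 ^ (finrank ℝ E + 1) * μ (S ∩ ball y r) := by ring
      _ ≤ _ := by gcongr; linarith

end Isoperimetry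

section Covering

variable {X : Type*} [PseudoMetricSpace X]

theorem exists_countable_disjoint_balls_cover [TopologicalSpace.SeparableSpace X] {S : Set X}
    {r : X → ℝ} {R : ℝ} (hr : ∀ y ∈ S, 0 < r y) (hR : ∀ y ∈ S, r y ≤ R) :
    ∃ u ⊆ S, u.Countable ∧ (u.PairwiseDisjoint fun y ↦ ball y (r y)) ∧
      S ⊆ ⋃ b ∈ u, ball b (6 * r b) := by
  obtain ⟨u, huS, hdisj, hcover⟩ :=
    Vitali.exists_disjoint_subfamily_covering_enlargement_closedBall S id r R hR 5 (by norm_num)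
  have hdisj' : u.PairwiseDisjoint fun y ↦ ball y (r y) :=
    hdisj.mono fun y ↦ ball_subset_closedBall
  refine ⟨u, huS, ?_, hdisj', fun y hy ↦ ?_⟩
  · exact hdisj'.countable_of_isOpen (fun _ _ ↦ isOpen_ball)
      fun y hy ↦ nonempty_ball.2 (hr y (huS hy))
  · obtain ⟨b, hb, hyb⟩ := hcover y hy
    have hrb := hr b (huS hb)
    exact Set.mem_biUnion hb (closedBall_subset_ball (by linarith)
      (hyb (mem_closedBall_self (hr y hy).le)))

theorem measure_ball_le_two_mul_measure_sdiff [ProperSpace X] [MeasurableSpace X] {μ : Measure X}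
    [IsFiniteMeasureOnCompacts μ] {S : Set X} (hS : MeasurableSet S) {y : X} {r : ℝ}
    (h : 2 * μ (S ∩ ball y r) ≤ μ (ball y r)) : μ (ball y r) ≤ 2 * μ (ball y r \ S) := by
  refine (ENNReal.add_le_add_iff_left (measure_ball_lt_top (μ := μ) (x := y) (r := r)).ne).1 ?_
  calc μ (ball y r) + μ (ball y r) = 2 * μ (S ∩ ball y r) + 2 * μ (ball y r \ S) := by
        rw [← two_mul, ← mul_add, Set.inter_comm, measure_inter_add_sdiff _ hS]
    _ ≤ μ (ball y r) + 2 * μ (ball y r \ S) := by gcongr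

/-- Upper Ahlfors regularity of dimension `d`, with constant `A`. -/
def UpperRegular [MeasurableSpace X] (d : ℕ) (ν : Measure X) (A : ℝ≥0) : Prop :=
  ∀ (x : X) (r : ℝ), 0 < r → ν (ball x r) ≤ A * ENNReal.ofReal r ^ d

end Covering

theorem tendsto_measure_superlevel_inter {X : Type*} [MeasurableSpace X] (μ : Measure X)
    (f : X → ℝ) (s : ℝ) (B : Set X) :
    Tendsto (fun k : ℕ ↦ μ ({z | 1 ≤ k * (f z - s)} ∩ B)) atTop (𝓝 (μ ({z | s < f z} ∩ B))) := by
  have hpos {k : ℕ} {z : X} (hz : 1 ≤ k * (f z - s)) : 0 < f z - s :=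
    pos_of_mul_pos_right (zero_lt_one.trans_le hz) k.cast_nonneg
  have hmono : Monotone fun k : ℕ ↦ {z | 1 ≤ k * (f z - s)} ∩ B := fun k l hkl z ⟨hz, hzB⟩ ↦
    ⟨hz.trans (mul_le_mul_of_nonneg_right (by exact_mod_cast hkl) (hpos hz).le), hzB⟩
  have hunion : ⋃ k : ℕ, {z | 1 ≤ k * (f z - s)} ∩ B = {z | s < f z} ∩ B := by
    rw [← Set.iUnion_inter]
    congr 1
    ext z
    simp only [Set.mem_iUnion, Set.mem_ofPred_eq]
    refine ⟨fun ⟨k, hk⟩ ↦ sub_pos.1 (hpos hk), fun hz ↦ ?_⟩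
    obtain ⟨k, hk⟩ := exists_nat_gt (1 / (f z - s))
    exact ⟨k, ((div_lt_iff₀ (sub_pos.2 hz)).1 hk).le⟩
  rw [← hunion]
  exact tendsto_measure_iUnion_atTop hmono

section LevelCutoff

variable {E : Type*} [NormedAddCommGroup E] [NormedSpace ℝ E] {f : E → ℝ}

/-- A `C¹` approximation of the indicator of the superlevel set `{s < f}`: it vanishes on
`{f ≤ s}` and, for `k ≥ 1`, equals `1` on `{s + 1 / k ≤ f}`. -/
def levelCutoff (f : E → ℝ) (k : ℕ) (s : ℝ) (z : E) : ℝ :=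
  Real.smoothTransition (k * (f z - s))

theorem contDiff_levelCutoff (hf : ContDiff ℝ 1 f) (k : ℕ) (s : ℝ) :
    ContDiff ℝ 1 (levelCutoff f k s) :=
  Real.smoothTransition.contDiff.comp (contDiff_const.mul (hf.sub contDiff_const))

theorem enorm_fderiv_levelCutoff (hf : ContDiff ℝ 1 f) (k : ℕ) (s : ℝ) (z : E) :
    ‖fderiv ℝ (levelCutoff f k s) z‖ₑ =
      k * ‖deriv Real.smoothTransition (k * (f z - s))‖ₑ * ‖fderiv ℝ f z‖ₑ := by
  have hinner : HasFDerivAt (fun z ↦ (k : ℝ) * (f z - s)) ((k : ℝ) • fderiv ℝ f z) z :=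
    ((hf.differentiable one_ne_zero z).hasFDerivAt.sub_const s).const_mul _
  have houter : HasDerivAt Real.smoothTransition (deriv Real.smoothTransition (k * (f z - s)))
      (k * (f z - s)) :=
    ((Real.smoothTransition.contDiff (n := 1)).differentiable one_ne_zero _).hasDerivAt
  have hcomp : fderiv ℝ (levelCutoff f k s) z =
      deriv Real.smoothTransition (k * (f z - s)) • ((k : ℝ) • fderiv ℝ f z) :=
    HasFDerivAt.fderiv (houter.comp_hasFDerivAt_of_eq z hinner rfl)
  rw [hcomp, enorm_smul, enorm_smul, Real.enorm_natCast]
  ring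

theorem integrable_deriv_smoothTransition : Integrable (deriv Real.smoothTransition) := by
  refine Continuous.integrable_of_hasCompactSupport
    ((Real.smoothTransition.contDiff (n := 1)).continuous_deriv le_rfl)
    (HasCompactSupport.intro (isCompact_Icc (a := (0 : ℝ)) (b := 1)) fun x hx ↦ ?_)
  rcases not_and_or.1 hx with hx | hx
  · refine IsLocalMin.deriv_eq_zero (Eventually.of_forall fun z ↦ ?_)
    rw [Real.smoothTransition.zero_of_nonpos (not_le.1 hx).le]
    exact Real.smoothTransition.nonneg z
  · refine IsLocalMax.deriv_eq_zero (Eventually.of_forall fun z ↦ ?_)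
    rw [Real.smoothTransition.one_of_one_le (not_le.1 hx).le]
    exact Real.smoothTransition.le_one z

theorem lintegral_mul_comp_mul_sub_le {h : ℝ → ℝ≥0∞} (hh : Measurable h) (k : ℕ) (a : ℝ) :
    ∫⁻ s, k * h (k * (a - s)) ≤ ∫⁻ s, h s := by
  rcases Nat.eq_zero_or_pos k with rfl | hk
  · simp
  have hk' : (k : ℝ) ≠ 0 := by exact_mod_cast hk.ne'
  have hscale : ∫⁻ s, h (k * s) = ∫⁻ s, h s ∂volume.map ((k : ℝ) * ·) :=
    (lintegral_map hh (measurable_const_mul _)).symm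
  refine le_of_eq ?_
  rw [lintegral_sub_left_eq_self (fun s ↦ k * h (k * s)) a,
    lintegral_const_mul' _ _ (by simp), hscale]
  nth_rw 2 [← Real.smul_map_volume_mul_left hk']
  rw [lintegral_smul_measure, Nat.abs_cast, ENNReal.ofReal_natCast, smul_eq_mul]

variable [MeasurableSpace E] [BorelSpace E] [FiniteDimensional ℝ E]

theorem measurable_enorm_fderiv_levelCutoff (hf : ContDiff ℝ 1 f) (k : ℕ) :
    Measurable fun q : ℝ × E ↦ ‖fderiv ℝ (levelCutoff f k q.1) q.2‖ₑ := by
  have hψ := (Real.smoothTransition.contDiff (n := 1)).continuous_deriv le_rfl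
  have hf' := hf.continuous_fderiv one_ne_zero
  have hc := hf.continuous
  simp only [enorm_fderiv_levelCutoff hf]
  exact (measurable_const.mul (hψ.comp (by fun_prop)).enorm.measurable).mul
    (hf'.comp continuous_snd).enorm.measurable

/-- One half of the coarea formula, with smoothed level sets. -/
theorem lintegral_lintegral_enorm_fderiv_levelCutoff_le (μ : Measure E) [SFinite μ]
    (hf : ContDiff ℝ 1 f) (k : ℕ) :
    ∫⁻ s, ∫⁻ z, ‖fderiv ℝ (levelCutoff f k s) z‖ₑ ∂μ ≤
      (∫⁻ x, ‖deriv Real.smoothTransition x‖ₑ) * ∫⁻ z, ‖fderiv ℝ f z‖ₑ ∂μ := by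
  have hψ := (Real.smoothTransition.contDiff (n := 1)).continuous_deriv le_rfl
  rw [lintegral_lintegral_swap (measurable_enorm_fderiv_levelCutoff hf k).aemeasurable,
    ← lintegral_const_mul _ (hf.continuous_fderiv one_ne_zero).enorm.measurable]
  refine lintegral_mono fun z ↦ ?_
  simp only [enorm_fderiv_levelCutoff hf]
  rw [lintegral_mul_const' _ _ enorm_ne_top]
  exact mul_le_mul_left (lintegral_mul_comp_mul_sub_le hψ.enorm.measurable k (f z)) _

end LevelCutoff

section Boxing

variable {E : Type*} [NormedAddCommGroup E] [NormedSpace ℝ E] [FiniteDimensional ℝ E]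
  [Nontrivial E] [MeasurableSpace E] [BorelSpace E] {μ : Measure E} [μ.IsAddHaarMeasure]
  {f : E → ℝ}

theorem eventually_ofReal_pow_mul_measure_ball_le (hf : ContDiff ℝ 1 f) {s : ℝ} {y : E} {r : ℝ}
    (hr : 0 < r) (hupper : 2 * μ ({z | s < f z} ∩ ball y r) ≤ μ (ball y r))
    (hlower : μ (ball y r) < 2 ^ (finrank ℝ E + 1) * μ ({z | s < f z} ∩ ball y r)) :
    ∀ᶠ k : ℕ in atTop, ENNReal.ofReal r ^ (finrank ℝ E - 1) * μ (ball 0 1) ≤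
      2 ^ (2 * finrank ℝ E + 3) * ∫⁻ w in ball y (3 * r), ‖fderiv ℝ (levelCutoff f k s) w‖ₑ ∂μ := by
  have hc := hf.continuous
  have hlim := ENNReal.Tendsto.const_mul (a := 2 ^ (finrank ℝ E + 1))
    (tendsto_measure_superlevel_inter μ f s (ball y r)) (Or.inr (by simp))
  filter_upwards [hlim.eventually (lt_mem_nhds hlower)] with k hk
  have hD : MeasurableSet ({z | 1 ≤ k * (f z - s)} ∩ ball y r) :=
    (isClosed_le (by fun_prop) (by fun_prop)).measurableSet.inter measurableSet_ball
  have hS : MeasurableSet {z | s < f z} := measurableSet_lt measurable_const hc.measurable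
  refine (ofReal_pow_mul_measure_ball_le (contDiff_levelCutoff hf k s) hr hD
    (measurableSet_ball.diff hS) Set.inter_subset_right Set.sdiff_subset
    (fun z hz ↦ Real.smoothTransition.one_of_one_le hz.1)
    (fun z hz ↦ Real.smoothTransition.zero_of_nonpos (mul_nonpos_of_nonneg_of_nonpos
      k.cast_nonneg (sub_nonpos.2 (not_lt.1 hz.2)))) hk.le
    (measure_ball_le_two_mul_measure_sdiff hS hupper)).trans_eq ?_
  ring

theorem tsum_ofReal_pow_mul_measure_ball_le (hf : ContDiff ℝ 1 f) {s : ℝ} {u : Set E} {r : E → ℝ}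
    (hr : ∀ y ∈ u, 0 < r y) (hdisj : u.PairwiseDisjoint fun y ↦ ball y (3 * r y))
    (hupper : ∀ y ∈ u, 2 * μ ({z | s < f z} ∩ ball y (r y)) ≤ μ (ball y (r y)))
    (hlower : ∀ y ∈ u,
      μ (ball y (r y)) < 2 ^ (finrank ℝ E + 1) * μ ({z | s < f z} ∩ ball y (r y))) :
    ∑' y : u, ENNReal.ofReal (r y) ^ (finrank ℝ E - 1) * μ (ball 0 1) ≤
      2 ^ (2 * finrank ℝ E + 3) *
        liminf (fun k ↦ ∫⁻ z, ‖fderiv ℝ (levelCutoff f k s) z‖ₑ ∂μ) atTop := by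
  rw [ENNReal.tsum_eq_iSup_sum, ← ENNReal.liminf_const_mul_of_ne_top (by simp)]
  refine iSup_le fun F ↦ le_liminf_of_le (by isBoundedDefault) ?_
  have hall : ∀ᶠ k : ℕ in atTop, ∀ y ∈ F,
      ENNReal.ofReal (r y) ^ (finrank ℝ E - 1) * μ (ball 0 1) ≤ 2 ^ (2 * finrank ℝ E + 3) *
        ∫⁻ w in ball (y : E) (3 * r y), ‖fderiv ℝ (levelCutoff f k s) w‖ₑ ∂μ :=
    (Filter.eventually_all_finset F).2 fun y _ ↦ eventually_ofReal_pow_mul_measure_ball_le hf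
      (hr y y.2) (hupper y y.2) (hlower y y.2)
  filter_upwards [hall] with k hk
  refine (Finset.sum_le_sum hk).trans ?_
  have hdisjF : (F : Set u).PairwiseDisjoint fun y ↦ ball (y : E) (3 * r y) :=
    fun a _ b _ hab ↦ hdisj a.2 b.2 fun h ↦ hab (Subtype.ext h)
  rw [← Finset.mul_sum, ← lintegral_biUnion_finset hdisjF fun _ _ ↦ measurableSet_ball]
  exact mul_le_mul_right (setLIntegral_le_lintegral _ _) _

/-- Cover `{s < f}` by balls of intermediate density; each of them meets the boundary of the
superlevel set in an amount comparable with `r ^ (d - 1)`. -/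
theorem measure_superlevel_le {ν : Measure E} {A : ℝ≥0} (hν : UpperRegular (finrank ℝ E - 1) ν A)
    (hf : ContDiff ℝ 1 f) {s : ℝ} (hfin : μ {z | s < f z} ≠ ⊤) :
    ν {z | s < f z} * μ (ball 0 1) ≤ 18 ^ (finrank ℝ E - 1) * 2 ^ (2 * finrank ℝ E + 3) * A *
      liminf (fun k ↦ ∫⁻ z, ‖fderiv ℝ (levelCutoff f k s) z‖ₑ ∂μ) atTop := by
  set S := {z | s < f z}
  have hS : IsOpen S := isOpen_lt continuous_const hf.continuous
  choose! r hr hupper hlower using fun y (hy : y ∈ S) ↦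
    exists_radius_of_intermediate_density hS hfin hy
  obtain ⟨R, hR⟩ := exists_radius_le (μ := μ) (c := 2 ^ (finrank ℝ E + 1) * μ S)
    (ENNReal.mul_ne_top (by simp) hfin)
  have hrR (y : E) (hy : y ∈ S) : r y ≤ R :=
    hR y (r y) ((hlower y hy).le.trans (by gcongr; exact Set.inter_subset_left))
  obtain ⟨u, huS, hcount, hdisj, hcover⟩ := exists_countable_disjoint_balls_cover
    (r := fun y ↦ 3 * r y) (R := 3 * R) (fun y hy ↦ by have := hr y hy; positivity)
    (fun y hy ↦ by have := hrR y hy; linarith)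
  have hball (y : u) : ν (ball y (6 * (3 * r y))) ≤
      18 ^ (finrank ℝ E - 1) * A * ENNReal.ofReal (r y) ^ (finrank ℝ E - 1) := by
    have h0 := hr y (huS y.2)
    refine (hν y _ (by positivity)).trans_eq ?_
    rw [← mul_assoc 6, ENNReal.ofReal_mul (by norm_num), mul_pow]
    norm_num
    ring
  calc ν S * μ (ball 0 1)
      ≤ (∑' y : u, 18 ^ (finrank ℝ E - 1) * A * ENNReal.ofReal (r y) ^ (finrank ℝ E - 1)) *
          μ (ball 0 1) := by
        gcongr
        exact (measure_mono hcover).trans ((measure_biUnion_le ν hcount _).trans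
          (ENNReal.tsum_le_tsum hball))
    _ = 18 ^ (finrank ℝ E - 1) * A *
          ∑' y : u, ENNReal.ofReal (r y) ^ (finrank ℝ E - 1) * μ (ball 0 1) := by
        rw [ENNReal.tsum_mul_left, ENNReal.tsum_mul_right, mul_assoc]
    _ ≤ 18 ^ (finrank ℝ E - 1) * A * (2 ^ (2 * finrank ℝ E + 3) *
          liminf (fun k ↦ ∫⁻ z, ‖fderiv ℝ (levelCutoff f k s) z‖ₑ ∂μ) atTop) := by
        gcongr
        exact tsum_ofReal_pow_mul_measure_ball_le hf (fun y hy ↦ hr y (huS hy)) hdisj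
          (fun y hy ↦ hupper y (huS hy)) (fun y hy ↦ hlower y (huS hy))
    _ = _ := by ring

theorem lintegral_Ioi_measure_superlevel_le {ν : Measure E} {A : ℝ≥0}
    (hν : UpperRegular (finrank ℝ E - 1) ν A) (hf : ContDiff ℝ 1 f) (hfc : HasCompactSupport f) :
    (∫⁻ t in Set.Ioi (0 : ℝ), ν {z | t < f z}) * μ (ball 0 1) ≤
      18 ^ (finrank ℝ E - 1) * 2 ^ (2 * finrank ℝ E + 3) * A *
        ((∫⁻ x, ‖deriv Real.smoothTransition x‖ₑ) * ∫⁻ z, ‖fderiv ℝ f z‖ₑ ∂μ) := by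
  have hfin (t : ℝ) (ht : 0 < t) : μ {z | t < f z} ≠ ⊤ :=
    measure_ne_top_of_subset
      (fun z hz ↦ subset_tsupport f (Function.mem_support.2 (ht.trans hz).ne'))
      hfc.isCompact.measure_lt_top.ne
  rw [← lintegral_mul_const' _ _ measure_ball_lt_top.ne]
  calc ∫⁻ t in Set.Ioi (0 : ℝ), ν {z | t < f z} * μ (ball 0 1)
      ≤ ∫⁻ t in Set.Ioi (0 : ℝ), 18 ^ (finrank ℝ E - 1) * 2 ^ (2 * finrank ℝ E + 3) * A *
          liminf (fun k ↦ ∫⁻ z, ‖fderiv ℝ (levelCutoff f k t) z‖ₑ ∂μ) atTop :=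
        setLIntegral_mono' measurableSet_Ioi fun t ht ↦ measure_superlevel_le hν hf (hfin t ht)
    _ ≤ ∫⁻ t, 18 ^ (finrank ℝ E - 1) * 2 ^ (2 * finrank ℝ E + 3) * A *
          liminf (fun k ↦ ∫⁻ z, ‖fderiv ℝ (levelCutoff f k t) z‖ₑ ∂μ) atTop :=
        setLIntegral_le_lintegral _ _
    _ = 18 ^ (finrank ℝ E - 1) * 2 ^ (2 * finrank ℝ E + 3) * A *
          ∫⁻ t, liminf (fun k ↦ ∫⁻ z, ‖fderiv ℝ (levelCutoff f k t) z‖ₑ ∂μ) atTop :=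
        lintegral_const_mul' _ _ (by finiteness)
    _ ≤ 18 ^ (finrank ℝ E - 1) * 2 ^ (2 * finrank ℝ E + 3) * A *
          liminf (fun k ↦ ∫⁻ t, ∫⁻ z, ‖fderiv ℝ (levelCutoff f k t) z‖ₑ ∂μ) atTop := by
        gcongr
        exact lintegral_liminf_le fun k ↦
          (measurable_enorm_fderiv_levelCutoff hf k).lintegral_prod_right'
    _ ≤ _ := by
        gcongr
        exact liminf_le_of_frequently_le'
          (Frequently.of_forall (lintegral_lintegral_enorm_fderiv_levelCutoff_le μ hf))

/-- The Meyers–Ziemer trace inequality. -/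
theorem exists_lintegral_enorm_le_lintegral_enorm_fderiv (μ : Measure E) [μ.IsAddHaarMeasure] :
    ∃ C : ℝ≥0, ∀ (ν : Measure E) (A : ℝ≥0), UpperRegular (finrank ℝ E - 1) ν A →
      ∀ f : E → ℝ, ContDiff ℝ 1 f → HasCompactSupport f →
        ∫⁻ z, ‖f z‖ₑ ∂ν ≤ C * A * ∫⁻ z, ‖fderiv ℝ f z‖ₑ ∂μ := by
  set V := ∫⁻ x, ‖deriv Real.smoothTransition x‖ₑ
  have hV : V ≠ ⊤ := integrable_deriv_smoothTransition.2.ne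
  have hω : μ (ball 0 1) ≠ 0 := (measure_ball_pos μ 0 one_pos).ne'
  set C : ℝ≥0∞ := 2 * 18 ^ (finrank ℝ E - 1) * 2 ^ (2 * finrank ℝ E + 3) * V / μ (ball 0 1) with hC
  have hC_top : C ≠ ⊤ := by finiteness
  refine ⟨C.toNNReal, fun ν A hν f hf hfc ↦ ?_⟩
  have hlayer : ∫⁻ z, ‖f z‖ₑ ∂ν ≤
      (∫⁻ t in Set.Ioi (0 : ℝ), ν {z | t < f z}) + ∫⁻ t in Set.Ioi (0 : ℝ), ν {z | t < -f z} := by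
    have hmeas : Measurable fun t : ℝ ↦ ν {z | t < f z} :=
      Antitone.measurable fun t t' htt' ↦ measure_mono fun z hz ↦ lt_of_le_of_lt htt' hz
    simp only [Real.enorm_eq_ofReal_abs]
    rw [lintegral_eq_lintegral_meas_lt ν (Eventually.of_forall fun z ↦ abs_nonneg (f z))
      hf.continuous.abs.measurable.aemeasurable, ← lintegral_add_left hmeas]
    refine lintegral_mono fun t ↦ ?_
    simp only [lt_abs, Set.ofPred_or]
    exact measure_union_le _ _
  have hneg : ∫⁻ z, ‖fderiv ℝ (fun z ↦ -f z) z‖ₑ ∂μ = ∫⁻ z, ‖fderiv ℝ f z‖ₑ ∂μ := by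
    simp only [fderiv_fun_neg, enorm_neg]
  have hplus := lintegral_Ioi_measure_superlevel_le (μ := μ) hν hf hfc
  have hminus := lintegral_Ioi_measure_superlevel_le (μ := μ) hν hf.neg hfc.neg
  rw [hneg] at hminus
  rw [ENNReal.coe_toNNReal hC_top, hC, ENNReal.div_eq_inv_mul, mul_assoc, mul_assoc,
    ← ENNReal.mul_le_iff_le_inv hω measure_ball_lt_top.ne, mul_comm]
  refine (mul_le_mul_left hlayer _).trans ?_
  rw [add_mul]
  exact (add_le_add hplus hminus).trans_eq (by ring)

end Boxing

section LocalTrace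

variable {E : Type*} [NormedAddCommGroup E] [NormedSpace ℝ E]

theorem enorm_fderiv_mul_le {v φ : E → ℝ} (hv : ContDiff ℝ 1 v) (hφ : ContDiff ℝ 1 φ) {B : Set E}
    {c : ℝ≥0∞} (hφB : ∀ z ∉ B, φ z = 0) (hφ01 : ∀ z, φ z ∈ Set.Icc 0 1)
    (hφc : ∀ z, ‖fderiv ℝ φ z‖ₑ ≤ c) (z : E) :
    ‖fderiv ℝ (fun z ↦ φ z * v z) z‖ₑ ≤
      B.indicator (fun z ↦ ‖fderiv ℝ v z‖ₑ + c * ‖v z‖ₑ) z := by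
  rw [fderiv_fun_mul (hφ.differentiable one_ne_zero z) (hv.differentiable one_ne_zero z)]
  by_cases hz : z ∈ B
  · have hφz : ‖φ z‖ₑ ≤ 1 := by
      rw [Real.enorm_of_nonneg (hφ01 z).1]
      exact ENNReal.ofReal_le_one.2 (hφ01 z).2
    rw [Set.indicator_of_mem hz]
    refine (enorm_add_le (φ z • fderiv ℝ v z) (v z • fderiv ℝ φ z)).trans ?_
    rw [enorm_smul, enorm_smul, mul_comm ‖v z‖ₑ]
    exact add_le_add (mul_le_of_le_one_left' hφz) (mul_le_mul_left (hφc z) _)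
  · have hfderiv : fderiv ℝ φ z = 0 := IsLocalMin.fderiv_eq_zero
      (Eventually.of_forall fun w ↦ (hφB z hz).trans_le (hφ01 w).1)
    rw [hφB z hz, hfderiv, zero_smul, smul_zero, add_zero, ← ofReal_norm, norm_zero,
      ENNReal.ofReal_zero]
    exact zero_le

variable [FiniteDimensional ℝ E]

variable (E) in
theorem exists_cutoff : ∃ K : ℝ≥0, ∀ (x : E) (L : ℝ), 0 < L → ∃ φ : E → ℝ, ContDiff ℝ 1 φ ∧
    (∀ z, φ z ∈ Set.Icc 0 1) ∧ (∀ z ∈ closedBall x L, φ z = 1) ∧ (∀ z ∉ ball x (2 * L), φ z = 0) ∧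
      ∀ z, ‖fderiv ℝ φ z‖ₑ ≤ K / ENNReal.ofReal L := by
  let b : ContDiffBump (0 : E) := ⟨1, 2, one_pos, one_lt_two⟩
  have hb : ContDiff ℝ 1 b := b.contDiff
  obtain ⟨K, hK⟩ := (hb.continuous_fderiv one_ne_zero).bounded_above_of_compact_support
    (b.hasCompactSupport.fderiv ℝ)
  refine ⟨K.toNNReal, fun x L hL ↦ ⟨fun z ↦ b (L⁻¹ • (z - x)), hb.comp (by fun_prop),
    fun z ↦ ⟨b.nonneg, b.le_one⟩, fun z hz ↦ b.one_of_mem_closedBall ?_,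
    fun z hz ↦ b.zero_of_le_dist ?_, fun z ↦ ?_⟩⟩
  · rw [mem_closedBall_zero_iff, norm_smul, norm_inv, Real.norm_of_nonneg hL.le,
      inv_mul_le_one₀ hL]
    exact mem_closedBall_iff_norm.1 hz
  · rw [dist_zero_right, norm_smul, norm_inv, Real.norm_of_nonneg hL.le, le_inv_mul_iff₀ hL,
      mul_comm]
    simpa [dist_eq_norm] using hz
  · have hderiv : fderiv ℝ (fun z ↦ b (L⁻¹ • (z - x))) z = L⁻¹ • fderiv ℝ b (L⁻¹ • (z - x)) := by
      rw [fderiv_comp_sub (f := fun z ↦ b (L⁻¹ • z)), fderiv_comp_smul]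
    rw [hderiv, enorm_smul, enorm_inv hL.ne', Real.enorm_of_nonneg hL.le,
      ← ENNReal.div_eq_inv_mul, ← ofReal_norm]
    exact ENNReal.div_le_div_right (ENNReal.ofReal_le_ofReal (hK _)) _

variable [Nontrivial E] [MeasurableSpace E] [BorelSpace E]

theorem exists_lintegral_enorm_le_of_closedBall (μ : Measure E) [μ.IsAddHaarMeasure] :
    ∃ C : ℝ≥0, ∀ (ν : Measure E) (A : ℝ≥0) (x : E) (L : ℝ), 0 < L →
      UpperRegular (finrank ℝ E - 1) ν A → ν (closedBall x L)ᶜ = 0 →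
      ∀ v : E → ℝ, ContDiff ℝ 1 v →
        ∫⁻ z, ‖v z‖ₑ ∂ν ≤ C * A * ((∫⁻ z in ball x (2 * L), ‖fderiv ℝ v z‖ₑ ∂μ) +
          (∫⁻ z in ball x (2 * L), ‖v z‖ₑ ∂μ) / ENNReal.ofReal L) := by
  obtain ⟨C₀, hC₀⟩ := exists_lintegral_enorm_le_lintegral_enorm_fderiv μ
  obtain ⟨K, hK⟩ := exists_cutoff E
  refine ⟨C₀ * (1 + K), fun ν A x L hL hν hsupp v hv ↦ ?_⟩
  obtain ⟨φ, hφ, hφ01, hφ1, hφ0, hφK⟩ := hK x L hL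
  have hcompact : HasCompactSupport fun z ↦ φ z * v z :=
    .intro (isCompact_closedBall x (2 * L)) fun z hz ↦ by
      rw [hφ0 z fun h ↦ hz (ball_subset_closedBall h), zero_mul]
  set I := ∫⁻ z in ball x (2 * L), ‖fderiv ℝ v z‖ₑ ∂μ
  set J := ∫⁻ z in ball x (2 * L), ‖v z‖ₑ ∂μ
  calc ∫⁻ z, ‖v z‖ₑ ∂ν = ∫⁻ z, ‖φ z * v z‖ₑ ∂ν := by
        refine lintegral_congr_ae ?_
        filter_upwards [show ∀ᵐ z ∂ν, z ∈ closedBall x L from hsupp] with z hz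
        rw [hφ1 z hz, one_mul]
    _ ≤ C₀ * A * ∫⁻ z, ‖fderiv ℝ (fun z ↦ φ z * v z) z‖ₑ ∂μ := hC₀ ν A hν _ (hφ.mul hv) hcompact
    _ ≤ C₀ * A * ∫⁻ z in ball x (2 * L), ‖fderiv ℝ v z‖ₑ + K / ENNReal.ofReal L * ‖v z‖ₑ ∂μ := by
        rw [← lintegral_indicator measurableSet_ball]
        exact mul_le_mul_right (lintegral_mono (enorm_fderiv_mul_le hv hφ hφ0 hφ01 hφK)) _
    _ = C₀ * A * (I + K * (J / ENNReal.ofReal L)) := by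
        rw [lintegral_add_left (hv.continuous_fderiv one_ne_zero).enorm.measurable,
          lintegral_const_mul _ hv.continuous.enorm.measurable, ← ENNReal.mul_div_right_comm,
          mul_div_assoc]
    _ ≤ C₀ * A * ((1 + K) * I + (1 + K) * (J / ENNReal.ofReal L)) := by
        gcongr
        · exact le_mul_of_one_le_left' le_self_add
        · exact le_add_self
    _ = _ := by
        push_cast
        ring

end LocalTrace

section Mollification

variable {E F : Type*} [NormedAddCommGroup E] [NormedSpace ℝ E] [FiniteDimensional ℝ E]
  [MeasurableSpace E] [NormedAddCommGroup F] [NormedSpace ℝ F] (μ : Measure E)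

variable (E) in
/-- A smooth bump function with support the closed ball of radius `1 / (k + 1)` around `0`. -/
def bump (k : ℕ) : ContDiffBump (0 : E) where
  rIn := 1 / (k + 1) / 2
  rOut := 1 / (k + 1)
  rIn_pos := by positivity
  rIn_lt_rOut := half_lt_self (by positivity)

/-- The standard mollifier at scale `1 / (k + 1)`. -/
def mollifier (k : ℕ) : E → ℝ := (bump E k).normed μ

/-- The probability measure whose density is the mollifier at scale `1 / (k + 1)`. -/
def mollifierMeasure (k : ℕ) : Measure E := μ.withDensity fun a ↦ ENNReal.ofReal (mollifier μ k a)

/-- The mollification of `f` at scale `1 / (k + 1)`. -/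
def mollify (k : ℕ) (f : E → F) : E → F :=
  convolution (mollifier μ k) f (ContinuousLinearMap.lsmul ℝ ℝ) μ

theorem contDiff_mollifier (k : ℕ) : ContDiff ℝ ∞ (mollifier μ k) := (bump E k).contDiff_normed

variable [BorelSpace E]

theorem measurable_ofReal_mollifier (k : ℕ) :
    Measurable fun a ↦ ENNReal.ofReal (mollifier μ k a) :=
  (contDiff_mollifier μ k).continuous.measurable.ennreal_ofReal

theorem mollify_eq_integral (k : ℕ) (f : E → F) (w : E) :
    mollify μ k f w = ∫ a, f (w - a) ∂mollifierMeasure μ k := by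
  rw [mollifierMeasure, integral_withDensity_eq_integral_toReal_smul
    (measurable_ofReal_mollifier μ k) (Eventually.of_forall fun _ ↦ ENNReal.ofReal_lt_top)]
  refine integral_congr_ae (Eventually.of_forall fun a ↦ ?_)
  have hnonneg : 0 ≤ mollifier μ k a := (bump E k).nonneg_normed a
  simp only [ContinuousLinearMap.lsmul_apply, ENNReal.toReal_ofReal hnonneg]

variable [μ.IsAddHaarMeasure]

theorem hasCompactSupport_mollifier (k : ℕ) : HasCompactSupport (mollifier μ k) :=
  (bump E k).hasCompactSupport_normed

instance (k : ℕ) : IsProbabilityMeasure (mollifierMeasure μ k) := by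
  refine ⟨?_⟩
  rw [mollifierMeasure, withDensity_apply _ .univ, Measure.restrict_univ,
    ← ofReal_integral_eq_lintegral_ofReal (f := mollifier μ k) (bump E k).integrable_normed
      (Eventually.of_forall (bump E k).nonneg_normed), mollifier, (bump E k).integral_normed,
    ENNReal.ofReal_one]

theorem ae_mollifierMeasure_norm_lt (k : ℕ) : ∀ᵐ a ∂mollifierMeasure μ k, ‖a‖ < 1 / (k + 1) := by
  rw [mollifierMeasure, ae_withDensity_iff (measurable_ofReal_mollifier μ k)]
  refine Eventually.of_forall fun a ha ↦ ?_
  have hsupp : a ∈ Function.support ((bump E k).normed μ) := fun h ↦ ha (by simp [mollifier, h])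
  rw [(bump E k).support_normed_eq] at hsupp
  simpa [bump] using hsupp

variable {μ}

theorem contDiff_mollify (k : ℕ) {f : E → F} (hf : LocallyIntegrable f μ) :
    ContDiff ℝ 1 (mollify μ k f) :=
  (hasCompactSupport_mollifier μ k).contDiff_convolution_left (n := 1) _
    ((contDiff_mollifier μ k).of_le (by simp)) hf

theorem convolutionExistsAt_mollifier (k : ℕ) {f : E → F} (hf : LocallyIntegrable f μ) (x : E) :
    ConvolutionExistsAt (mollifier μ k) f x (ContinuousLinearMap.lsmul ℝ ℝ) μ :=
  (hasCompactSupport_mollifier μ k).convolutionExists_left _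
    (contDiff_mollifier μ k).continuous hf x

theorem mollify_sub (k : ℕ) {f g : E → F} (hf : LocallyIntegrable f μ)
    (hg : LocallyIntegrable g μ) (x : E) :
    mollify μ k (f - g) x = mollify μ k f x - mollify μ k g x := by
  simp only [mollify, convolution, Pi.sub_apply, map_sub]
  exact integral_sub (convolutionExistsAt_mollifier k hf x) (convolutionExistsAt_mollifier k hg x)

theorem setLIntegral_lintegral_sub_le {m : Measure E} [IsProbabilityMeasure m] {H : E → ℝ≥0∞}
    (hH : AEMeasurable H μ) {S T : Set E}
    (hST : ∀ᵐ a ∂m, ∀ w ∈ S, w - a ∈ T) :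
    ∫⁻ w in S, ∫⁻ a, H (w - a) ∂m ∂μ ≤ ∫⁻ w in T, H w ∂μ := by
  have hmeas : AEMeasurable (fun q : E × E ↦ H (q.1 - q.2)) ((μ.restrict S).prod m) :=
    (hH.comp_quasiMeasurePreserving (quasiMeasurePreserving_sub_of_right_invariant μ m)).mono_ac
      (Measure.restrict_le_self.absolutelyContinuous.prod .rfl)
  rw [lintegral_lintegral_swap hmeas]
  calc ∫⁻ a, ∫⁻ w in S, H (w - a) ∂μ ∂m ≤ ∫⁻ _, ∫⁻ w in T, H w ∂μ ∂m := by
        refine lintegral_mono_ae (hST.mono fun a ha ↦ ?_)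
        refine (lintegral_mono_set ha).trans_eq ?_
        exact (measurePreserving_sub_right μ a).setLIntegral_comp_preimage_emb
          (measurableEmbedding_subRight a) H T
    _ = ∫⁻ w in T, H w ∂μ := by simp

theorem setLIntegral_ball_mollify_le (k : ℕ) {f : E → F} (hf : AEStronglyMeasurable f μ) (x : E)
    (L : ℝ) :
    ∫⁻ w in ball x L, ‖mollify μ k f w‖ₑ ∂μ ≤ ∫⁻ w in ball x (L + 1 / (k + 1)), ‖f w‖ₑ ∂μ := by
  calc ∫⁻ w in ball x L, ‖mollify μ k f w‖ₑ ∂μ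
      ≤ ∫⁻ w in ball x L, ∫⁻ a, ‖f (w - a)‖ₑ ∂mollifierMeasure μ k ∂μ :=
        lintegral_mono fun w ↦ by
          rw [mollify_eq_integral]
          exact enorm_integral_le_lintegral_enorm _
    _ ≤ _ := by
        refine setLIntegral_lintegral_sub_le hf.enorm
          ((ae_mollifierMeasure_norm_lt μ k).mono fun a ha w hw ↦ ?_)
        rw [mem_ball_iff_norm, sub_right_comm]
        exact (norm_sub_le _ _).trans_lt (add_lt_add (mem_ball_iff_norm.1 hw) ha)

/-- Jensen's inequality for the mollifier measure. -/
theorem lintegral_enorm_mollify_rpow_le {p : ℝ} (hp : 1 ≤ p) (k : ℕ) {f : E → F}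
    (hf : AEStronglyMeasurable f μ) :
    ∫⁻ w, ‖mollify μ k f w‖ₑ ^ p ∂μ ≤ ∫⁻ w, ‖f w‖ₑ ^ p ∂μ := by
  have hac : mollifierMeasure μ k ≪ μ := withDensity_absolutelyContinuous _ _
  have hjensen (w : E) : ‖mollify μ k f w‖ₑ ^ p ≤ ∫⁻ a, ‖f (w - a)‖ₑ ^ p ∂mollifierMeasure μ k := by
    have hmeas : AEStronglyMeasurable (fun a ↦ f (w - a)) (mollifierMeasure μ k) :=
      (hf.comp_quasiMeasurePreserving
        (quasiMeasurePreserving_sub_left_of_right_invariant μ w)).mono_ac hac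
    have hle := eLpNorm'_le_eLpNorm'_of_exponent_le one_pos hp _ hmeas
    simp only [eLpNorm', ENNReal.rpow_one, div_one] at hle
    rw [mollify_eq_integral, ← ENNReal.le_rpow_inv_iff (by positivity), ← one_div]
    exact (enorm_integral_le_lintegral_enorm _).trans hle
  refine (lintegral_mono hjensen).trans ?_
  simpa using setLIntegral_lintegral_sub_le (m := mollifierMeasure μ k)
    (hf.enorm.pow_const p) (S := .univ) (T := .univ) (by simp)

theorem tendsto_setLIntegral_mollify_sub_of_uniformContinuous [CompleteSpace F] {c : E → F}
    (hc : UniformContinuous c) (x : E) (L : ℝ) :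
    Tendsto (fun k ↦ ∫⁻ w in ball x L, ‖mollify μ k c w - c w‖ₑ ∂μ) atTop (𝓝 0) := by
  rw [ENNReal.tendsto_nhds_zero]
  intro ε hε
  obtain ⟨δ, hδ, hδε⟩ := ENNReal.exists_nnreal_pos_mul_lt
    (measure_ball_lt_top (μ := μ) (x := x) (r := L)).ne hε.ne'
  obtain ⟨η, hη, hcη⟩ := Metric.uniformContinuous_iff.1 hc δ hδ
  filter_upwards [tendsto_one_div_add_atTop_nhds_zero_nat.eventually (gt_mem_nhds hη)] with k hk
  have hclose (w : E) : ‖mollify μ k c w - c w‖ₑ ≤ δ := by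
    rw [← edist_eq_enorm_sub, edist_le_coe, ← NNReal.coe_le_coe, coe_nndist]
    refine (bump E k).dist_normed_convolution_le hc.continuous.aestronglyMeasurable fun z hz ↦ ?_
    exact (hcη (lt_trans (by simpa [bump] using hz) hk)).le
  calc ∫⁻ w in ball x L, ‖mollify μ k c w - c w‖ₑ ∂μ ≤ ∫⁻ _ in ball x L, δ ∂μ :=
        lintegral_mono hclose
    _ = δ * μ (ball x L) := setLIntegral_const _ _
    _ ≤ ε := hδε.le

theorem exists_continuous_hasCompactSupport_setLIntegral_sub_le {f : E → F}
    (hf : LocallyIntegrable f μ) (x : E) (L : ℝ) {ε : ℝ≥0∞} (hε : ε ≠ 0) :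
    ∃ c : E → F, HasCompactSupport c ∧ Continuous c ∧ ∫⁻ w in ball x L, ‖f w - c w‖ₑ ∂μ ≤ ε := by
  have hint : Integrable ((ball x L).indicator f) μ := by
    rw [integrable_indicator_iff measurableSet_ball]
    exact (hf.integrableOn_isCompact (isCompact_closedBall x L)).mono_set ball_subset_closedBall
  obtain ⟨c, hcs, hcε, hcc, -⟩ := hint.exists_hasCompactSupport_lintegral_sub_le hε
  refine ⟨c, hcs, hcc, (le_trans ?_ (setLIntegral_le_lintegral (ball x L) _)).trans hcε⟩
  refine setLIntegral_mono' measurableSet_ball fun w hw ↦ ?_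
  rw [Set.indicator_of_mem hw]

theorem tendsto_setLIntegral_mollify_sub [CompleteSpace F] {f : E → F}
    (hf : LocallyIntegrable f μ) (x : E) (L : ℝ) :
    Tendsto (fun k ↦ ∫⁻ w in ball x L, ‖mollify μ k f w - f w‖ₑ ∂μ) atTop (𝓝 0) := by
  rw [ENNReal.tendsto_nhds_zero]
  intro ε hε
  have hε3 : ε / 3 ≠ 0 := by simpa using hε.ne'
  obtain ⟨c, hcs, hcc, hcε⟩ :=
    exists_continuous_hasCompactSupport_setLIntegral_sub_le hf x (L + 1) hε3
  have hlim := tendsto_setLIntegral_mollify_sub_of_uniformContinuous (μ := μ)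
    (hcs.uniformContinuous_of_continuous hcc) x L
  filter_upwards [ENNReal.tendsto_nhds_zero.1 hlim _ hε3.bot_lt] with k hk
  have hmeas : AEStronglyMeasurable (f - c) μ :=
    hf.aestronglyMeasurable.sub hcc.aestronglyMeasurable
  have hmollifyMeas : AEMeasurable (fun w ↦ ‖mollify μ k (f - c) w‖ₑ) (μ.restrict (ball x L)) :=
    (contDiff_mollify k (hf.sub hcc.locallyIntegrable)).continuous.enorm.aemeasurable
  have hscale : (1 : ℝ) / (k + 1) ≤ 1 := (div_le_one (by positivity)).2 (by simp)
  have hmollify : ∫⁻ w in ball x L, ‖mollify μ k (f - c) w‖ₑ ∂μ ≤ ε / 3 :=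
    (setLIntegral_ball_mollify_le k hmeas x L).trans
      ((lintegral_mono_set (ball_subset_ball (by linarith))).trans hcε)
  have hsub : ∫⁻ w in ball x L, ‖(f - c) w‖ₑ ∂μ ≤ ε / 3 :=
    (lintegral_mono_set (ball_subset_ball (by linarith))).trans hcε
  calc ∫⁻ w in ball x L, ‖mollify μ k f w - f w‖ₑ ∂μ
      ≤ ∫⁻ w in ball x L, (‖mollify μ k (f - c) w‖ₑ + ‖(f - c) w‖ₑ +
          ‖mollify μ k c w - c w‖ₑ) ∂μ := by
        refine lintegral_mono fun w ↦ ?_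
        have hsplit : mollify μ k f w - f w =
            mollify μ k (f - c) w - (f - c) w + (mollify μ k c w - c w) := by
          rw [mollify_sub k hf hcc.locallyIntegrable, Pi.sub_apply]
          abel
        rw [hsplit]
        exact (enorm_add_le _ _).trans (add_le_add enorm_sub_le le_rfl)
    _ ≤ (∫⁻ w in ball x L, ‖mollify μ k (f - c) w‖ₑ ∂μ) + (∫⁻ w in ball x L, ‖(f - c) w‖ₑ ∂μ) +
          ∫⁻ w in ball x L, ‖mollify μ k c w - c w‖ₑ ∂μ := by
        have hadd := hmollifyMeas.add hmeas.restrict.enorm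
        refine (lintegral_add_left' hadd _).trans_le ?_
        simp only [Pi.add_apply]
        rw [lintegral_add_left' hmollifyMeas]
    _ ≤ ε / 3 + ε / 3 + ε / 3 := by gcongr
    _ = ε := ENNReal.add_thirds ε

theorem tendsto_setAverage_mollify [CompleteSpace F] {u : E → F} (hu : LocallyIntegrable u μ)
    (y : E) (r : ℝ) :
    Tendsto (fun k ↦ ⨍ w in ball y r, mollify μ k u w ∂μ) atTop (𝓝 (⨍ w in ball y r, u w ∂μ)) := by
  have hball {f : E → F} (hf : LocallyIntegrable f μ) : IntegrableOn f (ball y r) μ :=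
    (hf.integrableOn_isCompact (isCompact_closedBall y r)).mono_set ball_subset_closedBall
  simp only [setAverage_eq]
  refine Tendsto.const_smul ?_ _
  exact tendsto_integral_of_L1 _ (hball hu).aestronglyMeasurable
    (Eventually.of_forall fun k ↦ hball (contDiff_mollify k hu).continuous.locallyIntegrable)
    (tendsto_setLIntegral_mollify_sub hu y r)

end Mollification

section WeakGradient

variable {n : ℕ} {u : Rn n → ℝ} {g : Rn n → Rn n}

theorem IsWeakGradient.integral_mul_fderiv_comp_sub (h : IsWeakGradient u g) {φ : Rn n → ℝ}
    (hφ : ContDiff ℝ ∞ φ) (hφc : HasCompactSupport φ) (x e : Rn n) :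
    ∫ z, fderiv ℝ φ (x - z) e * u z = ∫ z, φ (x - z) * inner ℝ e (g z) := by
  have hweak := h.integral_eq (fun z ↦ φ (x - z)) (hφ.comp (by fun_prop))
    (hφc.comp_homeomorph (Homeomorph.subLeft x)) e
  have hderiv (z : Rn n) : fderiv ℝ (fun z ↦ φ (x - z)) z e = -fderiv ℝ φ (x - z) e := by
    have hcomp : HasFDerivAt (fun z ↦ φ (x - z)) _ z :=
      ((hφ.differentiable (by simp)) (x - z)).hasFDerivAt.comp z
        ((hasFDerivAt_id z).const_sub x)
    simp [hcomp.fderiv]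
  simp only [hderiv, mul_neg, integral_neg, neg_inj] at hweak
  simpa only [mul_comm, real_inner_comm] using hweak

theorem fderiv_mollify (h : IsWeakGradient u g) (k : ℕ) (x : Rn n) :
    fderiv ℝ (mollify volume k u) x = innerSL ℝ (mollify volume k g x) := by
  have hsupp := hasCompactSupport_mollifier (volume : Measure (Rn n)) k
  have hsmooth := contDiff_mollifier (volume : Measure (Rn n)) k
  have hsmooth₁ := hsmooth.of_le (m := 1) (by simp)
  have hderiv : HasFDerivAt (mollify volume k u) _ x :=
    hsupp.hasFDerivAt_convolution_left (ContinuousLinearMap.lsmul ℝ ℝ) hsmooth₁ h.locInt x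
  have hexists := (hsupp.fderiv ℝ).convolutionExists_left
    ((ContinuousLinearMap.lsmul ℝ ℝ).precompL (Rn n) : (Rn n →L[ℝ] ℝ) →L[ℝ] ℝ →L[ℝ] _)
    (hsmooth₁.continuous_fderiv one_ne_zero) h.locInt x
  rw [hderiv.fderiv]
  ext e
  calc _ = ∫ t, fderiv ℝ (mollifier volume k) t e * u (x - t) := by
        rw [convolution, ContinuousLinearMap.integral_apply hexists]
        rfl
    _ = ∫ z, fderiv ℝ (mollifier volume k) (x - z) e * u z := by
        simpa using (integral_sub_left_eq_self
          (fun z ↦ fderiv ℝ (mollifier volume k) (x - z) e * u z) volume x)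
    _ = ∫ z, mollifier volume k (x - z) * inner ℝ e (g z) :=
        h.integral_mul_fderiv_comp_sub hsmooth hsupp x e
    _ = ∫ t, inner ℝ e (mollifier volume k t • g (x - t)) := by
        simpa [real_inner_smul_right] using (integral_sub_left_eq_self
          (fun z ↦ mollifier volume k (x - z) * inner ℝ e (g z)) volume x).symm
    _ = innerSL ℝ (mollify volume k g x) e := by
        rw [innerSL_apply_apply, real_inner_comm]
        exact integral_inner (convolutionExistsAt_mollifier k h.locInt_grad x) e

theorem enorm_fderiv_mollify (h : IsWeakGradient u g) (k : ℕ) (x : Rn n) :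
    ‖fderiv ℝ (mollify volume k u) x‖ₑ = ‖mollify volume k g x‖ₑ := by
  rw [fderiv_mollify h, ← ofReal_norm, innerSL_apply_norm, ofReal_norm]

end WeakGradient

section PowerIntegrals

theorem lintegral_Ioc_rpow {e : ℝ} (he : -1 < e) {a : ℝ} (ha : 0 ≤ a) :
    ∫⁻ s in Set.Ioc 0 a, ENNReal.ofReal (s ^ e) = ENNReal.ofReal (a ^ (e + 1) / (e + 1)) := by
  have hint : IntervalIntegrable (fun s : ℝ ↦ s ^ e) volume 0 a :=
    intervalIntegral.intervalIntegrable_rpow' he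
  rw [← ofReal_integral_eq_lintegral_ofReal
    ((intervalIntegrable_iff_integrableOn_Ioc_of_le ha).1 hint)]
  · rw [← intervalIntegral.integral_of_le ha, integral_rpow (Or.inl he),
      Real.zero_rpow (by linarith), sub_zero]
  · filter_upwards [ae_restrict_mem measurableSet_Ioc] with s hs
    exact Real.rpow_nonneg hs.1.le _

theorem tendsto_lintegral_Ioc_rpow {e : ℝ} (he : -1 < e) :
    Tendsto (fun ρ : ℝ ↦ ∫⁻ s in Set.Ioc 0 ρ, ENNReal.ofReal (s ^ e)) (𝓝[>] 0) (𝓝 0) := by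
  have hcont : ContinuousAt (fun ρ : ℝ ↦ ENNReal.ofReal (ρ ^ (e + 1) / (e + 1))) 0 :=
    ENNReal.continuous_ofReal.continuousAt.comp
      ((Real.continuousAt_rpow_const _ _ (Or.inr (by linarith))).div_const _)
  have hlim := hcont.tendsto.mono_left (nhdsWithin_le_nhds (s := Set.Ioi 0))
  rw [Real.zero_rpow (by linarith), zero_div, ENNReal.ofReal_zero] at hlim
  refine hlim.congr' ?_
  filter_upwards [self_mem_nhdsWithin] with ρ hρ
  exact (lintegral_Ioc_rpow he hρ.le).symm

/-- Either `t ≤ l`, or `t = t ^ (1 - p) * t ^ p` with `t ^ (1 - p) ≤ l ^ (1 - p)`. -/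
theorem le_add_mul_rpow {p : ℝ} (hp : 1 < p) (t : ℝ≥0∞) {l : ℝ} (hl : 0 < l) :
    t ≤ ENNReal.ofReal l + ENNReal.ofReal (l ^ (1 - p)) * t ^ p := by
  rcases le_or_gt t (ENNReal.ofReal l) with htl | hlt
  · exact htl.trans le_self_add
  refine le_trans ?_ le_add_self
  rcases eq_or_ne t ⊤ with rfl | ht
  · rw [ENNReal.top_rpow_of_pos (by linarith), ENNReal.mul_top]
    simpa using Real.rpow_pos_of_pos hl _
  have ht₀ : t ≠ 0 := (zero_le.trans_lt hlt).ne'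
  calc t = t ^ (1 - p) * t ^ p := by
        rw [← ENNReal.rpow_add _ _ ht₀ ht, sub_add_cancel, ENNReal.rpow_one]
    _ ≤ ENNReal.ofReal (l ^ (1 - p)) * t ^ p := by
        rw [← ENNReal.ofReal_rpow_of_pos hl, ← neg_sub, ENNReal.rpow_neg, ENNReal.rpow_neg]
        gcongr

end PowerIntegrals

section RadialPotential

variable {E : Type*} [NormedAddCommGroup E] [NormedSpace ℝ E]
  [MeasurableSpace E] (μ : Measure E)

/-- The truncated potential `∫_r^ρ s⁻ᵈ ∫_{B(y,s)} h ds`, `d = dim E`. It controls the oscillation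
at `y` of a function whose gradient has norm `h`, and for `r = 0`, `ρ = ∞` it is a multiple of the
Riesz potential of order one. -/
def radialPotential (h : E → ℝ≥0∞) (r ρ : ℝ) (y : E) : ℝ≥0∞ :=
  ∫⁻ s in Set.Ioc r ρ, (ENNReal.ofReal s ^ finrank ℝ E)⁻¹ * ∫⁻ w in ball y s, h w ∂μ

variable {μ}

theorem radialPotential_mono {h h' : E → ℝ≥0∞} (hh : h ≤ h') {r ρ ρ' : ℝ}
    (hρ : ρ ≤ ρ') (y : E) : radialPotential μ h r ρ y ≤ radialPotential μ h' r ρ' y :=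
  (lintegral_mono_set (Set.Ioc_subset_Ioc_right hρ)).trans
    (lintegral_mono fun _ ↦ mul_le_mul_right (lintegral_mono hh) _)

theorem radialPotential_le_mul (h : E → ℝ≥0∞) (r ρ : ℝ) (x : E) :
    radialPotential μ h r ρ x ≤ (ENNReal.ofReal r ^ finrank ℝ E)⁻¹ * ENNReal.ofReal (ρ - r) *
      ∫⁻ w in ball x ρ, h w ∂μ := by
  calc radialPotential μ h r ρ x
      ≤ ∫⁻ _ in Set.Ioc r ρ, (ENNReal.ofReal r ^ finrank ℝ E)⁻¹ * ∫⁻ w in ball x ρ, h w ∂μ := by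
        refine setLIntegral_mono' measurableSet_Ioc fun s hs ↦ mul_le_mul' ?_
          (lintegral_mono_set (ball_subset_ball hs.2))
        have := hs.1.le
        gcongr
    _ = _ := by
        rw [setLIntegral_const, Real.volume_Ioc]
        ring

variable [FiniteDimensional ℝ E] [BorelSpace E]

theorem measurable_lintegral_ball [SFinite μ] {h : E → ℝ≥0∞} (hh : Measurable h) :
    Measurable fun q : E × ℝ ↦ ∫⁻ w in ball q.1 q.2, h w ∂μ := by
  have hset : MeasurableSet {q : (E × ℝ) × E | dist q.2 q.1.1 < q.1.2} :=
    (isOpen_lt (by fun_prop) (by fun_prop)).measurableSet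
  simp only [← lintegral_indicator measurableSet_ball]
  exact ((hh.comp measurable_snd).indicator hset).lintegral_prod_right'

theorem measurable_radialPotential_integrand [SFinite μ] {h : E → ℝ≥0∞} (hh : Measurable h) :
    Measurable fun q : E × ℝ ↦
      (ENNReal.ofReal q.2 ^ finrank ℝ E)⁻¹ * ∫⁻ w in ball q.1 q.2, h w ∂μ :=
  (by fun_prop : Measurable fun q : E × ℝ ↦ (ENNReal.ofReal q.2 ^ finrank ℝ E)⁻¹).mul
    (measurable_lintegral_ball hh)

theorem measurable_radialPotential [SFinite μ] {h : E → ℝ≥0∞} (hh : Measurable h) (r ρ : ℝ) :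
    Measurable (radialPotential μ h r ρ) :=
  (measurable_radialPotential_integrand hh).lintegral_prod_right'

theorem lintegral_lintegral_ball [SFinite μ] {ν : Measure E} [SFinite ν] {H : E → ℝ≥0∞}
    (hH : Measurable H) (s : ℝ) :
    ∫⁻ y, ∫⁻ w in ball y s, H w ∂μ ∂ν = ∫⁻ w, H w * ν (ball w s) ∂μ := by
  have hset : MeasurableSet {q : E × E | dist q.2 q.1 < s} :=
    (isOpen_lt (by fun_prop) (by fun_prop)).measurableSet
  have hmeas : Measurable fun q : E × E ↦ (ball q.1 s).indicator H q.2 :=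
    (hH.comp measurable_snd).indicator hset
  have hswap (w : E) : (fun y ↦ (ball y s).indicator H w) = (ball w s).indicator fun _ ↦ H w := by
    ext y
    simp only [Set.indicator, mem_ball, dist_comm w y]
  simp only [← lintegral_indicator measurableSet_ball]
  rw [lintegral_lintegral_swap hmeas.aemeasurable]
  refine lintegral_congr fun w ↦ ?_
  rw [hswap, lintegral_indicator measurableSet_ball, setLIntegral_const]

variable [μ.IsAddHaarMeasure]

theorem lintegral_unitBall_comp (H : E → ℝ≥0∞) (y : E) {s : ℝ} (hs : 0 < s) :
    ∫⁻ z in ball 0 1, H (y + s • z) ∂μ =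
      (ENNReal.ofReal s ^ finrank ℝ E)⁻¹ * ∫⁻ w in ball y s, H w ∂μ := by
  have hemb : MeasurableEmbedding fun z : E ↦ y + s • z :=
    ((Homeomorph.smulOfNeZero s hs.ne').trans (Homeomorph.addLeft y)).measurableEmbedding
  have hmap : μ.map (fun z ↦ y + s • z) = ENNReal.ofReal |(s ^ finrank ℝ E)⁻¹| • μ := by
    refine (Measure.map_map (measurable_const_add y) (measurable_const_smul s)).symm.trans ?_
    rw [Measure.map_addHaar_smul μ hs.ne', Measure.map_smul, map_add_left_eq_self]
  have hpre : (fun z ↦ y + s • z) ⁻¹' ball y s = ball 0 1 := by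
    ext z
    simp [norm_smul, abs_of_pos hs, hs]
  rw [← hpre, ← hemb.lintegral_map, ← hemb.restrict_map, hmap, Measure.restrict_smul,
    lintegral_smul_measure, abs_of_pos (by positivity), ENNReal.ofReal_inv_of_pos (by positivity),
    ENNReal.ofReal_pow hs.le, smul_eq_mul]

theorem laverage_ball_eq (H : E → ℝ≥0∞) (y : E) {r : ℝ} (hr : 0 < r) :
    ⨍⁻ w in ball y r, H w ∂μ = (μ (ball 0 1))⁻¹ * ∫⁻ z in ball 0 1, H (y + r • z) ∂μ := by
  rw [setLAverage_eq, lintegral_unitBall_comp H y hr, measure_ball_eq y hr, div_eq_mul_inv,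
    ENNReal.mul_inv (Or.inr measure_ball_lt_top.ne)
      (Or.inr (measure_ball_pos _ _ one_pos).ne')]
  ring

theorem lintegral_unitBall_enorm_sub_le {v : E → ℝ} (hv : ContDiff ℝ 1 v) (y : E) {r ρ : ℝ}
    (hr : 0 ≤ r) (h : r ≤ ρ) :
    ∫⁻ z in ball 0 1, ‖v (y + ρ • z) - v (y + r • z)‖ₑ ∂μ ≤
      radialPotential μ (fun w ↦ ‖fderiv ℝ v w‖ₑ) r ρ y := by
  have hcont : Continuous fun q : E × ℝ ↦ ‖fderiv ℝ v (y + q.2 • q.1)‖ₑ :=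
    ((hv.continuous_fderiv one_ne_zero).comp (by fun_prop)).enorm
  calc ∫⁻ z in ball 0 1, ‖v (y + ρ • z) - v (y + r • z)‖ₑ ∂μ
      ≤ ∫⁻ z in ball 0 1, ∫⁻ s in Set.Ioc r ρ, ‖fderiv ℝ v (y + s • z)‖ₑ ∂volume ∂μ := by
        refine setLIntegral_mono' measurableSet_ball fun z hz ↦ ?_
        refine (enorm_sub_le_lintegral_fderiv hv y z h).trans (lintegral_mono fun s ↦ ?_)
        refine mul_le_of_le_one_right zero_le ?_
        rw [← ofReal_norm]
        exact ENNReal.ofReal_le_one.2 (mem_ball_zero_iff.1 hz).le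
    _ = ∫⁻ s in Set.Ioc r ρ, ∫⁻ z in ball 0 1, ‖fderiv ℝ v (y + s • z)‖ₑ ∂μ :=
        lintegral_lintegral_swap hcont.measurable.aemeasurable
    _ = radialPotential μ (fun w ↦ ‖fderiv ℝ v w‖ₑ) r ρ y :=
        setLIntegral_congr_fun measurableSet_Ioc fun s hs ↦
          lintegral_unitBall_comp (fun w ↦ ‖fderiv ℝ v w‖ₑ) y (hr.trans_lt hs.1)

theorem enorm_setAverage_sub_le {v : E → ℝ} (hv : ContDiff ℝ 1 v) (y : E) {r : ℝ} (hr : 0 < r) :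
    ‖(⨍ w in ball y r, v w ∂μ) - v y‖ₑ ≤
      (μ (ball 0 1))⁻¹ * radialPotential μ (fun w ↦ ‖fderiv ℝ v w‖ₑ) 0 r y := by
  have hint : IntegrableOn v (ball y r) μ :=
    (hv.continuous.locallyIntegrable.integrableOn_isCompact (isCompact_closedBall y r)).mono_set
      ball_subset_closedBall
  have hsub : (⨍ w in ball y r, v w ∂μ) - v y = ⨍ w in ball y r, (v w - v y) ∂μ := by
    simp only [setAverage_eq]
    rw [integral_sub hint (integrableOn_const measure_ball_lt_top.ne), setIntegral_const, smul_sub,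
      inv_smul_smul₀]
    exact (ENNReal.toReal_pos (measure_ball_pos _ _ hr).ne' measure_ball_lt_top.ne).ne'
  calc ‖(⨍ w in ball y r, v w ∂μ) - v y‖ₑ ≤ ⨍⁻ w in ball y r, ‖v w - v y‖ₑ ∂μ := by
        rw [hsub]
        exact enorm_integral_le_lintegral_enorm _
    _ ≤ _ := by
        rw [laverage_ball_eq _ y hr]
        refine mul_le_mul_right ?_ _
        simpa using lintegral_unitBall_enorm_sub_le hv y le_rfl hr.le

theorem lintegral_lintegral_ball_le {ν : Measure E} [IsFiniteMeasure ν] {A : ℝ≥0}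
    (hν : UpperRegular (finrank ℝ E - 1) ν A) {p : ℝ} (hp : 1 < p) {h : E → ℝ≥0∞}
    (hh : Measurable h) {s l : ℝ} (hs : 0 < s) (hl : 0 < l) :
    ∫⁻ y, ∫⁻ w in ball y s, h w ∂μ ∂ν ≤
      ENNReal.ofReal l * (ENNReal.ofReal s ^ finrank ℝ E * μ (ball 0 1)) * ν Set.univ +
        ENNReal.ofReal (l ^ (1 - p)) *
          (A * ENNReal.ofReal s ^ (finrank ℝ E - 1) * ∫⁻ w, h w ^ p ∂μ) := by
  have hmeas := hh.pow_const p
  calc ∫⁻ y, ∫⁻ w in ball y s, h w ∂μ ∂ν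
      ≤ ∫⁻ y, (ENNReal.ofReal l * (ENNReal.ofReal s ^ finrank ℝ E * μ (ball 0 1)) +
          ENNReal.ofReal (l ^ (1 - p)) * ∫⁻ w in ball y s, h w ^ p ∂μ) ∂ν := by
        refine lintegral_mono fun y ↦ ?_
        refine (lintegral_mono fun w ↦ le_add_mul_rpow hp (h w) hl).trans_eq ?_
        rw [lintegral_add_left measurable_const, setLIntegral_const, measure_ball_eq y hs,
          lintegral_const_mul _ hmeas]
    _ = ENNReal.ofReal l * (ENNReal.ofReal s ^ finrank ℝ E * μ (ball 0 1)) * ν Set.univ +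
          ENNReal.ofReal (l ^ (1 - p)) * ∫⁻ w, h w ^ p * ν (ball w s) ∂μ := by
        rw [lintegral_add_left measurable_const, lintegral_const,
          lintegral_const_mul' _ _ ENNReal.ofReal_ne_top, lintegral_lintegral_ball hmeas]
    _ ≤ _ := by
        rw [← lintegral_const_mul _ hmeas]
        refine add_le_add_right (mul_le_mul_right (lintegral_mono fun w ↦ ?_) _) _
        rw [mul_comm]
        exact mul_le_mul_left (hν w s hs) _

/-- At scale `s`, the integrand of the potential is bounded by splitting `h` at height
`s ^ (-1 / p)`. -/
theorem lintegral_radialPotential_le [Nontrivial E] {ν : Measure E} [IsFiniteMeasure ν] {A : ℝ≥0}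
    (hν : UpperRegular (finrank ℝ E - 1) ν A) {p : ℝ} (hp : 1 < p) {h : E → ℝ≥0∞}
    (hh : Measurable h) (ρ : ℝ) :
    ∫⁻ y, radialPotential μ h 0 ρ y ∂ν ≤
      (μ (ball 0 1) * ν Set.univ + A * ∫⁻ w, h w ^ p ∂μ) *
        ∫⁻ s in Set.Ioc 0 ρ, ENNReal.ofReal (s ^ (-(1 / p))) := by
  simp only [radialPotential]
  rw [lintegral_lintegral_swap (measurable_radialPotential_integrand hh).aemeasurable,
    ← lintegral_const_mul _ (by fun_prop)]
  refine setLIntegral_mono' measurableSet_Ioc fun s hs ↦ ?_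
  have hs₀ : 0 < s := hs.1
  have hsplit := lintegral_lintegral_ball_le (μ := μ) hν hp hh hs₀
    (Real.rpow_pos_of_pos hs₀ (-(1 / p)))
  set l := s ^ (-(1 / p)) with hl
  have hheight : l ^ (1 - p) = s * l := by
    have hp₀ : p ≠ 0 := by positivity
    rw [hl, ← Real.rpow_mul hs₀.le, ← Real.rpow_one_add' hs₀.le]
    · congr 1
      field_simp
      ring
    · rw [← sub_eq_add_neg, sub_ne_zero, ne_comm, Ne, div_eq_iff hp₀]
      linarith
  rw [lintegral_const_mul' _ _ (by simp [hs₀])]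
  rw [hheight, ENNReal.ofReal_mul hs₀.le] at hsplit
  have hcancel : (ENNReal.ofReal s ^ finrank ℝ E)⁻¹ * ENNReal.ofReal s ^ finrank ℝ E = 1 :=
    ENNReal.inv_mul_cancel (pow_ne_zero _ (by simpa using hs₀)) (by finiteness)
  have hpow := mul_pow_sub_one finrank_pos.ne' (ENNReal.ofReal s) (n := finrank ℝ E)
  refine (mul_le_mul_right hsplit _).trans_eq ?_
  generalize ENNReal.ofReal s ^ finrank ℝ E = S at hcancel hpow ⊢
  calc _ = S⁻¹ * S * (μ (ball 0 1) * ν Set.univ * ENNReal.ofReal l) + S⁻¹ *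
          (ENNReal.ofReal s * ENNReal.ofReal s ^ (finrank ℝ E - 1)) *
          (A * (∫⁻ w, h w ^ p ∂μ) * ENNReal.ofReal l) := by ring
    _ = _ := by
        rw [hpow, hcancel]
        ring

end RadialPotential

section MaximalFunction

theorem lowerSemicontinuous_setLIntegral_ball {X : Type*} [PseudoMetricSpace X]
    [MeasurableSpace X] [OpensMeasurableSpace X] (μ : Measure X) {h : X → ℝ≥0∞}
    (hh : Measurable h) (r : ℝ) : LowerSemicontinuous fun x ↦ ∫⁻ z in ball x r, h z ∂μ := by
  refine lowerSemicontinuous_iff_le_liminf.2 fun x ↦ ?_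
  simp only [← lintegral_indicator measurableSet_ball]
  refine (lintegral_mono fun z ↦ ?_).trans
    (lintegral_liminf_le fun y ↦ hh.indicator measurableSet_ball)
  by_cases hz : z ∈ ball x r
  · refine le_liminf_of_le (by isBoundedDefault) ?_
    filter_upwards [isOpen_ball.mem_nhds (mem_ball'.1 hz)] with y hy
    rw [Set.indicator_of_mem hz, Set.indicator_of_mem (show z ∈ ball y r from mem_ball'.1 hy)]
  · simp only [Set.indicator_of_notMem hz, zero_le]

/-- The centred Hardy–Littlewood maximal function of a nonnegative function with
respect to a measure `μ`. -/
def maximalFunction {X : Type*} [PseudoMetricSpace X] [MeasurableSpace X] (μ : Measure X)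
    (h : X → ℝ≥0∞) (x : X) : ℝ≥0∞ :=
  ⨆ (r : ℝ) (_ : 0 < r), ⨍⁻ z in ball x r, h z ∂μ

variable {E : Type*} [NormedAddCommGroup E] [MeasurableSpace E] [BorelSpace E] {μ : Measure E}
  [μ.IsAddHaarMeasure] {h : E → ℝ≥0∞}

theorem lowerSemicontinuous_maximalFunction (hh : Measurable h) :
    LowerSemicontinuous (maximalFunction μ h) := by
  refine lowerSemicontinuous_iSup fun r ↦ lowerSemicontinuous_iSup fun hr ↦ ?_
  simp only [setLAverage_eq, Measure.addHaar_ball_center μ _ r, div_eq_mul_inv]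
  have hinv : (μ (ball 0 r))⁻¹ ≠ ⊤ := ENNReal.inv_ne_top.2 (measure_ball_pos _ _ hr).ne'
  exact (ENNReal.continuous_mul_const hinv).comp_lowerSemicontinuous
    (lowerSemicontinuous_setLIntegral_ball μ hh r) fun _ _ hab ↦ mul_le_mul_left hab _

variable [NormedSpace ℝ E] [FiniteDimensional ℝ E]

theorem setLIntegral_ball_le_maximalFunction (h : E → ℝ≥0∞) (x : E) {r : ℝ} (hr : 0 < r) :
    ∫⁻ z in ball x r, h z ∂μ ≤
      ENNReal.ofReal r ^ finrank ℝ E * μ (ball 0 1) * maximalFunction μ h x := by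
  calc ∫⁻ z in ball x r, h z ∂μ
      = μ (ball x r) * ⨍⁻ z in ball x r, h z ∂μ := by
        rw [setLAverage_eq, ENNReal.mul_div_cancel (measure_ball_pos _ _ hr).ne'
          measure_ball_lt_top.ne]
    _ ≤ μ (ball x r) * maximalFunction μ h x := by
        gcongr
        exact le_iSup₂ (f := fun (r : ℝ) (_ : 0 < r) ↦ ⨍⁻ z in ball x r, h z ∂μ) r hr
    _ = _ := by rw [measure_ball_eq x hr]

theorem mul_measure_le_of_forall_exists_ball [Nontrivial E] {S : Set E} {c : ℝ≥0∞} (hc : c ≠ 0)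
    (hS : ∀ x ∈ S, ∃ r > 0, c * μ (ball x r) ≤ ∫⁻ z in ball x r, h z ∂μ) :
    c * μ S ≤ 6 ^ finrank ℝ E * ∫⁻ z, h z ∂μ := by
  rcases eq_or_ne (∫⁻ z, h z ∂μ) ⊤ with htop | hfin
  · simp [htop, ENNReal.mul_top]
  choose! r hr hle using hS
  obtain ⟨R, hR⟩ := exists_radius_le (μ := μ) (ENNReal.div_ne_top hfin hc)
  have hrR : ∀ y ∈ S, r y ≤ R := fun y hy ↦ hR y (r y) <|
    ENNReal.le_div_iff_mul_le (.inl hc) (.inr hfin) |>.2 <|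
      (mul_comm _ _).trans_le ((hle y hy).trans (setLIntegral_le_lintegral _ _))
  obtain ⟨u, huS, hu, hdisj, hcover⟩ := exists_countable_disjoint_balls_cover hr hrR
  have hscale : ∀ b ∈ u, μ (ball b (6 * r b)) = 6 ^ finrank ℝ E * μ (ball b (r b)) := by
    intro b hb
    have hrb := hr b (huS hb)
    rw [measure_ball_eq b hrb, measure_ball_eq b (by positivity),
      ENNReal.ofReal_mul (by norm_num), mul_pow, ENNReal.ofReal_ofNat, mul_assoc]
  calc c * μ S
      ≤ c * ∑' b : u, μ (ball (b : E) (6 * r b)) := by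
        gcongr
        exact (measure_mono hcover).trans (measure_biUnion_le μ hu _)
    _ = 6 ^ finrank ℝ E * ∑' b : u, c * μ (ball (b : E) (r b)) := by
        rw [tsum_congr fun b : u ↦ hscale b b.2, ENNReal.tsum_mul_left, ENNReal.tsum_mul_left,
          mul_left_comm]
    _ ≤ 6 ^ finrank ℝ E * ∑' b : u, ∫⁻ z in ball (b : E) (r b), h z ∂μ :=
        mul_le_mul_right (ENNReal.tsum_le_tsum fun b : u ↦ hle b (huS b.2)) _
    _ = 6 ^ finrank ℝ E * ∫⁻ z in ⋃ b ∈ u, ball b (r b), h z ∂μ := by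
        rw [lintegral_biUnion hu (fun _ _ ↦ measurableSet_ball) hdisj]
    _ ≤ 6 ^ finrank ℝ E * ∫⁻ z, h z ∂μ :=
        mul_le_mul_right (setLIntegral_le_lintegral _ _) _

/-- The excess `h - c` over the level `c` carries the whole estimate, since the remaining part of
`h` contributes at most `c` to every average. -/
theorem mul_measure_two_mul_lt_maximalFunction_le [Nontrivial E] (h : E → ℝ≥0∞) {c : ℝ≥0∞}
    (hc : c ≠ 0) (hc' : c ≠ ⊤) :
    c * μ {x | 2 * c < maximalFunction μ h x} ≤
      6 ^ finrank ℝ E * ∫⁻ z, (h z - c) ∂μ := by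
  refine mul_measure_le_of_forall_exists_ball hc fun x hx ↦ ?_
  simp only [maximalFunction, Set.mem_ofPred_eq, lt_iSup_iff] at hx
  obtain ⟨r, hr, hlt⟩ := hx
  refine ⟨r, hr, ?_⟩
  have hfin : c * μ (ball x r) ≠ ⊤ := ENNReal.mul_ne_top hc' measure_ball_lt_top.ne
  rw [setLAverage_eq, ENNReal.lt_div_iff_mul_lt (.inl (measure_ball_pos _ _ hr).ne')
    (.inl measure_ball_lt_top.ne), mul_assoc, two_mul] at hlt
  refine (ENNReal.add_le_add_iff_left hfin).1 (hlt.le.trans ?_)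
  rw [← setLIntegral_const, ← lintegral_add_left measurable_const]
  exact lintegral_mono fun z ↦ le_add_tsub

theorem rpow_le_setLIntegral_ofReal_lt {p : ℝ} (hp : 0 < p) (a : ℝ≥0∞) :
    a ^ p ≤ ENNReal.ofReal p *
      ∫⁻ t in Set.Ioi (0 : ℝ), Set.indicator {t | ENNReal.ofReal t < a}
        (fun t ↦ ENNReal.ofReal (t ^ (p - 1))) t := by
  rw [← ENNReal.le_rpow_inv_iff hp]
  refine ENNReal.le_of_forall_nnreal_lt fun b hb ↦ (ENNReal.le_rpow_inv_iff hp).2 ?_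
  have hsub : Set.Ioc (0 : ℝ) b ⊆ {t | ENNReal.ofReal t < a} := fun t ht ↦
    ((ENNReal.ofReal_le_ofReal ht.2).trans_eq (ENNReal.ofReal_coe_nnreal)).trans_lt hb
  calc (b : ℝ≥0∞) ^ p
      = ENNReal.ofReal p * ∫⁻ t in Set.Ioc (0 : ℝ) b, ENNReal.ofReal (t ^ (p - 1)) := by
        rw [lintegral_Ioc_rpow (by linarith) b.coe_nonneg, ← ENNReal.ofReal_mul hp.le,
          sub_add_cancel, mul_div_cancel₀ _ hp.ne',
          ← ENNReal.ofReal_rpow_of_nonneg b.coe_nonneg hp.le, ENNReal.ofReal_coe_nnreal]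
    _ = ENNReal.ofReal p * ∫⁻ t in Set.Ioc (0 : ℝ) b, Set.indicator {t | ENNReal.ofReal t < a}
          (fun t ↦ ENNReal.ofReal (t ^ (p - 1))) t := by
        congr 1
        refine setLIntegral_congr_fun measurableSet_Ioc fun t ht ↦ ?_
        rw [Set.indicator_of_mem (hsub ht)]
    _ ≤ _ := mul_le_mul_right (lintegral_mono_set Set.Ioc_subset_Ioi_self) _

theorem lintegral_rpow_le_lintegral_measure_lt {X : Type*} [MeasurableSpace X] {ν : Measure X}
    [SFinite ν] {p : ℝ} (hp : 0 < p) {F : X → ℝ≥0∞} (hF : Measurable F) :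
    ∫⁻ x, F x ^ p ∂ν ≤ ENNReal.ofReal p *
      ∫⁻ t in Set.Ioi (0 : ℝ), ENNReal.ofReal (t ^ (p - 1)) * ν {x | ENNReal.ofReal t < F x} := by
  have hset : MeasurableSet {q : X × ℝ | ENNReal.ofReal q.2 < F q.1} :=
    measurableSet_lt (by fun_prop) (by fun_prop)
  have hmeas : Measurable fun q : X × ℝ ↦ Set.indicator {t | ENNReal.ofReal t < F q.1}
      (fun t ↦ ENNReal.ofReal (t ^ (p - 1))) q.2 :=
    Measurable.indicator (f := fun q : X × ℝ ↦ ENNReal.ofReal (q.2 ^ (p - 1))) (by fun_prop) hset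
  refine (lintegral_mono fun x ↦ rpow_le_setLIntegral_ofReal_lt hp (F x)).trans_eq ?_
  rw [lintegral_const_mul' _ _ ENNReal.ofReal_ne_top,
    lintegral_lintegral_swap (f := fun x t ↦ Set.indicator {t | ENNReal.ofReal t < F x}
      (fun t ↦ ENNReal.ofReal (t ^ (p - 1))) t) hmeas.aemeasurable]
  congr 1
  refine lintegral_congr fun t ↦ ?_
  rw [← setLIntegral_const, ← lintegral_indicator (measurableSet_lt measurable_const hF)]
  rfl

theorem setLIntegral_rpow_mul_tsub_le {p : ℝ} (hp : 1 < p) (a : ℝ≥0∞) :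
    ∫⁻ t in Set.Ioi (0 : ℝ), ENNReal.ofReal (t ^ (p - 2)) * (a - ENNReal.ofReal t) ≤
      ENNReal.ofReal (p - 1)⁻¹ * a ^ p := by
  have hp' : 0 < p - 1 := by linarith
  rcases eq_or_ne a ⊤ with rfl | ha
  · simp [ENNReal.top_rpow_of_pos (zero_lt_one.trans hp), ENNReal.mul_top, hp]
  lift a to ℝ≥0 using ha
  have hfar : ∫⁻ t in Set.Ioi (a : ℝ), ENNReal.ofReal (t ^ (p - 2)) * (a - ENNReal.ofReal t) = 0 :=
    setLIntegral_eq_zero measurableSet_Ioi fun t ht ↦ by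
      have hat : (a : ℝ≥0∞) ≤ ENNReal.ofReal t := by
        rw [← ENNReal.ofReal_coe_nnreal]; exact ENNReal.ofReal_le_ofReal ht.le
      simp only [tsub_eq_zero_of_le hat, mul_zero, Pi.zero_apply]
  rw [← Set.Ioc_union_Ioi_eq_Ioi a.coe_nonneg,
    lintegral_union measurableSet_Ioi Set.Ioc_disjoint_Ioi_same, hfar, add_zero]
  calc ∫⁻ t in Set.Ioc (0 : ℝ) a, ENNReal.ofReal (t ^ (p - 2)) * (a - ENNReal.ofReal t)
      ≤ ∫⁻ t in Set.Ioc (0 : ℝ) a, ENNReal.ofReal (t ^ (p - 2)) * a :=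
        lintegral_mono fun t ↦ mul_le_mul_right tsub_le_self _
    _ = ENNReal.ofReal (p - 1)⁻¹ * ((a : ℝ≥0∞) ^ (p - 1) * a) := by
        rw [lintegral_mul_const' _ _ ENNReal.coe_ne_top,
          lintegral_Ioc_rpow (by linarith) a.coe_nonneg,
          show p - 2 + 1 = p - 1 by ring, div_eq_inv_mul, ENNReal.ofReal_mul (by positivity),
          ← ENNReal.ofReal_rpow_of_nonneg a.coe_nonneg hp'.le, ENNReal.ofReal_coe_nnreal, mul_assoc]
    _ = ENNReal.ofReal (p - 1)⁻¹ * (a : ℝ≥0∞) ^ p := by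
        conv_lhs => rw [← ENNReal.rpow_one (a : ℝ≥0∞), ← ENNReal.rpow_mul, one_mul,
          ← ENNReal.rpow_add_of_nonneg _ _ hp'.le zero_le_one, sub_add_cancel]

theorem lintegral_maximalFunction_rpow_le [Nontrivial E] {p : ℝ} (hp : 1 < p)
    (hh : Measurable h) :
    ∫⁻ x, maximalFunction μ h x ^ p ∂μ ≤
      2 ^ p * ENNReal.ofReal p * 6 ^ finrank ℝ E * ENNReal.ofReal (p - 1)⁻¹ *
        ∫⁻ z, h z ^ p ∂μ := by
  have hp₀ : 0 < p := zero_lt_one.trans hp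
  have hM : Measurable (maximalFunction μ h) := (lowerSemicontinuous_maximalFunction hh).measurable
  have hweak : ∀ t ∈ Set.Ioi (0 : ℝ), ENNReal.ofReal (t ^ (p - 1)) *
      μ {x | ENNReal.ofReal t < maximalFunction μ h x / 2} ≤
        6 ^ finrank ℝ E * ∫⁻ z, ENNReal.ofReal (t ^ (p - 2)) * (h z - ENNReal.ofReal t) ∂μ := by
    intro t (ht : 0 < t)
    have hpow : t ^ (p - 1) = t ^ (p - 2) * t := by
      rw [← Real.rpow_add_one ht.ne']; ring_nf
    have hlevel := mul_measure_two_mul_lt_maximalFunction_le (μ := μ) h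
      (ENNReal.ofReal_pos.2 ht).ne' ENNReal.ofReal_ne_top
    simp only [ENNReal.lt_div_iff_mul_lt (.inl two_ne_zero) (.inl ENNReal.ofNat_ne_top),
      mul_comm _ (2 : ℝ≥0∞)]
    rw [hpow, ENNReal.ofReal_mul (by positivity), mul_assoc,
      lintegral_const_mul' _ _ ENNReal.ofReal_ne_top, mul_left_comm (6 ^ finrank ℝ E)]
    exact mul_le_mul_right hlevel _
  calc ∫⁻ x, maximalFunction μ h x ^ p ∂μ
      = 2 ^ p * ∫⁻ x, (maximalFunction μ h x / 2) ^ p ∂μ := by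
        rw [← lintegral_const_mul' _ _ (ENNReal.rpow_ne_top_of_nonneg hp₀.le ENNReal.ofNat_ne_top)]
        simp only [← ENNReal.mul_rpow_of_nonneg _ _ hp₀.le,
          ENNReal.mul_div_cancel two_ne_zero ENNReal.ofNat_ne_top]
    _ ≤ 2 ^ p * (ENNReal.ofReal p * ∫⁻ t in Set.Ioi (0 : ℝ), 6 ^ finrank ℝ E *
          ∫⁻ z, ENNReal.ofReal (t ^ (p - 2)) * (h z - ENNReal.ofReal t) ∂μ) := by
        refine mul_le_mul_right ((lintegral_rpow_le_lintegral_measure_lt hp₀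
          (hM.div_const 2)).trans (mul_le_mul_right ?_ _)) _
        exact setLIntegral_mono' measurableSet_Ioi hweak
    _ = 2 ^ p * ENNReal.ofReal p * 6 ^ finrank ℝ E * ∫⁻ z, (∫⁻ t in Set.Ioi (0 : ℝ),
          ENNReal.ofReal (t ^ (p - 2)) * (h z - ENNReal.ofReal t)) ∂μ := by
        rw [lintegral_const_mul' _ _ (by finiteness), lintegral_lintegral_swap (by fun_prop),
          ← mul_assoc, ← mul_assoc]
    _ ≤ 2 ^ p * ENNReal.ofReal p * 6 ^ finrank ℝ E *
          ∫⁻ z, ENNReal.ofReal (p - 1)⁻¹ * h z ^ p ∂μ :=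
        mul_le_mul_right (lintegral_mono fun z ↦ setLIntegral_rpow_mul_tsub_le hp (h z)) _
    _ = _ := by rw [lintegral_const_mul' _ _ ENNReal.ofReal_ne_top, ← mul_assoc]

end MaximalFunction

section PreciseRepresentative

open scoped Gradient

variable {n : ℕ} {u w : Rn n → ℝ} {g : Rn n → Rn n}

theorem enorm_gradient (v : Rn n → ℝ) (z : Rn n) : ‖∇ v z‖ₑ = ‖fderiv ℝ v z‖ₑ := by
  rw [gradient, ← ofReal_norm, LinearIsometryEquiv.norm_map, ofReal_norm]

theorem gradient_fun_sub {v : Rn n → ℝ} (hv : Differentiable ℝ v) (hw : Differentiable ℝ w) :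
    ∇ (fun z ↦ v z - w z) = ∇ v - ∇ w := by
  ext1 z
  rw [gradient, fderiv_fun_sub (hv z) (hw z), map_sub]
  rfl

theorem gradient_mollify (h : IsWeakGradient u g) (k : ℕ) :
    ∇ (mollify volume k u) = mollify volume k g := by
  ext1 x
  rw [gradient, fderiv_mollify h]
  exact (InnerProductSpace.toDual ℝ (Rn n)).symm_apply_apply _

/-- The scale-invariant `W^{1,1}` norm of `u`, with gradient `g`, on the ball `B(x, 2 * L)`. -/
def localSobolevNorm (x : Rn n) (L : ℝ) (u : Rn n → ℝ) (g : Rn n → Rn n) : ℝ≥0∞ :=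
  (∫⁻ z in ball x (2 * L), ‖g z‖ₑ) + (∫⁻ z in ball x (2 * L), ‖u z‖ₑ) / ENNReal.ofReal L

theorem localSobolevNorm_sub_le (x : Rn n) (L : ℝ) {u₁ u₂ : Rn n → ℝ} {g₁ g₂ : Rn n → Rn n}
    (hu₁ : AEStronglyMeasurable u₁ volume) (hu₂ : AEStronglyMeasurable u₂ volume)
    (hg₁ : AEStronglyMeasurable g₁ volume) (hg₂ : AEStronglyMeasurable g₂ volume)
    (u₃ : Rn n → ℝ) (g₃ : Rn n → Rn n) :
    localSobolevNorm x L (u₁ - u₃) (g₁ - g₃) ≤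
      localSobolevNorm x L (u₁ - u₂) (g₁ - g₂) + localSobolevNorm x L (u₂ - u₃) (g₂ - g₃) := by
  have htriangle {F : Type} [NormedAddCommGroup F] {f₁ f₂ : Rn n → F}
      (h₁ : AEStronglyMeasurable f₁ volume) (h₂ : AEStronglyMeasurable f₂ volume) (f₃ : Rn n → F) :
      ∫⁻ z in ball x (2 * L), ‖(f₁ - f₃) z‖ₑ ≤ (∫⁻ z in ball x (2 * L), ‖(f₁ - f₂) z‖ₑ) +
        ∫⁻ z in ball x (2 * L), ‖(f₂ - f₃) z‖ₑ := by
    rw [← lintegral_add_left' (h₁.sub h₂).enorm.restrict]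
    refine lintegral_mono fun z ↦ ?_
    rw [← sub_add_sub_cancel f₁ f₂ f₃]
    exact enorm_add_le _ _
  refine (add_le_add (htriangle hg₁ hg₂ g₃)
    (ENNReal.div_le_div_right (htriangle hu₁ hu₂ u₃) _)).trans_eq ?_
  rw [ENNReal.add_div, localSobolevNorm, localSobolevNorm]
  ring

theorem tendsto_localSobolevNorm_mollify_sub (h : IsWeakGradient u g) (x : Rn n) {L : ℝ}
    (hL : 0 < L) :
    Tendsto (fun k ↦ localSobolevNorm x L (mollify volume k u - u) (mollify volume k g - g)) atTop
      (𝓝 0) := by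
  have hlim := (tendsto_setLIntegral_mollify_sub h.locInt_grad x (2 * L)).add
    (ENNReal.Tendsto.div_const (tendsto_setLIntegral_mollify_sub h.locInt x (2 * L))
      (Or.inr (ENNReal.ofReal_pos.2 hL).ne'))
  rwa [ENNReal.zero_div, add_zero] at hlim

theorem exists_lintegral_enorm_le_localSobolevNorm (n : ℕ) [NeZero n] :
    ∃ C : ℝ≥0, ∀ (ν : Measure (Rn n)) (A : ℝ≥0) (x : Rn n) (L : ℝ), 0 < L →
      UpperRegular (n - 1) ν A → ν (closedBall x L)ᶜ = 0 → ∀ v : Rn n → ℝ, ContDiff ℝ 1 v →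
        ∫⁻ z, ‖v z‖ₑ ∂ν ≤ C * A * localSobolevNorm x L v (∇ v) := by
  simpa only [localSobolevNorm, enorm_gradient, finrank_euclideanSpace_fin] using
    exists_lintegral_enorm_le_of_closedBall (volume : Measure (Rn n))

/-- A pointwise bound of `|⨍_{B(y,r)} u - w(y)|`, uniform over the radii `r ≤ ρ`. -/
def averageError (u w : Rn n → ℝ) (g : Rn n → Rn n) (ρ : ℝ) (y : Rn n) : ℝ≥0∞ :=
  liminf (fun k ↦ ‖mollify volume k u y - w y‖ₑ + (volume (ball (0 : Rn n) 1))⁻¹ *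
    radialPotential volume (fun z ↦ ‖mollify volume k g z‖ₑ) 0 ρ y) atTop

theorem enorm_setAverage_sub_le_averageError (h : IsWeakGradient u g) (w : Rn n → ℝ) (y : Rn n)
    {r ρ : ℝ} (hr : 0 < r) (hρ : r ≤ ρ) :
    ‖(⨍ z in ball y r, u z) - w y‖ₑ ≤ averageError u w g ρ y := by
  rw [← ((tendsto_setAverage_mollify h.locInt y r).sub_const (w y)).enorm.liminf_eq]
  refine liminf_le_liminf (Eventually.of_forall fun k ↦ ?_)
  rw [← sub_add_sub_cancel' (mollify volume k u y)]
  refine (enorm_add_le _ _).trans (add_le_add_right ?_ _)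
  refine (enorm_setAverage_sub_le (contDiff_mollify k h.locInt) y hr).trans
    (mul_le_mul_right ?_ _)
  exact radialPotential_mono (fun z ↦ (enorm_fderiv_mollify h k z).le) hρ y

theorem abs_preciseRep_le {y : Rn n} {c : ℝ} {G : ℝ≥0∞} {ρ : ℝ} (hρ : 0 < ρ)
    (h : ∀ r, 0 < r → r ≤ ρ → ‖(⨍ z in ball y r, u z) - c‖ₑ ≤ G) :
    (preciseRep u y).abs ≤ ‖c‖ₑ + G ∧ ‖c‖ₑ ≤ (preciseRep u y).abs + G := by
  rcases eq_or_ne G ⊤ with rfl | hG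
  · simp
  have hev : ∀ᶠ r in 𝓝[>] (0 : ℝ), |(⨍ z in ball y r, u z) - c| ≤ G.toReal := by
    filter_upwards [Ioc_mem_nhdsGT hρ] with r hr
    have := h r hr.1 hr.2
    rwa [Real.enorm_eq_ofReal_abs, ENNReal.ofReal_le_iff_le_toReal hG] at this
  have hupper : preciseRep u y ≤ ((c + G.toReal : ℝ) : EReal) := by
    refine limsup_le_of_le (by isBoundedDefault) ?_
    filter_upwards [hev] with r hr
    exact EReal.coe_le_coe_iff.2 (by linarith [(abs_le.1 hr).2])
  have hlower : ((c - G.toReal : ℝ) : EReal) ≤ preciseRep u y := by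
    refine le_limsup_of_frequently_le (Eventually.frequently ?_) (by isBoundedDefault)
    filter_upwards [hev] with r hr
    exact EReal.coe_le_coe_iff.2 (by linarith [(abs_le.1 hr).1])
  lift preciseRep u y to ℝ using ⟨(hupper.trans_lt (EReal.coe_lt_top _)).ne,
    ((EReal.bot_lt_coe _).trans_le hlower).ne'⟩ with t
  rw [EReal.coe_le_coe_iff] at hupper hlower
  have hdist : ‖t - c‖ₑ ≤ G := by
    rw [Real.enorm_eq_ofReal_abs, ENNReal.ofReal_le_iff_le_toReal hG]
    exact abs_le.2 ⟨by linarith, by linarith⟩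
  rw [EReal.abs_def, ← Real.enorm_eq_ofReal_abs]
  constructor
  · simpa using (enorm_add_le c (t - c)).trans (add_le_add_right hdist _)
  · rw [enorm_sub_rev] at hdist
    simpa using (enorm_add_le t (c - t)).trans (add_le_add_right hdist _)

theorem measurable_averageError (h : IsWeakGradient u g) (hw : Continuous w) (ρ : ℝ) :
    Measurable (averageError u w g ρ) :=
  Measurable.liminf fun k ↦
    ((contDiff_mollify k h.locInt).continuous.sub hw).enorm.measurable.add
      ((measurable_radialPotential
        (contDiff_mollify k h.locInt_grad).continuous.enorm.measurable 0 ρ).const_mul _)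

theorem exists_lintegral_enorm_mollify_sub_le (n : ℕ) [NeZero n] :
    ∃ C : ℝ≥0, ∀ (ν : Measure (Rn n)) (A : ℝ≥0) (x : Rn n) (L : ℝ), 0 < L →
      UpperRegular (n - 1) ν A → ν (closedBall x L)ᶜ = 0 →
      ∀ (u : Rn n → ℝ) (g : Rn n → Rn n), IsWeakGradient u g → ∀ w : Rn n → ℝ, ContDiff ℝ 1 w →
      ∀ k : ℕ, ∫⁻ y, ‖mollify volume k u y - w y‖ₑ ∂ν ≤
        C * A * (localSobolevNorm x L (mollify volume k u - u) (mollify volume k g - g) +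
          localSobolevNorm x L (u - w) (g - ∇ w)) := by
  obtain ⟨C, hC⟩ := exists_lintegral_enorm_le_localSobolevNorm n
  refine ⟨C, fun ν A x L hL hν hsupp u g h w hw k ↦ ?_⟩
  have hu : ContDiff ℝ 1 (mollify volume k u) := contDiff_mollify k h.locInt
  have hg : ContDiff ℝ 1 (mollify volume k g) := contDiff_mollify k h.locInt_grad
  refine (hC ν A x L hL hν hsupp _ (hu.sub hw)).trans (mul_le_mul_right ?_ _)
  rw [gradient_fun_sub (hu.differentiable one_ne_zero) (hw.differentiable one_ne_zero),
    gradient_mollify h]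
  exact localSobolevNorm_sub_le x L hu.continuous.aestronglyMeasurable
    h.locInt.aestronglyMeasurable hg.continuous.aestronglyMeasurable
    h.locInt_grad.aestronglyMeasurable w (∇ w)

theorem exists_lintegral_averageError_le (n : ℕ) [NeZero n] :
    ∃ C : ℝ≥0, ∀ (ν : Measure (Rn n)) [IsFiniteMeasure ν] (A : ℝ≥0) (x : Rn n) (L : ℝ), 0 < L →
      UpperRegular (n - 1) ν A → ν (closedBall x L)ᶜ = 0 → ∀ p : ℝ, 1 < p →
      ∀ (u : Rn n → ℝ) (g : Rn n → Rn n), IsWeakGradient u g → ∀ w : Rn n → ℝ, ContDiff ℝ 1 w →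
      ∀ ρ : ℝ, ∫⁻ y, averageError u w g ρ y ∂ν ≤
        C * A * localSobolevNorm x L (u - w) (g - ∇ w) +
          (volume (ball (0 : Rn n) 1))⁻¹ *
            ((volume (ball (0 : Rn n) 1) * ν Set.univ + A * ∫⁻ z, ‖g z‖ₑ ^ p) *
              ∫⁻ s in Set.Ioc 0 ρ, ENNReal.ofReal (s ^ (-(1 / p)))) := by
  obtain ⟨C, hC⟩ := exists_lintegral_enorm_mollify_sub_le n
  refine ⟨C, fun ν _ A x L hL hν hsupp p hp u g h w hw ρ ↦ ?_⟩
  set V := volume (ball (0 : Rn n) 1)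
  set κ := V⁻¹ * ((V * ν Set.univ + A * ∫⁻ z, ‖g z‖ₑ ^ p) *
    ∫⁻ s in Set.Ioc 0 ρ, ENNReal.ofReal (s ^ (-(1 / p))))
  have hu k : ContDiff ℝ 1 (mollify volume k u) := contDiff_mollify k h.locInt
  have hg k : Measurable fun z ↦ ‖mollify volume k g z‖ₑ :=
    (contDiff_mollify k h.locInt_grad).continuous.enorm.measurable
  have htrace k : ∫⁻ y, ‖mollify volume k u y - w y‖ₑ ∂ν ≤
      C * A * (localSobolevNorm x L (mollify volume k u - u) (mollify volume k g - g) +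
        localSobolevNorm x L (u - w) (g - ∇ w)) := hC ν A x L hL hν hsupp u g h w hw k
  have hpotential k : V⁻¹ *
      ∫⁻ y, radialPotential volume (fun z ↦ ‖mollify volume k g z‖ₑ) 0 ρ y ∂ν ≤ κ := by
    have hjensen := lintegral_enorm_mollify_rpow_le hp.le k h.locInt_grad.aestronglyMeasurable
    refine mul_le_mul_right ?_ _
    refine (lintegral_radialPotential_le (by simpa using hν) hp (hg k) ρ).trans ?_
    exact mul_le_mul_left (add_le_add_right (mul_le_mul_right hjensen _) _) _
  have hmollify k : ∫⁻ y, (‖mollify volume k u y - w y‖ₑ +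
      V⁻¹ * radialPotential volume (fun z ↦ ‖mollify volume k g z‖ₑ) 0 ρ y) ∂ν ≤
      C * A * (localSobolevNorm x L (mollify volume k u - u) (mollify volume k g - g) +
        localSobolevNorm x L (u - w) (g - ∇ w)) + κ := by
    have hdiff : Measurable fun y ↦ ‖mollify volume k u y - w y‖ₑ :=
      ((hu k).continuous.sub hw.continuous).enorm.measurable
    rw [lintegral_add_left hdiff, lintegral_const_mul _ (measurable_radialPotential (hg k) 0 ρ)]
    exact add_le_add (htrace k) (hpotential k)
  have hlim := (ENNReal.Tendsto.const_mul (a := C * A) ((tendsto_localSobolevNorm_mollify_sub h x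
    hL).add_const (localSobolevNorm x L (u - w) (g - ∇ w))) (Or.inr (by finiteness))).add_const κ
  rw [zero_add] at hlim
  refine (lintegral_liminf_le fun k ↦ ?_).trans
    ((liminf_le_liminf (Eventually.of_forall hmollify)).trans_eq hlim.liminf_eq)
  exact ((hu k).continuous.sub hw.continuous).enorm.measurable.add
    ((measurable_radialPotential (hg k) 0 ρ).const_mul _)

theorem exists_lintegral_preciseRep_le (n : ℕ) [NeZero n] :
    ∃ C : ℝ≥0, ∀ (ν : Measure (Rn n)) [IsFiniteMeasure ν] (A : ℝ≥0) (x : Rn n) (L : ℝ), 0 < L →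
      UpperRegular (n - 1) ν A → ν (closedBall x L)ᶜ = 0 → ∀ p : ℝ, 1 < p →
      ∀ (u : Rn n → ℝ) (g : Rn n → Rn n), IsSobolev p u g → ∀ w : Rn n → ℝ, ContDiff ℝ 1 w →
        (∫⁻ y, (preciseRep u y).abs ∂ν ≤
          ∫⁻ y, ‖w y‖ₑ ∂ν + C * A * localSobolevNorm x L (u - w) (g - ∇ w)) ∧
        ∫⁻ y, ‖w y‖ₑ ∂ν ≤
          ∫⁻ y, (preciseRep u y).abs ∂ν + C * A * localSobolevNorm x L (u - w) (g - ∇ w) := by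
  obtain ⟨C, hC⟩ := exists_lintegral_averageError_le n
  refine ⟨C, fun ν _ A x L hL hν hsupp p hp u g h w hw ↦ ?_⟩
  set N := C * A * localSobolevNorm x L (u - w) (g - ∇ w)
  set V := volume (ball (0 : Rn n) 1)
  set κ := V⁻¹ * (V * ν Set.univ + A * ∫⁻ z, ‖g z‖ₑ ^ p)
  have hV : V ≠ 0 := (measure_ball_pos volume 0 one_pos).ne'
  have hκ : κ ≠ ⊤ := by
    have hg := lintegral_rpow_enorm_lt_top_of_eLpNorm_lt_top (by simpa using by linarith) (by simp)
      h.memLp_grad.eLpNorm_lt_top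
    rw [ENNReal.toReal_ofReal (by linarith)] at hg
    have hVtop : V ≠ ⊤ := measure_ball_lt_top.ne
    finiteness
  have herror ρ : ∫⁻ y, averageError u w g ρ y ∂ν ≤
      N + κ * ∫⁻ s in Set.Ioc 0 ρ, ENNReal.ofReal (s ^ (-(1 / p))) := by
    simpa only [N, κ, mul_assoc] using hC ν A x L hL hν hsupp p hp u g h.weakGradient w hw ρ
  have hlim (a : ℝ≥0∞) : Tendsto
      (fun ρ ↦ a + (N + κ * ∫⁻ s in Set.Ioc 0 ρ, ENNReal.ofReal (s ^ (-(1 / p))))) (𝓝[>] 0)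
      (𝓝 (a + N)) := by
    have hexp : -1 < -(1 / p) := neg_lt_neg ((div_lt_one (by linarith)).2 hp)
    have := ENNReal.Tendsto.const_mul (tendsto_lintegral_Ioc_rpow hexp) (Or.inr hκ)
    simpa only [mul_zero, add_zero] using (this.const_add N).const_add a
  have hpassage {F F' : Rn n → ℝ≥0∞}
      (hF : ∀ ρ, 0 < ρ → ∀ y, F y ≤ F' y + averageError u w g ρ y) :
      ∫⁻ y, F y ∂ν ≤ ∫⁻ y, F' y ∂ν + N := by
    refine ge_of_tendsto (hlim _) ?_
    filter_upwards [self_mem_nhdsWithin] with ρ hρ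
    refine (lintegral_mono (hF ρ hρ)).trans ?_
    rw [lintegral_add_right _ (measurable_averageError h.weakGradient hw.continuous ρ)]
    exact add_le_add_right (herror ρ) _
  have hpointwise (ρ : ℝ) (hρ : 0 < ρ) (y : Rn n) := abs_preciseRep_le hρ fun r hr hrρ ↦
    enorm_setAverage_sub_le_averageError h.weakGradient w y hr hrρ
  exact ⟨hpassage fun ρ hρ y ↦ (hpointwise ρ hρ y).1, hpassage fun ρ hρ y ↦ (hpointwise ρ hρ y).2⟩

end PreciseRepresentative

section MaximalOperator

open scoped Gradient

variable {n : ℕ} {μ : Measure (Rn n)} {R M : ℝ} {u : Rn n → ℝ} {g : Rn n → Rn n}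

/-- The rescaled measure `μ_t`, translated by `x`: the image of `μ` under `z ↦ t z + x`. -/
def rescaleAt (μ : Measure (Rn n)) (t : ℝ) (x : Rn n) : Measure (Rn n) :=
  μ.map fun z ↦ t • z + x

theorem measurable_smul_add (t : ℝ) (x : Rn n) : Measurable fun z : Rn n ↦ t • z + x := by
  fun_prop

theorem lintegral_rescale (μ : Measure (Rn n)) (t : ℝ) (x : Rn n) (f : Rn n → ℝ≥0∞) :
    ∫⁻ z, f (z + x) ∂rescale μ t = ∫⁻ y, f y ∂rescaleAt μ t x := by
  have hmap : rescaleAt μ t x = (rescale μ t).map (· + x) := by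
    rw [rescale, Measure.map_map (measurable_add_const x) (measurable_const_smul t)]
    rfl
  rw [hmap]
  exact (lintegral_map_equiv f (MeasurableEquiv.addRight x)).symm

theorem maximalOp_eq (μ : Measure (Rn n)) (v : Rn n → EReal) (x : Rn n) :
    maximalOp μ v x = ⨆ (t : ℝ) (_ : 0 < t), ∫⁻ y, (v y).abs ∂rescaleAt μ t x :=
  iSup_congr fun t ↦ iSup_congr fun _ ↦ lintegral_rescale μ t x fun y ↦ (v y).abs

instance [IsProbabilityMeasure μ] (t : ℝ) (x : Rn n) : IsProbabilityMeasure (rescaleAt μ t x) :=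
  Measure.isProbabilityMeasure_map (measurable_smul_add t x).aemeasurable

theorem IsSphericalLike.measure_compl_closedBall (h : IsSphericalLike μ R M) :
    μ (closedBall 0 R)ᶜ = 0 :=
  measure_mono_null (Set.compl_subset_compl.2 h.support_subset) Measure.measure_compl_support

theorem IsSphericalLike.radius_pos (hn : 2 ≤ n) (h : IsSphericalLike μ R M) : 0 < R := by
  have := h.isProbabilityMeasure
  by_contra! hR
  have hball (r : ℝ) (hr : 0 < r) : 1 ≤ ENNReal.ofReal (M * r ^ (n - 1)) := by
    refine le_trans ?_ (h.measure_ball_le 0 r hr)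
    rw [← (prob_compl_eq_zero_iff isClosed_closedBall.measurableSet).1 h.measure_compl_closedBall]
    exact measure_mono (closedBall_subset_ball (hR.trans_lt hr))
  have hlim : Tendsto (fun r : ℝ ↦ ENNReal.ofReal (M * r ^ (n - 1))) (𝓝[>] 0) (𝓝 0) := by
    have hcont : Continuous fun r : ℝ ↦ ENNReal.ofReal (M * r ^ (n - 1)) :=
      ENNReal.continuous_ofReal.comp (by fun_prop)
    simpa [zero_pow (show n - 1 ≠ 0 by lia)] using (hcont.tendsto 0).mono_left nhdsWithin_le_nhds
  refine not_le_of_gt one_pos (ge_of_tendsto hlim ?_)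
  filter_upwards [self_mem_nhdsWithin] with r hr using hball r hr

/-- The constant `M t^{-(n-1)}` for which the image of a spherical-like measure under
`z ↦ t z + x` is upper regular. -/
def growthConst (n : ℕ) (M t : ℝ) : ℝ≥0 := M.toNNReal * t⁻¹.toNNReal ^ (n - 1)

theorem coe_growthConst (n : ℕ) (M : ℝ) {t : ℝ} (ht : 0 < t) :
    (growthConst n M t : ℝ≥0∞) = ENNReal.ofReal M * (ENNReal.ofReal t)⁻¹ ^ (n - 1) := by
  rw [growthConst, ENNReal.coe_mul, ENNReal.coe_pow, ← ENNReal.ofReal_inv_of_pos ht]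
  rfl

theorem growthConst_mul_ofReal_pow (n : ℕ) (M : ℝ) {t R : ℝ} (ht : 0 < t) (hR : 0 < R) :
    growthConst n M t * ENNReal.ofReal (t * R) ^ (n - 1) = ENNReal.ofReal (R ^ (n - 1) * M) := by
  have hcancel : (ENNReal.ofReal t)⁻¹ * ENNReal.ofReal t = 1 :=
    ENNReal.inv_mul_cancel (ENNReal.ofReal_pos.2 ht).ne' ENNReal.ofReal_ne_top
  rw [coe_growthConst n M ht, ENNReal.ofReal_mul ht.le, ENNReal.ofReal_mul (by positivity),
    ENNReal.ofReal_pow hR.le, mul_assoc, ← mul_pow, ← mul_assoc, hcancel, one_mul, mul_comm]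

theorem IsSphericalLike.upperRegular_rescaleAt (h : IsSphericalLike μ R M) {t : ℝ} (ht : 0 < t)
    (x : Rn n) : UpperRegular (n - 1) (rescaleAt μ t x) (growthConst n M t) := by
  intro y r hr
  rw [rescaleAt, Measure.map_apply (measurable_smul_add t x) isOpen_ball.measurableSet]
  have hsub : (fun z ↦ t • z + x) ⁻¹' ball y r ⊆ ball (t⁻¹ • (y - x)) (t⁻¹ * r) := by
    intro z hz
    have hz' : z - t⁻¹ • (y - x) = t⁻¹ • (t • z + x - y) := by
      rw [smul_sub, smul_sub, smul_add, inv_smul_smul₀ ht.ne']; abel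
    rw [mem_ball_iff_norm, hz', norm_smul, Real.norm_of_nonneg (inv_pos.2 ht).le]
    exact mul_lt_mul_of_pos_left (mem_ball_iff_norm.1 hz) (inv_pos.2 ht)
  refine (measure_mono hsub).trans ((h.measure_ball_le _ _ (by positivity)).trans_eq ?_)
  rw [coe_growthConst n M ht, mul_pow, ← mul_assoc, ENNReal.ofReal_mul' (by positivity),
    ENNReal.ofReal_mul' (by positivity), ENNReal.ofReal_pow hr.le,
    ENNReal.ofReal_pow (by positivity), ENNReal.ofReal_inv_of_pos ht]

theorem IsSphericalLike.rescaleAt_compl_closedBall (h : IsSphericalLike μ R M) {t : ℝ} (ht : 0 < t)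
    (x : Rn n) : rescaleAt μ t x (closedBall x (t * R))ᶜ = 0 := by
  rw [rescaleAt, Measure.map_apply (measurable_smul_add t x)
    isClosed_closedBall.measurableSet.compl, Set.preimage_compl]
  have hsub : closedBall 0 R ⊆ (fun z ↦ t • z + x) ⁻¹' closedBall x (t * R) := by
    intro z hz
    rw [Set.mem_preimage, mem_closedBall_iff_norm, add_sub_cancel_right, norm_smul,
      Real.norm_of_nonneg ht.le]
    exact mul_le_mul_of_nonneg_left (mem_closedBall_zero_iff.1 hz) ht.le
  exact measure_mono_null (Set.compl_subset_compl.2 hsub) h.measure_compl_closedBall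

theorem setLIntegral_ball_le_rieszPotential (g : Rn n → Rn n) (x : Rn n) {r : ℝ} (hr : 0 < r) :
    ∫⁻ z in ball x r, ‖g z‖ₑ ≤ ENNReal.ofReal r ^ (n - 1) * rieszPotential g x := by
  have hr0 : ENNReal.ofReal r ^ (n - 1) ≠ 0 := pow_ne_zero _ (ENNReal.ofReal_pos.2 hr).ne'
  have hrtop : ENNReal.ofReal r ^ (n - 1) ≠ ⊤ := by finiteness
  rw [rieszPotential, ← lintegral_const_mul' _ _ hrtop]
  refine (setLIntegral_mono' isOpen_ball.measurableSet fun z hz ↦ ?_).trans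
    (setLIntegral_le_lintegral _ _)
  have hdist : ‖x - z‖ₑ ≤ ENNReal.ofReal r := by
    rw [← ofReal_norm, ← dist_eq_norm, dist_comm]
    exact ENNReal.ofReal_le_ofReal (mem_ball.1 hz).le
  calc ‖g z‖ₑ = ENNReal.ofReal r ^ (n - 1) * (‖g z‖ₑ / ENNReal.ofReal r ^ (n - 1)) :=
        (ENNReal.mul_div_cancel hr0 hrtop).symm
    _ ≤ ENNReal.ofReal r ^ (n - 1) * (‖g z‖ₑ / ‖x - z‖ₑ ^ (n - 1)) := by gcongr

theorem localSobolevNorm_le [NeZero n] (u : Rn n → ℝ) (g : Rn n → Rn n) (x : Rn n) {L : ℝ}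
    (hL : 0 < L) :
    localSobolevNorm x L u g ≤ 2 ^ n * (1 + volume (ball (0 : Rn n) 1)) *
      ENNReal.ofReal L ^ (n - 1) * (hardyLittlewood u x + rieszPotential g x) := by
  have hI := setLIntegral_ball_le_rieszPotential g x (r := 2 * L) (by positivity)
  have hH : ∫⁻ z in ball x (2 * L), ‖u z‖ₑ ≤
      ENNReal.ofReal (2 * L) ^ n * volume (ball (0 : Rn n) 1) * hardyLittlewood u x := by
    simpa only [finrank_euclideanSpace_fin] using!
      setLIntegral_ball_le_maximalFunction (μ := volume) (fun z ↦ ‖u z‖ₑ) x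
        (show 0 < 2 * L by positivity)
  rw [ENNReal.ofReal_mul zero_le_two, ENNReal.ofReal_ofNat, mul_pow] at hI hH
  set V := volume (ball (0 : Rn n) 1)
  set l := ENNReal.ofReal L
  have hl : l ^ n / l = l ^ (n - 1) := by
    rw [← pow_sub_one_mul (NeZero.ne n), ENNReal.mul_div_cancel_right
      (ENNReal.ofReal_pos.2 hL).ne' ENNReal.ofReal_ne_top]
  calc localSobolevNorm x L u g
      ≤ 2 ^ (n - 1) * l ^ (n - 1) * rieszPotential g x +
          2 ^ n * l ^ n * V * hardyLittlewood u x / l :=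
        add_le_add hI (ENNReal.div_le_div_right hH _)
    _ = 2 ^ (n - 1) * l ^ (n - 1) * rieszPotential g x +
          2 ^ n * V * (l ^ n / l) * hardyLittlewood u x := by simp only [div_eq_mul_inv]; ring
    _ ≤ 2 ^ n * (1 + V) * l ^ (n - 1) * rieszPotential g x +
          2 ^ n * (1 + V) * l ^ (n - 1) * hardyLittlewood u x := by
        rw [hl]
        gcongr
        · calc (2 : ℝ≥0∞) ^ (n - 1) ≤ 2 ^ n := pow_le_pow_right₀ one_le_two (Nat.sub_le n 1)
            _ ≤ 2 ^ n * (1 + V) := le_mul_of_one_le_right' le_self_add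
        · exact le_add_self
    _ = _ := by ring

theorem exists_maximalOp_preciseRep_le (hn : 2 ≤ n) :
    ∃ C : ℝ, 0 < C ∧ ∀ (μ : Measure (Rn n)) (R M : ℝ), IsSphericalLike μ R M →
      ∀ p : ℝ, 1 < p → ∀ (u : Rn n → ℝ) (g : Rn n → Rn n), IsSobolev p u g → ∀ x : Rn n,
        maximalOp μ (preciseRep u) x ≤
          ENNReal.ofReal (C * R ^ (n - 1) * M) * (hardyLittlewood u x + rieszPotential g x) := by
  have : NeZero n := ⟨by lia⟩
  obtain ⟨C, hC⟩ := exists_lintegral_preciseRep_le n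
  set V := volume (ball (0 : Rn n) 1)
  have hVtop : V ≠ ⊤ := measure_ball_lt_top.ne
  obtain ⟨K, hK⟩ : ∃ K : ℝ≥0, (K : ℝ≥0∞) = C * (2 ^ n * (1 + V)) := ENNReal.canLift.prf _
    (by finiteness)
  refine ⟨K + 1, by positivity, fun μ R M hμ p hp u g h x ↦ ?_⟩
  have hR := hμ.radius_pos hn
  have := hμ.isProbabilityMeasure
  rw [maximalOp_eq]
  refine iSup₂_le fun t ht ↦ ?_
  have htR : 0 < t * R := mul_pos ht hR
  set N := hardyLittlewood u x + rieszPotential g x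
  have htrace := (hC (rescaleAt μ t x) (growthConst n M t) x (t * R) htR
    (hμ.upperRegular_rescaleAt ht x) (hμ.rescaleAt_compl_closedBall ht x) p hp u g h 0
    contDiff_const).1
  have hgrad : ∇ (0 : Rn n → ℝ) = 0 := funext fun z ↦ gradient_const z 0
  simp only [hgrad, Pi.zero_apply, enorm_zero, lintegral_zero, zero_add, sub_zero] at htrace
  calc ∫⁻ y, (preciseRep u y).abs ∂rescaleAt μ t x
      ≤ C * growthConst n M t * (2 ^ n * (1 + V) * ENNReal.ofReal (t * R) ^ (n - 1) * N) := by
        refine htrace.trans ?_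
        gcongr
        exact localSobolevNorm_le u g x htR
    _ = C * (2 ^ n * (1 + V)) * (growthConst n M t * ENNReal.ofReal (t * R) ^ (n - 1)) * N := by
        ring
    _ = K * ENNReal.ofReal (R ^ (n - 1) * M) * N := by rw [hK, growthConst_mul_ofReal_pow n M ht hR]
    _ ≤ ENNReal.ofReal ((K + 1) * R ^ (n - 1) * M) * N := by
        rw [mul_assoc (_ + _) (_ ^ _), ENNReal.ofReal_mul (p := (K + 1 : ℝ)) (by positivity)]
        gcongr
        rw [← ENNReal.ofReal_coe_nnreal]
        exact ENNReal.ofReal_le_ofReal (by linarith)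

theorem lowerSemicontinuous_of_forall_exists_le_add {X : Type*} [TopologicalSpace X]
    {F : X → ℝ≥0∞} (hF : ∀ x, ∃ (f : ℕ → X → ℝ≥0∞) (e : ℕ → ℝ≥0∞), Tendsto e atTop (𝓝 0) ∧
      ∀ k, LowerSemicontinuous (f k) ∧ ∀ᶠ y in 𝓝 x, F y ≤ f k y + e k ∧ f k y ≤ F y + e k) :
    LowerSemicontinuous F := by
  intro x a ha
  obtain ⟨f, e, he, hf⟩ := hF x
  have hlim : Tendsto (fun k ↦ a + e k + e k) atTop (𝓝 a) := by
    simpa only [add_zero] using (he.const_add a).add he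
  obtain ⟨k, hk⟩ := (hlim.eventually_lt_const ha).exists
  have hfx : a + e k < f k x :=
    lt_of_add_lt_add_right (hk.trans_le (hf k).2.self_of_nhds.1)
  filter_upwards [(hf k).1 x _ hfx, (hf k).2] with y hy hFy
  exact lt_of_add_lt_add_right (hy.trans_le hFy.2)

theorem lowerSemicontinuous_lintegral_rescaleAt (μ : Measure (Rn n)) {f : Rn n → ℝ≥0∞}
    (hf : Continuous f) (t : ℝ) : LowerSemicontinuous fun x ↦ ∫⁻ y, f y ∂rescaleAt μ t x := by
  refine lowerSemicontinuous_iff_le_liminf.2 fun x ↦ ?_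
  simp only [rescaleAt, lintegral_map hf.measurable (measurable_smul_add _ _)]
  refine (lintegral_congr fun z ↦ ?_).trans_le
    (lintegral_liminf_le fun y ↦ hf.measurable.comp (measurable_smul_add t y))
  exact (Continuous.tendsto (f := fun y ↦ f (t • z + y)) (by fun_prop) x).liminf_eq.symm

theorem localSobolevNorm_le_two_mul {x y : Rn n} {L : ℝ} (hy : dist y x ≤ 2 * L)
    (u : Rn n → ℝ) (g : Rn n → Rn n) :
    localSobolevNorm y L u g ≤ 2 * localSobolevNorm x (2 * L) u g := by
  have hball : ball y (2 * L) ⊆ ball x (2 * (2 * L)) := ball_subset_ball' (by linarith)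
  calc localSobolevNorm y L u g
      ≤ (∫⁻ z in ball x (2 * (2 * L)), ‖g z‖ₑ) +
          (∫⁻ z in ball x (2 * (2 * L)), ‖u z‖ₑ) / ENNReal.ofReal L := by
        unfold localSobolevNorm; gcongr
    _ ≤ 2 * (∫⁻ z in ball x (2 * (2 * L)), ‖g z‖ₑ) +
          2 * ((∫⁻ z in ball x (2 * (2 * L)), ‖u z‖ₑ) / ENNReal.ofReal (2 * L)) := by
        rw [ENNReal.ofReal_mul zero_le_two, ENNReal.ofReal_ofNat, ← mul_div_assoc,
          ENNReal.mul_div_mul_left _ _ two_ne_zero ENNReal.ofNat_ne_top]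
        gcongr
        exact le_mul_of_one_le_left' one_le_two
    _ = 2 * localSobolevNorm x (2 * L) u g := (mul_add _ _ _).symm

theorem localSobolevNorm_sub_comm (x : Rn n) (L : ℝ) (u v : Rn n → ℝ) (g h : Rn n → Rn n) :
    localSobolevNorm x L (u - v) (g - h) = localSobolevNorm x L (v - u) (h - g) := by
  simp only [localSobolevNorm, Pi.sub_apply, enorm_sub_rev]

theorem lowerSemicontinuous_maximalOp (hn : 2 ≤ n) (hμ : IsSphericalLike μ R M) {p : ℝ}
    (hp : 1 < p) (h : IsSobolev p u g) : LowerSemicontinuous (maximalOp μ (preciseRep u)) := by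
  have : NeZero n := ⟨by lia⟩
  have := hμ.isProbabilityMeasure
  obtain ⟨C, hC⟩ := exists_lintegral_preciseRep_le n
  simp only [funext (maximalOp_eq μ (preciseRep u))]
  refine lowerSemicontinuous_iSup fun t ↦ lowerSemicontinuous_iSup fun ht ↦ ?_
  have htR : 0 < t * R := mul_pos ht (hμ.radius_pos hn)
  refine lowerSemicontinuous_of_forall_exists_le_add fun x ↦
    ⟨fun k y ↦ ∫⁻ z, ‖mollify volume k u z‖ₑ ∂rescaleAt μ t y, fun k ↦ C * growthConst n M t *
      (2 * localSobolevNorm x (2 * (t * R)) (mollify volume k u - u) (mollify volume k g - g)),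
      ?_, fun k ↦ ⟨?_, ?_⟩⟩
  · have hlim := tendsto_localSobolevNorm_mollify_sub h.weakGradient x (L := 2 * (t * R))
      (by positivity)
    simpa only [mul_zero, mul_assoc] using ENNReal.Tendsto.const_mul
      (a := C * growthConst n M t * 2) hlim (Or.inr (by finiteness))
  · exact lowerSemicontinuous_lintegral_rescaleAt μ
      (contDiff_mollify k h.weakGradient.locInt).continuous.enorm t
  · filter_upwards [closedBall_mem_nhds x (show 0 < 2 * (t * R) by positivity)] with y hy
    have hle : localSobolevNorm y (t * R) (u - mollify volume k u) (g - ∇ (mollify volume k u)) ≤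
        2 * localSobolevNorm x (2 * (t * R)) (mollify volume k u - u)
          (mollify volume k g - g) := by
      rw [gradient_mollify h.weakGradient, localSobolevNorm_sub_comm]
      exact localSobolevNorm_le_two_mul hy _ _
    have htrace := hC (rescaleAt μ t y) _ y (t * R) htR (hμ.upperRegular_rescaleAt ht y)
      (hμ.rescaleAt_compl_closedBall ht y) p hp u g h (mollify volume k u)
      (contDiff_mollify k h.weakGradient.locInt)
    exact ⟨htrace.1.trans (add_le_add_right (mul_le_mul_right hle _) _),
      htrace.2.trans (add_le_add_right (mul_le_mul_right hle _) _)⟩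

end MaximalOperator

section MaximalFunctionLeRieszPotential

theorem lintegral_Ioi_rpow {e : ℝ} (he : e < -1) {c : ℝ} (hc : 0 < c) :
    ∫⁻ t in Set.Ioi c, ENNReal.ofReal (t ^ e) = ENNReal.ofReal (-c ^ (e + 1) / (e + 1)) := by
  rw [← integral_Ioi_rpow_of_lt he hc,
    ofReal_integral_eq_lintegral_ofReal (integrableOn_Ioi_rpow_of_lt he hc)]
  filter_upwards [ae_restrict_mem measurableSet_Ioi] with s hs
  exact Real.rpow_nonneg (hc.le.trans hs.le) _

theorem lintegral_Ioi_inv_pow {m : ℕ} (hm : m ≠ 0) {a : ℝ} (ha : 0 < a) :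
    ∫⁻ s in Set.Ioi a, (ENNReal.ofReal s ^ (m + 1))⁻¹ =
      (m : ℝ≥0∞)⁻¹ * (ENNReal.ofReal a ^ m)⁻¹ := by
  have hm₀ : (0 : ℝ) < m := by positivity
  have hrpow : ∀ s ∈ Set.Ioi a, (ENNReal.ofReal s ^ (m + 1))⁻¹ =
      ENNReal.ofReal (s ^ (-((m : ℝ) + 1))) := by
    intro s hs
    have hs₀ : 0 < s := ha.trans hs
    rw [Real.rpow_neg hs₀.le, ENNReal.ofReal_inv_of_pos (by positivity),
      ← ENNReal.ofReal_pow hs₀.le]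
    norm_cast
  rw [setLIntegral_congr_fun measurableSet_Ioi hrpow, lintegral_Ioi_rpow (by linarith) ha,
    neg_add_rev, neg_add_cancel_comm, neg_div_neg_eq, Real.rpow_neg ha.le, Real.rpow_natCast,
    div_eq_mul_inv, mul_comm, ENNReal.ofReal_mul (by positivity), ENNReal.ofReal_inv_of_pos hm₀,
    ENNReal.ofReal_inv_of_pos (by positivity), ENNReal.ofReal_natCast, ENNReal.ofReal_pow ha.le]

section NormedSpace

variable {E : Type*} [NormedAddCommGroup E] [NormedSpace ℝ E] [FiniteDimensional ℝ E]
  [MeasurableSpace E] [BorelSpace E] {μ : Measure E}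

theorem lintegral_Ioi_lintegral_ball [SFinite μ] [NullSingletonClass μ] (hE : 1 < finrank ℝ E)
    {h : E → ℝ≥0∞} (hh : Measurable h) (x : E) :
    ∫⁻ s in Set.Ioi (0 : ℝ), (ENNReal.ofReal s ^ finrank ℝ E)⁻¹ * ∫⁻ w in ball x s, h w ∂μ =
      ((finrank ℝ E - 1 : ℕ) : ℝ≥0∞)⁻¹ * ∫⁻ z, h z / ‖x - z‖ₑ ^ (finrank ℝ E - 1) ∂μ := by
  obtain ⟨m, hm⟩ : ∃ m, finrank ℝ E = m + 1 := ⟨finrank ℝ E - 1, by omega⟩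
  have hm₀ : m ≠ 0 := by omega
  rw [hm, Nat.add_sub_cancel]
  have hset : MeasurableSet {q : ℝ × E | dist q.2 x < q.1} :=
    (isOpen_lt (by fun_prop) (by fun_prop)).measurableSet
  have hmeas : Measurable fun q : ℝ × E ↦
      (ball x q.1).indicator (fun z ↦ (ENNReal.ofReal q.1 ^ (m + 1))⁻¹ * h z) q.2 :=
    ((by fun_prop : Measurable fun q : ℝ × E ↦ (ENNReal.ofReal q.1 ^ (m + 1))⁻¹).mul
      (hh.comp measurable_snd)).indicator hset
  have hslice (z : E) : (fun s ↦ (ball x s).indicator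
      (fun z ↦ (ENNReal.ofReal s ^ (m + 1))⁻¹ * h z) z) =
      (Set.Ioi (dist z x)).indicator fun s ↦ (ENNReal.ofReal s ^ (m + 1))⁻¹ * h z := by
    ext s
    simp only [Set.indicator, mem_ball, Set.mem_Ioi]
  simp only [← lintegral_const_mul _ hh]
  simp only [← lintegral_indicator measurableSet_ball]
  rw [lintegral_lintegral_swap hmeas.aemeasurable,
    ← lintegral_const_mul' _ _ (ENNReal.inv_ne_top.2 (by exact_mod_cast hm₀))]
  refine lintegral_congr_ae ?_
  filter_upwards [compl_mem_ae_iff.2 (measure_singleton (μ := μ) x)] with z hz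
  have hdist : 0 < dist z x := dist_pos.2 hz
  rw [hslice, setLIntegral_indicator measurableSet_Ioi, Set.Ioi_inter_Ioi, max_eq_left hdist.le,
    lintegral_mul_const _ (by fun_prop), lintegral_Ioi_inv_pow hm₀ hdist, dist_comm, dist_eq_norm,
    ofReal_norm, div_eq_mul_inv]
  ring

theorem radialPotential_add [SFinite μ] {h : E → ℝ≥0∞} (hh : Measurable h) (h' : E → ℝ≥0∞)
    (r ρ : ℝ) (x : E) :
    radialPotential μ (fun w ↦ h w + h' w) r ρ x =
      radialPotential μ h r ρ x + radialPotential μ h' r ρ x := by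
  have hmeas : Measurable fun s : ℝ ↦
      (ENNReal.ofReal s ^ finrank ℝ E)⁻¹ * ∫⁻ w in ball x s, h w ∂μ :=
    Measurable.of_uncurry_left (f := fun (y : E) (s : ℝ) ↦
      (ENNReal.ofReal s ^ finrank ℝ E)⁻¹ * ∫⁻ w in ball y s, h w ∂μ)
      (measurable_radialPotential_integrand hh)
  simp only [radialPotential]
  rw [← lintegral_add_left hmeas]
  refine lintegral_congr fun s ↦ ?_
  rw [lintegral_add_left hh, mul_add]

theorem laverage_ball_enorm_le [μ.IsAddHaarMeasure] {v : E → ℝ} (hv : ContDiff ℝ 1 v) (x : E)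
    {r ρ : ℝ} (hr : 0 < r) (hρ : r ≤ ρ) :
    ⨍⁻ w in ball x r, ‖v w‖ₑ ∂μ ≤ ⨍⁻ w in ball x ρ, ‖v w‖ₑ ∂μ +
      (μ (ball 0 1))⁻¹ * radialPotential μ (fun w ↦ ‖fderiv ℝ v w‖ₑ) r ρ x := by
  have hmeas : Measurable fun z ↦ ‖v (x + ρ • z)‖ₑ :=
    (hv.continuous.comp (by fun_prop)).enorm.measurable
  rw [laverage_ball_eq _ x hr, laverage_ball_eq _ x (hr.trans_le hρ), ← mul_add]
  refine mul_le_mul_right (le_trans ?_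
    (add_le_add_right (lintegral_unitBall_enorm_sub_le hv x hr.le hρ) _)) _
  rw [← lintegral_add_left hmeas]
  refine lintegral_mono fun z ↦ ?_
  calc ‖v (x + r • z)‖ₑ = ‖v (x + ρ • z) - (v (x + ρ • z) - v (x + r • z))‖ₑ := by
        rw [sub_sub_cancel]
    _ ≤ _ := enorm_sub_le

theorem tendsto_laverage_ball_atTop [Nontrivial E] [μ.IsAddHaarMeasure] {p : ℝ} (hp : 1 < p)
    {h : E → ℝ≥0∞} (hh : ∫⁻ z, h z ^ p ∂μ ≠ ⊤) (x : E) :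
    Tendsto (fun ρ ↦ ⨍⁻ w in ball x ρ, h w ∂μ) atTop (𝓝 0) := by
  refine ENNReal.tendsto_nhds_zero.2 fun ε hε ↦ ?_
  obtain ⟨δ, hδ, hδε⟩ := ENNReal.lt_iff_exists_nnreal_btwn.1 hε
  have hl : (0 : ℝ) < δ / 2 := half_pos (by exact_mod_cast hδ)
  have hδl : (δ : ℝ≥0∞) = ENNReal.ofReal (δ / 2) + ENNReal.ofReal (δ / 2) := by
    rw [← ENNReal.ofReal_add hl.le hl.le, add_halves, ENNReal.ofReal_coe_nnreal]
  set l : ℝ := δ / 2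
  set N := ENNReal.ofReal (l ^ (1 - p)) * ∫⁻ z, h z ^ p ∂μ
  have hvol : Tendsto (fun ρ : ℝ ↦ ENNReal.ofReal ρ ^ finrank ℝ E * μ (ball 0 1)) atTop (𝓝 ⊤) := by
    have hpow := ((ENNReal.continuous_pow (finrank ℝ E)).tendsto ⊤).comp
      ENNReal.tendsto_ofReal_atTop
    rw [ENNReal.top_pow finrank_pos.ne'] at hpow
    have := ENNReal.Tendsto.mul_const (b := μ (ball 0 1)) hpow (Or.inl ENNReal.top_ne_zero)
    rwa [ENNReal.top_mul (measure_ball_pos _ _ one_pos).ne'] at this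
  have hlim := ENNReal.Tendsto.const_div (a := N) hvol
    (Or.inr (ENNReal.mul_ne_top ENNReal.ofReal_ne_top hh))
  rw [ENNReal.div_top] at hlim
  filter_upwards [hlim.eventually (gt_mem_nhds (ENNReal.ofReal_pos.2 hl)), eventually_gt_atTop 0]
    with ρ hρ hρ₀
  rw [← measure_ball_eq x hρ₀] at hρ
  have hball : ∫⁻ w in ball x ρ, h w ∂μ ≤ ENNReal.ofReal l * μ (ball x ρ) + N := by
    refine (lintegral_mono fun w ↦ le_add_mul_rpow hp (h w) hl).trans ?_
    rw [lintegral_add_left measurable_const, setLIntegral_const,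
      lintegral_const_mul' _ _ ENNReal.ofReal_ne_top]
    exact add_le_add_right (mul_le_mul_right (setLIntegral_le_lintegral _ _) _) _
  calc ⨍⁻ w in ball x ρ, h w ∂μ
      ≤ (ENNReal.ofReal l * μ (ball x ρ) + N) / μ (ball x ρ) := by
        rw [setLAverage_eq]
        exact ENNReal.div_le_div_right hball _
    _ = ENNReal.ofReal l + N / μ (ball x ρ) := by
        rw [ENNReal.add_div, ENNReal.mul_div_cancel_right (measure_ball_pos _ _ hρ₀).ne'
          measure_ball_lt_top.ne]
    _ ≤ ε := by
        refine le_trans ?_ hδε.le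
        rw [hδl]
        exact add_le_add_right hρ.le _

end NormedSpace

theorem tendsto_lintegral_enorm {α F : Type*} [MeasurableSpace α] {μ : Measure α}
    [NormedAddCommGroup F] {f : ℕ → α → F} {f₀ : α → F} (hf : ∀ k, AEStronglyMeasurable (f k) μ)
    (hf₀ : AEStronglyMeasurable f₀ μ)
    (h : Tendsto (fun k ↦ ∫⁻ z, ‖f k z - f₀ z‖ₑ ∂μ) atTop (𝓝 0)) :
    Tendsto (fun k ↦ ∫⁻ z, ‖f k z‖ₑ ∂μ) atTop (𝓝 (∫⁻ z, ‖f₀ z‖ₑ ∂μ)) := by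
  have hupper (k : ℕ) : ∫⁻ z, ‖f k z‖ₑ ∂μ ≤ ∫⁻ z, ‖f₀ z‖ₑ ∂μ + ∫⁻ z, ‖f k z - f₀ z‖ₑ ∂μ := by
    rw [← lintegral_add_left' hf₀.enorm]
    exact lintegral_mono fun z ↦ by simpa using enorm_add_le (f₀ z) (f k z - f₀ z)
  have hlower (k : ℕ) : ∫⁻ z, ‖f₀ z‖ₑ ∂μ ≤ ∫⁻ z, ‖f k z‖ₑ ∂μ + ∫⁻ z, ‖f k z - f₀ z‖ₑ ∂μ := by
    rw [← lintegral_add_left' (hf k).enorm]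
    exact lintegral_mono fun z ↦ by simpa using enorm_sub_le (a := f k z) (b := f k z - f₀ z)
  refine tendsto_of_le_liminf_of_limsup_le ?_ ?_
  · rw [← ENNReal.liminf_add_of_right_tendsto_zero h]
    exact le_liminf_of_le (by isBoundedDefault) (Eventually.of_forall hlower)
  · refine (limsup_le_limsup (Eventually.of_forall hupper)).trans_eq ?_
    exact (tendsto_const_nhds.add h).limsup_eq.trans (add_zero _)

variable {n : ℕ} {u : Rn n → ℝ} {g : Rn n → Rn n}

theorem radialPotential_le_rieszPotential (hn : 2 ≤ n) (hg : Measurable g) {r : ℝ} (hr : 0 ≤ r)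
    (ρ : ℝ) (x : Rn n) : radialPotential volume (fun w ↦ ‖g w‖ₑ) r ρ x ≤ rieszPotential g x := by
  have : Nontrivial (Rn n) := nontrivial_of_finrank_pos (R := ℝ) (by simp; omega)
  have hpolar := lintegral_Ioi_lintegral_ball (μ := volume)
    (by rw [finrank_euclideanSpace_fin]; omega) hg.enorm x
  refine (lintegral_mono_set fun s hs ↦ hr.trans_lt hs.1).trans (hpolar.trans_le ?_)
  rw [finrank_euclideanSpace_fin]
  refine mul_le_of_le_one_left zero_le (ENNReal.inv_le_one.2 ?_)
  exact_mod_cast (by omega : 1 ≤ n - 1)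

theorem laverage_ball_enorm_le_of_isWeakGradient (hg : Measurable g) (h : IsWeakGradient u g)
    (x : Rn n) {r ρ : ℝ} (hr : 0 < r) (hρ : r ≤ ρ) :
    ⨍⁻ w in ball x r, ‖u w‖ₑ ∂volume ≤ ⨍⁻ w in ball x ρ, ‖u w‖ₑ ∂volume +
      (volume (ball (0 : Rn n) 1))⁻¹ * radialPotential volume (fun w ↦ ‖g w‖ₑ) r ρ x := by
  have haverage {s : ℝ} (hs : 0 < s) :
      Tendsto (fun k ↦ ⨍⁻ w in ball x s, ‖mollify volume k u w‖ₑ ∂volume) atTop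
        (𝓝 (⨍⁻ w in ball x s, ‖u w‖ₑ ∂volume)) := by
    simp only [setLAverage_eq]
    exact ENNReal.Tendsto.div_const (tendsto_lintegral_enorm
      (fun k ↦ (contDiff_mollify k h.locInt).continuous.aestronglyMeasurable)
      h.locInt.aestronglyMeasurable.restrict (tendsto_setLIntegral_mollify_sub h.locInt x s))
      (Or.inr (measure_ball_pos _ _ hs).ne')
  set c := (ENNReal.ofReal r ^ finrank ℝ (Rn n))⁻¹ * ENNReal.ofReal (ρ - r)
  have hc : c ≠ ⊤ := ENNReal.mul_ne_top
    (ENNReal.inv_ne_top.2 (pow_ne_zero _ (ENNReal.ofReal_pos.2 hr).ne')) ENNReal.ofReal_ne_top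
  have herror : Tendsto (fun k ↦ c * ∫⁻ w in ball x ρ, ‖mollify volume k g w - g w‖ₑ) atTop
      (𝓝 0) := by
    simpa using ENNReal.Tendsto.const_mul
      (tendsto_setLIntegral_mollify_sub h.locInt_grad x ρ) (Or.inr hc)
  have hpotential (k : ℕ) : radialPotential volume (fun w ↦ ‖fderiv ℝ (mollify volume k u) w‖ₑ)
      r ρ x ≤ radialPotential volume (fun w ↦ ‖g w‖ₑ) r ρ x +
        c * ∫⁻ w in ball x ρ, ‖mollify volume k g w - g w‖ₑ := by
    refine le_trans ?_ (add_le_add_right (radialPotential_le_mul _ r ρ x) _)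
    rw [← radialPotential_add hg.enorm]
    refine radialPotential_mono (fun w ↦ ?_) le_rfl x
    simpa [enorm_fderiv_mollify h k w] using enorm_add_le (g w) (mollify volume k g w - g w)
  have hlim := (haverage (hr.trans_le hρ)).add (ENNReal.Tendsto.const_mul (herror.const_add
    (radialPotential volume (fun w ↦ ‖g w‖ₑ) r ρ x))
    (Or.inr (ENNReal.inv_ne_top.2 (measure_ball_pos volume (0 : Rn n) one_pos).ne')))
  rw [add_zero] at hlim
  refine le_of_tendsto_of_tendsto' (haverage hr) hlim fun k ↦ ?_
  exact (laverage_ball_enorm_le (contDiff_mollify k h.locInt) x hr hρ).trans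
    (add_le_add_right (mul_le_mul_right (hpotential k) _) _)

theorem hardyLittlewood_le_rieszPotential (hn : 2 ≤ n) {p : ℝ} (hp : 1 < p) (hg : Measurable g)
    (h : IsWeakGradient u g) (hu : ∫⁻ z, ‖u z‖ₑ ^ p ≠ ⊤) (x : Rn n) :
    hardyLittlewood u x ≤ (volume (ball (0 : Rn n) 1))⁻¹ * rieszPotential g x := by
  have : Nontrivial (Rn n) := nontrivial_of_finrank_pos (R := ℝ) (by simp; omega)
  refine iSup₂_le fun r hr ↦ ?_
  have hlim := (tendsto_laverage_ball_atTop hp hu x).add_const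
    ((volume (ball (0 : Rn n) 1))⁻¹ * rieszPotential g x)
  rw [zero_add] at hlim
  refine ge_of_tendsto hlim ?_
  filter_upwards [eventually_ge_atTop r] with ρ hρ
  exact (laverage_ball_enorm_le_of_isWeakGradient hg h x hr hρ).trans
    (add_le_add_right (mul_le_mul_right (radialPotential_le_rieszPotential hn hg hr.le ρ x) _) _)

end MaximalFunctionLeRieszPotential

section HardyLittlewoodSobolev

theorem setLIntegral_le_rpow_mul_measure_rpow {X : Type*} [MeasurableSpace X] {ν : Measure X}
    {h : X → ℝ≥0∞} (hh : Measurable h) {p : ℝ} (hp : 1 < p) (s : Set X) :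
    ∫⁻ z in s, h z ∂ν ≤ (∫⁻ z, h z ^ p ∂ν) ^ (1 / p) * ν s ^ (1 - 1 / p) := by
  have hpq := Real.HolderConjugate.conjExponent hp
  calc ∫⁻ z in s, h z ∂ν
      ≤ (∫⁻ z in s, h z ^ p ∂ν) ^ (1 / p) * ν s ^ (1 / p.conjExponent) := by
        simpa only [Pi.mul_apply, mul_one, ENNReal.one_rpow, setLIntegral_const, one_mul] using
          ENNReal.lintegral_mul_le_Lp_mul_Lq (ν.restrict s) hpq hh.aemeasurable
            (aemeasurable_const (b := 1))
    _ ≤ (∫⁻ z, h z ^ p ∂ν) ^ (1 / p) * ν s ^ (1 - 1 / p) := by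
        rw [one_div p.conjExponent, ← hpq.one_sub_inv, one_div]
        refine mul_le_mul_left (ENNReal.rpow_le_rpow (setLIntegral_le_lintegral _ _) ?_) _
        positivity

theorem exists_pos_balance {m L θ : ℝ} (hm : 0 < m) (hL : 0 < L) (hθ : 0 < θ) :
    ∃ ρ > 0, m * ρ = m ^ (θ / (1 + θ)) * L ^ (1 / (1 + θ)) ∧
      L * ρ ^ (-θ) = m ^ (θ / (1 + θ)) * L ^ (1 / (1 + θ)) := by
  have hθ' : 1 + θ ≠ 0 := by positivity
  refine ⟨m ^ (-(1 / (1 + θ))) * L ^ (1 / (1 + θ)), by positivity, ?_, ?_⟩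
  · rw [← mul_assoc, ← Real.rpow_one_add' hm.le (by field_simp; simp [hθ.ne', hθ'])]
    congr 2
    field_simp
    ring
  · rw [Real.mul_rpow (by positivity) (by positivity), ← Real.rpow_mul hm.le, ← Real.rpow_mul hL.le,
      mul_left_comm, ← Real.rpow_one_add' hL.le (by field_simp; simp [hθ'])]
    congr 2 <;> field_simp
    ring

theorem le_mul_rpow_mul_rpow_of_forall_pos {X A B m L : ℝ≥0∞} {θ : ℝ} (hm : m ≠ 0) (hm' : m ≠ ⊤)
    (hL : L ≠ 0) (hL' : L ≠ ⊤) (hθ : 0 < θ)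
    (hX : ∀ ρ : ℝ, 0 < ρ →
      X ≤ A * (m * ENNReal.ofReal ρ) + B * (L * ENNReal.ofReal (ρ ^ (-θ)))) :
    X ≤ (A + B) * (m ^ (θ / (1 + θ)) * L ^ (1 / (1 + θ))) := by
  have hm₀ := ENNReal.toReal_pos hm hm'
  have hL₀ := ENNReal.toReal_pos hL hL'
  obtain ⟨ρ, hρ, hnear, hfar⟩ := exists_pos_balance hm₀ hL₀ hθ
  have hbound := hX ρ hρ
  rw [← ENNReal.ofReal_toReal hm', ← ENNReal.ofReal_toReal hL'] at hbound ⊢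
  rwa [← ENNReal.ofReal_mul hm₀.le, ← ENNReal.ofReal_mul hL₀.le, hnear, hfar, ← add_mul,
    ENNReal.ofReal_mul (by positivity), ← ENNReal.ofReal_rpow_of_pos hm₀,
    ← ENNReal.ofReal_rpow_of_pos hL₀] at hbound

variable {E : Type*} [NormedAddCommGroup E] [NormedSpace ℝ E] [FiniteDimensional ℝ E]
  [MeasurableSpace E] [BorelSpace E] {μ : Measure E} {h : E → ℝ≥0∞} {p : ℝ}

theorem lintegral_div_enorm_pow_eq_zero_of_lintegral_rpow (hp : 0 < p) (hh : Measurable h)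
    (hN : ∫⁻ z, h z ^ p ∂μ = 0) (x : E) (m : ℕ) : ∫⁻ z, h z / ‖x - z‖ₑ ^ m ∂μ = 0 := by
  rw [lintegral_eq_zero_iff (hh.pow_const p)] at hN
  rw [lintegral_eq_zero_iff' (by fun_prop)]
  filter_upwards [hN] with z hz
  rw [Pi.zero_apply, ENNReal.rpow_eq_zero_iff_of_pos hp] at hz
  rw [hz, ENNReal.zero_div, Pi.zero_apply]

variable [μ.IsAddHaarMeasure]

theorem setLIntegral_Ioc_lintegral_ball_le (h : E → ℝ≥0∞) (x : E) (ρ : ℝ) :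
    ∫⁻ s in Set.Ioc 0 ρ, (ENNReal.ofReal s ^ finrank ℝ E)⁻¹ * ∫⁻ w in ball x s, h w ∂μ ≤
      μ (ball 0 1) * (maximalFunction μ h x * ENNReal.ofReal ρ) := by
  calc ∫⁻ s in Set.Ioc 0 ρ, (ENNReal.ofReal s ^ finrank ℝ E)⁻¹ * ∫⁻ w in ball x s, h w ∂μ
      ≤ ∫⁻ _ in Set.Ioc 0 ρ, μ (ball 0 1) * maximalFunction μ h x := by
        refine setLIntegral_mono' measurableSet_Ioc fun s hs ↦ ?_
        rw [ENNReal.inv_mul_le_iff (pow_ne_zero _ (by simpa using hs.1)) (by finiteness),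
          ← mul_assoc]
        exact setLIntegral_ball_le_maximalFunction h x hs.1
    _ = _ := by rw [setLIntegral_const, Real.volume_Ioc, sub_zero, mul_assoc]

theorem setLIntegral_Ioi_lintegral_ball_le (hh : Measurable h) (hp : 1 < p)
    (hpE : p < finrank ℝ E) (hN : ∫⁻ z, h z ^ p ∂μ ≠ ⊤) (x : E) {ρ : ℝ} (hρ : 0 < ρ) :
    ∫⁻ s in Set.Ioi ρ, (ENNReal.ofReal s ^ finrank ℝ E)⁻¹ * ∫⁻ w in ball x s, h w ∂μ ≤
      μ (ball 0 1) ^ (1 - 1 / p) * ENNReal.ofReal (1 / (finrank ℝ E / p - 1)) *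
        ((∫⁻ z, h z ^ p ∂μ) ^ (1 / p) * ENNReal.ofReal (ρ ^ (-(finrank ℝ E / p - 1)))) := by
  have hp₀ : 0 < p := zero_lt_one.trans hp
  have hd : 0 < finrank ℝ E / p - 1 := sub_pos.2 ((one_lt_div hp₀).2 hpE)
  have hp' : 0 < 1 - 1 / p := sub_pos.2 ((div_lt_one hp₀).2 hp)
  set d := finrank ℝ E
  set V := μ (ball 0 1)
  have hV : V ≠ ⊤ := measure_ball_lt_top.ne
  set N := ∫⁻ z, h z ^ p ∂μ
  have hpow : ∀ s ∈ Set.Ioi ρ,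
      (ENNReal.ofReal s ^ d)⁻¹ * (ENNReal.ofReal s ^ d) ^ (1 - 1 / p) =
        ENNReal.ofReal (s ^ (-(d / p : ℝ))) := by
    intro s hs
    have hs₀ : 0 < s := hρ.trans hs
    rw [← ENNReal.ofReal_pow hs₀.le, ← ENNReal.ofReal_inv_of_pos (by positivity),
      ENNReal.ofReal_rpow_of_pos (by positivity), ← ENNReal.ofReal_mul (by positivity),
      ← Real.rpow_neg_one, ← Real.rpow_add (by positivity), ← Real.rpow_natCast,
      ← Real.rpow_mul hs₀.le]
    ring_nf
  calc ∫⁻ s in Set.Ioi ρ, (ENNReal.ofReal s ^ d)⁻¹ * ∫⁻ w in ball x s, h w ∂μ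
      ≤ ∫⁻ s in Set.Ioi ρ, N ^ (1 / p) * V ^ (1 - 1 / p) * ENNReal.ofReal (s ^ (-(d / p : ℝ))) := by
        refine setLIntegral_mono' measurableSet_Ioi fun s hs ↦ ?_
        rw [← hpow s hs]
        refine (mul_le_mul_right (setLIntegral_le_rpow_mul_measure_rpow hh hp _) _).trans_eq ?_
        rw [measure_ball_eq x (hρ.trans hs), ENNReal.mul_rpow_of_nonneg _ _ hp'.le]
        ring
    _ = N ^ (1 / p) * V ^ (1 - 1 / p) *
          (ENNReal.ofReal (1 / (d / p - 1)) * ENNReal.ofReal (ρ ^ (-(d / p - 1 : ℝ)))) := by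
        rw [lintegral_const_mul' _ _ (by finiteness), lintegral_Ioi_rpow (by linarith) hρ,
          ← ENNReal.ofReal_mul (by positivity), neg_add_eq_sub, ← neg_sub (d / p : ℝ) 1,
          neg_div_neg_eq, one_div_mul_eq_div]
    _ = _ := by ring

theorem lintegral_div_enorm_pow_le_add (hE : 1 < finrank ℝ E) (hh : Measurable h) (hp : 1 < p)
    (hpE : p < finrank ℝ E) (hN : ∫⁻ z, h z ^ p ∂μ ≠ ⊤) (x : E) {ρ : ℝ} (hρ : 0 < ρ) :
    ((finrank ℝ E - 1 : ℕ) : ℝ≥0∞)⁻¹ * ∫⁻ z, h z / ‖x - z‖ₑ ^ (finrank ℝ E - 1) ∂μ ≤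
      μ (ball 0 1) * (maximalFunction μ h x * ENNReal.ofReal ρ) +
      μ (ball 0 1) ^ (1 - 1 / p) * ENNReal.ofReal (1 / (finrank ℝ E / p - 1)) *
        ((∫⁻ z, h z ^ p ∂μ) ^ (1 / p) * ENNReal.ofReal (ρ ^ (-(finrank ℝ E / p - 1)))) := by
  have : Nontrivial E := nontrivial_of_finrank_pos (R := ℝ) (by lia)
  rw [← lintegral_Ioi_lintegral_ball hE hh x, ← Set.Ioc_union_Ioi_eq_Ioi hρ.le,
    lintegral_union measurableSet_Ioi Set.Ioc_disjoint_Ioi_same]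
  exact add_le_add (setLIntegral_Ioc_lintegral_ball_le h x ρ)
    (setLIntegral_Ioi_lintegral_ball_le hh hp hpE hN x hρ)

theorem lintegral_div_enorm_pow_eq_zero_of_maximalFunction (hE : 1 < finrank ℝ E)
    (hh : Measurable h) {x : E} (hM : maximalFunction μ h x = 0) :
    ∫⁻ z, h z / ‖x - z‖ₑ ^ (finrank ℝ E - 1) ∂μ = 0 := by
  have : Nontrivial E := nontrivial_of_finrank_pos (R := ℝ) (by lia)
  have hzero : ∫⁻ s in Set.Ioi (0 : ℝ), (ENNReal.ofReal s ^ finrank ℝ E)⁻¹ *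
      ∫⁻ w in ball x s, h w ∂μ = 0 := by
    refine setLIntegral_eq_zero measurableSet_Ioi fun s hs ↦ ?_
    have hball := setLIntegral_ball_le_maximalFunction (μ := μ) h x hs
    rw [hM, mul_zero, nonpos_iff_eq_zero] at hball
    rw [hball, mul_zero, Pi.zero_apply]
  rw [lintegral_Ioi_lintegral_ball hE hh x] at hzero
  exact (mul_eq_zero.1 hzero).resolve_left (ENNReal.inv_ne_zero.2 (ENNReal.natCast_ne_top _))

variable (μ) in
/-- Hedberg's inequality. -/
theorem exists_lintegral_div_enorm_pow_le_maximalFunction (hE : 1 < finrank ℝ E) (hp : 1 < p)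
    (hpE : p < finrank ℝ E) :
    ∃ K : ℝ≥0, ∀ h : E → ℝ≥0∞, Measurable h → ∫⁻ z, h z ^ p ∂μ ≠ ⊤ → ∀ x,
      ∫⁻ z, h z / ‖x - z‖ₑ ^ (finrank ℝ E - 1) ∂μ ≤
        K * (maximalFunction μ h x ^ (1 - p / finrank ℝ E) *
          (∫⁻ z, h z ^ p ∂μ) ^ (1 / (finrank ℝ E : ℝ))) := by
  have hp₀ : 0 < p := zero_lt_one.trans hp
  have hE₀ : (0 : ℝ) < finrank ℝ E := hp₀.trans hpE
  have hθ : 0 < finrank ℝ E / p - 1 := sub_pos.2 ((one_lt_div hp₀).2 hpE)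
  have hpE' : 0 < 1 - p / finrank ℝ E := sub_pos.2 ((div_lt_one hE₀).2 hpE)
  have hp' : 0 < 1 - 1 / p := sub_pos.2 ((div_lt_one hp₀).2 hp)
  have hball : μ (ball (0 : E) 1) ≠ ⊤ := measure_ball_lt_top.ne
  obtain ⟨K, hK⟩ : ∃ K : ℝ≥0, (K : ℝ≥0∞) = (finrank ℝ E - 1 : ℕ) * (μ (ball (0 : E) 1) +
      μ (ball (0 : E) 1) ^ (1 - 1 / p) * ENNReal.ofReal (1 / (finrank ℝ E / p - 1))) :=
    ENNReal.canLift.prf _ (by finiteness)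
  refine ⟨K + 1, fun h hh hN x ↦ ?_⟩
  rcases eq_or_ne (∫⁻ z, h z ^ p ∂μ) 0 with hN₀ | hN₀
  · rw [lintegral_div_enorm_pow_eq_zero_of_lintegral_rpow hp₀ hh hN₀]
    exact zero_le
  rcases eq_or_ne (maximalFunction μ h x) 0 with hm₀ | hm₀
  · rw [lintegral_div_enorm_pow_eq_zero_of_maximalFunction hE hh hm₀]
    exact zero_le
  rcases eq_or_ne (maximalFunction μ h x) ⊤ with hm | hm
  · have hN' : (∫⁻ z, h z ^ p ∂μ) ^ (1 / (finrank ℝ E : ℝ)) ≠ 0 := by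
      simp [ENNReal.rpow_eq_zero_iff, hN₀, hN]
    rw [hm, ENNReal.top_rpow_of_pos hpE', ENNReal.top_mul hN', ENNReal.mul_top (by simp)]
    exact le_top
  have hbalance := le_mul_rpow_mul_rpow_of_forall_pos hm₀ hm
    (by simp [ENNReal.rpow_eq_zero_iff, hN₀, hN])
    (ENNReal.rpow_ne_top_of_nonneg (by positivity) hN) hθ
    fun ρ hρ ↦ lintegral_div_enorm_pow_le_add hE hh hp hpE hN x hρ
  rw [ENNReal.inv_mul_le_iff (Nat.cast_ne_zero.2 (by lia)) (ENNReal.natCast_ne_top _), ← mul_assoc,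
    ← hK, ← ENNReal.rpow_mul] at hbalance
  have hexp : (finrank ℝ E / p - 1) / (1 + (finrank ℝ E / p - 1)) = 1 - p / finrank ℝ E := by
    rw [add_sub_cancel]; field_simp
  have hexp' : 1 / p * (1 / (1 + (finrank ℝ E / p - 1))) = 1 / finrank ℝ E := by
    rw [add_sub_cancel]; field_simp
  rw [hexp, hexp'] at hbalance
  refine hbalance.trans (mul_le_mul_left ?_ _)
  exact_mod_cast le_self_add

variable (μ) in
/-- The Hardy–Littlewood–Sobolev inequality for the Riesz potential of order one. -/
theorem exists_lintegral_rpow_lintegral_div_enorm_pow_le (hE : 1 < finrank ℝ E) (hp : 1 < p)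
    (hpE : p < finrank ℝ E) {q : ℝ} (hq : q = finrank ℝ E * p / (finrank ℝ E - p)) :
    ∃ K : ℝ≥0, ∀ h : E → ℝ≥0∞, Measurable h → ∫⁻ z, h z ^ p ∂μ ≠ ⊤ →
      (∫⁻ x, (∫⁻ z, h z / ‖x - z‖ₑ ^ (finrank ℝ E - 1) ∂μ) ^ q ∂μ) ^ (1 / q) ≤
        K * (∫⁻ z, h z ^ p ∂μ) ^ (1 / p) := by
  have : Nontrivial E := nontrivial_of_finrank_pos (R := ℝ) (by lia)
  have : 0 < p := zero_lt_one.trans hp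
  have hpE' : 0 < finrank ℝ E - p := sub_pos.2 hpE
  have hq₀ : 0 < q := by rw [hq]; positivity
  obtain ⟨K, hK⟩ := exists_lintegral_div_enorm_pow_le_maximalFunction μ hE hp hpE
  obtain ⟨D, hD⟩ : ∃ D : ℝ≥0, (D : ℝ≥0∞) = 2 ^ p * ENNReal.ofReal p * 6 ^ finrank ℝ E *
      ENNReal.ofReal (p - 1)⁻¹ := ENNReal.canLift.prf _ (by finiteness)
  refine ⟨K * D ^ (1 / q), fun h hh hN ↦ ?_⟩
  set N := ∫⁻ z, h z ^ p ∂μ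
  have hpow : ∀ x, (∫⁻ z, h z / ‖x - z‖ₑ ^ (finrank ℝ E - 1) ∂μ) ^ q ≤
      (K : ℝ≥0∞) ^ q * N ^ (q / finrank ℝ E) * maximalFunction μ h x ^ p := by
    intro x
    have hexp : (1 - p / finrank ℝ E) * q = p := by rw [hq]; field_simp
    refine (ENNReal.rpow_le_rpow (hK h hh hN x) hq₀.le).trans_eq ?_
    rw [ENNReal.mul_rpow_of_nonneg _ _ hq₀.le, ENNReal.mul_rpow_of_nonneg _ _ hq₀.le,
      ← ENNReal.rpow_mul, ← ENNReal.rpow_mul, hexp, one_div_mul_eq_div]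
    ring
  have hNpow : N ^ (q / finrank ℝ E) * N = N ^ (q / p) := by
    conv_lhs => rw [← ENNReal.rpow_one N, ← ENNReal.rpow_mul, one_mul,
      ← ENNReal.rpow_add_of_nonneg _ _ (by positivity) zero_le_one]
    congr 1
    rw [hq]; field_simp; ring
  calc (∫⁻ x, (∫⁻ z, h z / ‖x - z‖ₑ ^ (finrank ℝ E - 1) ∂μ) ^ q ∂μ) ^ (1 / q)
      ≤ ((K : ℝ≥0∞) ^ q * N ^ (q / finrank ℝ E) * (D * N)) ^ (1 / q) := by
        refine ENNReal.rpow_le_rpow ((lintegral_mono hpow).trans ?_) (by positivity)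
        rw [lintegral_const_mul' _ _ (by finiteness), hD]
        exact mul_le_mul_right (lintegral_maximalFunction_rpow_le hp hh) _
    _ = ((K : ℝ≥0∞) ^ q * D * N ^ (q / p)) ^ (1 / q) := by rw [← hNpow]; ring_nf
    _ = K * D ^ (1 / q) * N ^ (1 / p) := by
        rw [ENNReal.mul_rpow_of_nonneg _ _ (by positivity),
          ENNReal.mul_rpow_of_nonneg _ _ (by positivity), ← ENNReal.rpow_mul, ← ENNReal.rpow_mul,
          mul_one_div_cancel hq₀.ne', ENNReal.rpow_one, show q / p * (1 / q) = 1 / p by field_simp]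
    _ = _ := by rw [ENNReal.coe_mul, ENNReal.coe_rpow_of_nonneg _ (by positivity)]

end HardyLittlewoodSobolev

section SobolevLebesgue

variable {n : ℕ} {g g' : Rn n → Rn n} {p : ℝ}

theorem eLpNorm_ofReal {X F : Type*} [MeasurableSpace X] [TopologicalSpace F] [ENormedAddMonoid F]
    {ν : Measure X} {q : ℝ} (hq : 0 < q) (f : X → F) :
    eLpNorm f (ENNReal.ofReal q) ν = (∫⁻ x, ‖f x‖ₑ ^ q ∂ν) ^ (1 / q) := by
  rw [eLpNorm_eq_lintegral_rpow_enorm_toReal (by simpa using hq) ENNReal.ofReal_ne_top,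
    ENNReal.toReal_ofReal hq.le]

theorem lintegral_enorm_rpow_ne_top {X F : Type*} [MeasurableSpace X] [TopologicalSpace F]
    [ENormedAddMonoid F] {ν : Measure X} {f : X → F} (hp : 0 < p)
    (hf : MemLp f (ENNReal.ofReal p) ν) : ∫⁻ x, ‖f x‖ₑ ^ p ∂ν ≠ ⊤ := by
  simpa only [ENNReal.toReal_ofReal hp.le] using
    (lintegral_rpow_enorm_lt_top_of_eLpNorm_lt_top (by simpa using hp)
      ENNReal.ofReal_ne_top hf.2).ne

theorem rieszPotential_congr (h : g =ᵐ[volume] g') : rieszPotential g = rieszPotential g' := by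
  funext x
  refine lintegral_congr_ae ?_
  filter_upwards [h] with z hz
  rw [hz]

theorem IsWeakGradient.congr_grad {u : Rn n → ℝ} (hu : IsWeakGradient u g)
    (h : g =ᵐ[volume] g') : IsWeakGradient u g' where
  locInt := hu.locInt
  locInt_grad := (locallyIntegrable_congr h).1 hu.locInt_grad
  integral_eq φ hφ hφ' e := by
    rw [hu.integral_eq φ hφ hφ' e]
    congr 1
    refine integral_congr_ae ?_
    filter_upwards [h] with x hx
    rw [hx]

theorem exists_eLpNorm_rieszPotential_le (hn : 2 ≤ n) (hp : 1 < p) (hpn : p < n) :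
    ∃ K : ℝ≥0, ∀ g : Rn n → Rn n, MemLp g (ENNReal.ofReal p) volume →
      eLpNorm (rieszPotential g) (ENNReal.ofReal (n * p / (n - p))) volume ≤
        K * eLpNorm g (ENNReal.ofReal p) volume := by
  have hrank : finrank ℝ (Rn n) = n := finrank_euclideanSpace_fin
  obtain ⟨K, hK⟩ := exists_lintegral_rpow_lintegral_div_enorm_pow_le (volume : Measure (Rn n))
    (by rwa [hrank]) hp (by rwa [hrank]) rfl
  refine ⟨K, fun g hg ↦ ?_⟩
  have hp₀ : 0 < p := zero_lt_one.trans hp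
  have hq : 0 < n * p / (n - p) := by
    have := sub_pos.2 hpn
    have : 0 < (n : ℝ) := hp₀.trans hpn
    positivity
  obtain ⟨g', hg', hgg'⟩ := hg.1
  have hbound := hK (‖g' ·‖ₑ) hg'.measurable.enorm
    (lintegral_enorm_rpow_ne_top hp₀ (hg.ae_eq hgg'))
  rw [hrank] at hbound
  rw [rieszPotential_congr hgg', eLpNorm_congr_ae hgg', eLpNorm_ofReal hq, eLpNorm_ofReal hp₀]
  exact hbound

theorem exists_maximalOp_preciseRep_le_rieszPotential (hn : 2 ≤ n) {μ : Measure (Rn n)} {R M : ℝ}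
    (hμ : IsSphericalLike μ R M) (hp : 1 < p) :
    ∃ D : ℝ≥0, ∀ (u : Rn n → ℝ) (g : Rn n → Rn n), IsSobolev p u g →
      ∀ x, maximalOp μ (preciseRep u) x ≤ D * rieszPotential g x := by
  obtain ⟨C, -, hC⟩ := exists_maximalOp_preciseRep_le hn
  have hball : volume (ball (0 : Rn n) 1) ≠ 0 := (measure_ball_pos _ _ one_pos).ne'
  obtain ⟨D, hD⟩ : ∃ D : ℝ≥0, (D : ℝ≥0∞) = ENNReal.ofReal (C * R ^ (n - 1) * M) *
      ((volume (ball (0 : Rn n) 1))⁻¹ + 1) := ENNReal.canLift.prf _ (by finiteness)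
  refine ⟨D, fun u g hu x ↦ ?_⟩
  obtain ⟨g', hg', hgg'⟩ := hu.memLp_grad.1
  have hHL : hardyLittlewood u x ≤ (volume (ball (0 : Rn n) 1))⁻¹ * rieszPotential g' x :=
    hardyLittlewood_le_rieszPotential hn hp hg'.measurable (hu.weakGradient.congr_grad hgg')
      (lintegral_enorm_rpow_ne_top (zero_lt_one.trans hp) hu.memLp) x
  calc maximalOp μ (preciseRep u) x
      ≤ ENNReal.ofReal (C * R ^ (n - 1) * M) * (hardyLittlewood u x + rieszPotential g' x) := by
        rw [← rieszPotential_congr hgg']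
        exact hC μ R M hμ p hp u g hu x
    _ ≤ ENNReal.ofReal (C * R ^ (n - 1) * M) *
          ((volume (ball (0 : Rn n) 1))⁻¹ * rieszPotential g' x + rieszPotential g' x) :=
        mul_le_mul_right (add_le_add_left hHL _) _
    _ = D * rieszPotential g x := by rw [hD, rieszPotential_congr hgg']; ring

theorem boundedSobolevLebesgue_maximalOp (hn : 2 ≤ n) {μ : Measure (Rn n)} {R M : ℝ}
    (hμ : IsSphericalLike μ R M) (hp : 1 < p) (hpn : p < n) :
    BoundedSobolevLebesgue p (maximalOp μ) := by
  obtain ⟨D, hD⟩ := exists_maximalOp_preciseRep_le_rieszPotential hn hμ hp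
  obtain ⟨K, hK⟩ := exists_eLpNorm_rieszPotential_le hn hp hpn
  refine ⟨D * K, fun u g hu ↦ ?_⟩
  have hbound : eLpNorm (maximalOp μ (preciseRep u)) (ENNReal.ofReal (n * p / (n - p))) volume ≤
      (D * K : ℝ≥0) * sobolevNorm p u g :=
    calc _ ≤ D * eLpNorm (rieszPotential g) (ENNReal.ofReal (n * p / (n - p))) volume :=
          eLpNorm_le_mul_eLpNorm_of_ae_le_mul' (.of_forall (hD u g hu)) _
      _ ≤ D * (K * eLpNorm g (ENNReal.ofReal p) volume) :=
          mul_le_mul_right (hK g hu.memLp_grad) _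
      _ ≤ (D * K : ℝ≥0) * sobolevNorm p u g := by
          rw [ENNReal.coe_mul, ← mul_assoc]
          exact mul_le_mul_right le_add_self _
  refine ⟨⟨(lowerSemicontinuous_maximalOp hn hμ hp hu).measurable.aestronglyMeasurable,
    hbound.trans_lt ?_⟩, hbound⟩
  exact ENNReal.mul_lt_top ENNReal.coe_lt_top (ENNReal.add_lt_top.2 ⟨hu.memLp.2, hu.memLp_grad.2⟩)

end SobolevLebesgue

section Dilation

variable {E : Type*} [NormedAddCommGroup E] [NormedSpace ℝ E]

/-- Dilation by `t` followed by translation by `x`. -/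
def dilation (t : ℝ) (ht : t ≠ 0) (x : E) : E ≃ₜ E :=
  (Homeomorph.smulOfNeZero t ht).trans (Homeomorph.addRight x)

theorem coe_dilation (t : ℝ) (ht : t ≠ 0) (x : E) :
    (dilation t ht x : E → E) = fun z ↦ t • z + x := rfl

theorem hausdorffMeasure_image_dilation [MeasurableSpace E] [BorelSpace E] {s : ℝ} (hs : 0 ≤ s)
    {t : ℝ} (ht : t ≠ 0) (x : E) (A : Set E) :
    Measure.hausdorffMeasure s (dilation t ht x '' A) =
      ‖t‖₊ ^ s • Measure.hausdorffMeasure s A := by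
  rw [← Measure.hausdorffMeasure_smul₀ hs ht A, ← Set.image_smul,
    ← (IsometryEquiv.addRight x).hausdorffMeasure_image s ((fun z ↦ t • z) '' A), Set.image_image]
  rfl

theorem image_dilation_levelSet (N : Seminorm ℝ E) (x : E) {t : ℝ} (ht : 0 < t) :
    dilation t ht.ne' x '' {z | N z = 1} = {z | N (z - x) = t} := by
  ext z
  constructor
  · rintro ⟨w, hw, rfl⟩
    simpa [coe_dilation, map_smul_eq_mul, abs_of_pos ht, ht.ne'] using hw
  · intro (hz : N (z - x) = t)
    refine ⟨t⁻¹ • (z - x), ?_, by simp [coe_dilation, ht.ne']⟩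
    rw [Set.mem_ofPred_eq, map_smul_eq_mul, hz,
      Real.norm_of_nonneg (inv_pos.2 ht).le, inv_mul_cancel₀ ht.ne']

variable {d : ℕ}

theorem rescaleAt_normalizedHausdorff (A : Set (Rn (d + 1))) {t : ℝ} (ht : 0 < t)
    (x : Rn (d + 1)) :
    rescaleAt (normalizedHausdorff A) t x = normalizedHausdorff (dilation t ht.ne' x '' A) := by
  have hd : (0 : ℝ) ≤ ((d + 1 : ℕ) : ℝ) - 1 := by simp
  have htd : ((‖t‖₊ ^ (((d + 1 : ℕ) : ℝ) - 1) : ℝ≥0) : ℝ≥0∞) ≠ 0 :=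
    ENNReal.coe_ne_zero.2 (NNReal.rpow_pos (nnnorm_pos.2 ht.ne')).ne'
  ext F hF
  have hinter : dilation t ht.ne' x '' (A ∩ dilation t ht.ne' x ⁻¹' F) =
      dilation t ht.ne' x '' A ∩ F := Set.image_inter_preimage _ _ _
  have hmeas : Measurable (dilation t ht.ne' x) := (dilation t ht.ne' x).continuous.measurable
  rw [rescaleAt, ← coe_dilation t ht.ne' x, Measure.map_apply hmeas hF, normalizedHausdorff,
    normalizedHausdorff, ProbabilityTheory.cond_apply' (hmeas hF),
    ProbabilityTheory.cond_apply' hF, ← hinter, hausdorffMeasure_image_dilation hd,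
    hausdorffMeasure_image_dilation hd, ENNReal.smul_def, ENNReal.smul_def, smul_eq_mul,
    smul_eq_mul, ENNReal.mul_inv (Or.inl htd) (Or.inl ENNReal.coe_ne_top), mul_mul_mul_comm,
    ENNReal.inv_mul_cancel htd ENNReal.coe_ne_top, one_mul]

theorem maximalOp_normalizedHausdorff {A : Set (Rn (d + 1))} {S : Rn (d + 1) → ℝ → Set (Rn (d + 1))}
    (hS : ∀ x t (ht : 0 < t), dilation t ht.ne' x '' A = S x t) (v : Rn (d + 1) → EReal)
    (x : Rn (d + 1)) :
    maximalOp (normalizedHausdorff A) v x = ⨆ (t : ℝ) (_ : 0 < t),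
      ⨍⁻ z in S x t, (v z).abs ∂(Measure.hausdorffMeasure (((d + 1 : ℕ) : ℝ) - 1)) := by
  rw [maximalOp_eq]
  refine iSup_congr fun t ↦ iSup_congr fun ht ↦ ?_
  rw [rescaleAt_normalizedHausdorff A ht, hS x t ht, laverage, Measure.restrict_apply_univ]
  rfl

end Dilation

section UpperRegularSets

theorem exists_isSphericalLike_normalizedHausdorff {d : ℕ} {A : Set (Rn (d + 1))} {M : ℝ≥0}
    (hM : UpperRegular d ((Measure.hausdorffMeasure d).restrict A) M) (hA : IsClosed A) {R : ℝ}
    (hR : A ⊆ closedBall 0 R) (hA₀ : Measure.hausdorffMeasure d A ≠ 0) :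
    ∃ M', IsSphericalLike (normalizedHausdorff A) R M' := by
  have hcond : normalizedHausdorff A = ProbabilityTheory.cond (Measure.hausdorffMeasure d) A := by
    rw [normalizedHausdorff, Nat.cast_succ, add_sub_cancel_right]
  have hfinite : Measure.hausdorffMeasure d A ≠ ⊤ := by
    obtain ⟨r, hr, hAr⟩ := (isBounded_closedBall.subset hR).subset_ball_lt 0 0
    rw [← Set.inter_eq_right.2 hAr, ← Measure.restrict_apply measurableSet_ball]
    exact ne_top_of_le_ne_top (by finiteness) (hM 0 r hr)
  rw [hcond]
  refine ⟨((Measure.hausdorffMeasure d A)⁻¹ * M).toReal,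
    ProbabilityTheory.cond_isProbabilityMeasure_of_finite hA₀ hfinite, ?_, fun x r hr ↦ ?_⟩
  · refine Measure.support_subset_of_isClosed isClosed_closedBall ?_
    rw [mem_ae_iff, ProbabilityTheory.cond_apply hA.measurableSet,
      (Set.disjoint_compl_right_iff_subset.2 hR).inter_eq, measure_empty, mul_zero]
  · rw [ENNReal.ofReal_mul ENNReal.toReal_nonneg, ENNReal.ofReal_toReal (by finiteness),
      ENNReal.ofReal_pow hr.le, ProbabilityTheory.cond_apply hA.measurableSet, mul_assoc,
      Set.inter_comm, ← Measure.restrict_apply measurableSet_ball]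
    exact mul_le_mul_right (hM x r hr) _

theorem UpperRegular.exists_restrict_of_lipschitzOnWith {X Y : Type*} [MetricSpace X]
    [MeasurableSpace X] [BorelSpace X] [MetricSpace Y] [MeasurableSpace Y] [BorelSpace Y] {d : ℕ}
    {A : Set X} {S : Set Y} {M : ℝ≥0}
    (hM : UpperRegular d ((Measure.hausdorffMeasure d).restrict A) M) {f : X → Y} {g : Y → X}
    {K L : ℝ≥0} (hf : LipschitzOnWith K f A) (hg : LipschitzOnWith L g S) (hgS : Set.MapsTo g S A)
    (hfg : Set.LeftInvOn f g S) :
    ∃ M', UpperRegular d ((Measure.hausdorffMeasure d).restrict S) M' := by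
  refine ⟨K ^ d * (M * ((L + 1) * 2) ^ d), fun x r hr ↦ ?_⟩
  rw [Measure.restrict_apply measurableSet_ball]
  rcases (ball x r ∩ S).eq_empty_or_nonempty with hempty | ⟨s, hsx, hs⟩
  · rw [hempty, measure_empty]
    exact zero_le
  have hsub : ball x r ∩ S ⊆ f '' (ball (g s) ((L + 1) * 2 * r) ∩ A) := by
    rintro z ⟨hzx, hz⟩
    refine ⟨g z, ⟨?_, hgS hz⟩, hfg hz⟩
    have hzs : dist z s ≤ 2 * r := by
      linarith [dist_triangle_right z s x, mem_ball.1 hzx, mem_ball.1 hsx]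
    calc dist (g z) (g s) ≤ L * dist z s := hg.dist_le_mul z hz s hs
      _ ≤ L * (2 * r) := by gcongr
      _ < (L + 1) * 2 * r := by linarith
  calc Measure.hausdorffMeasure d (ball x r ∩ S)
      ≤ (K : ℝ≥0∞) ^ (d : ℝ) * Measure.hausdorffMeasure d (ball (g s) ((L + 1) * 2 * r) ∩ A) :=
        (measure_mono hsub).trans
          ((hf.mono Set.inter_subset_right).hausdorffMeasure_image_le d.cast_nonneg)
    _ ≤ (K : ℝ≥0∞) ^ (d : ℝ) * (M * ENNReal.ofReal ((L + 1) * 2 * r) ^ d) := by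
        rw [← Measure.restrict_apply measurableSet_ball]
        exact mul_le_mul_right (hM (g s) _ (by positivity)) _
    _ = _ := by
        rw [ENNReal.ofReal_mul (by positivity),
          show ((L : ℝ) + 1) * 2 = (((L + 1) * 2 : ℝ≥0) : ℝ) by simp, ENNReal.ofReal_coe_nnreal,
          ENNReal.rpow_natCast, mul_pow]
        push_cast
        ring

end UpperRegularSets

section RadialProjection

variable {E : Type*} [NormedAddCommGroup E] [NormedSpace ℝ E]

/-- The radial projection onto the level set `N = 1` of a seminorm `N`; it maps the points with
`N z = 0` to `0`. -/
def radialProjection (N : Seminorm ℝ E) (z : E) : E := (N z)⁻¹ • z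

theorem apply_radialProjection (N N' : Seminorm ℝ E) (z : E) :
    N' (radialProjection N z) = (N z)⁻¹ * N' z := by
  rw [radialProjection, map_smul_eq_mul, Real.norm_of_nonneg (inv_nonneg.2 (apply_nonneg N z))]

theorem radialProjection_radialProjection {N N' : Seminorm ℝ E} {z : E} (hz : N z = 1)
    (hz' : N' z ≠ 0) : radialProjection N (radialProjection N' z) = z := by
  rw [radialProjection, apply_radialProjection, hz, mul_one, inv_inv, radialProjection,
    smul_inv_smul₀ hz']

theorem mapsTo_radialProjection {N : Seminorm ℝ E} {A : Set E} (hA : ∀ z ∈ A, N z ≠ 0) :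
    Set.MapsTo (radialProjection N) A {z | N z = 1} := fun z hz ↦ by
  rw [Set.mem_ofPred_eq, apply_radialProjection, inv_mul_cancel₀ (hA z hz)]

theorem lipschitzOnWith_radialProjection {N : Seminorm ℝ E} {A : Set E} {B K c : ℝ≥0} (hc : 0 < c)
    (hN : LipschitzWith K N) (hNc : ∀ z ∈ A, c ≤ N z) (hB : ∀ z ∈ A, ‖z‖ ≤ B) :
    LipschitzOnWith (c⁻¹ + B * (K * (c⁻¹ * c⁻¹))) (radialProjection N) A := by
  refine LipschitzOnWith.of_dist_le_mul fun z hz w hw ↦ ?_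
  have hc' : (0 : ℝ) < c := hc
  have hz₀ : 0 < N z := hc'.trans_le (hNc z hz)
  have hw₀ : 0 < N w := hc'.trans_le (hNc w hw)
  have hzc : (N z)⁻¹ ≤ (c : ℝ)⁻¹ := inv_anti₀ hc' (hNc z hz)
  have hwc : (N w)⁻¹ ≤ (c : ℝ)⁻¹ := inv_anti₀ hc' (hNc w hw)
  have hinv : |(N z)⁻¹ - (N w)⁻¹| ≤ K * dist z w * ((c : ℝ)⁻¹ * (c : ℝ)⁻¹) := by
    have hzw := hN.dist_le_mul w z
    rw [Real.dist_eq, dist_comm w z] at hzw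
    rw [inv_sub_inv hz₀.ne' hw₀.ne', abs_div, div_eq_mul_inv, abs_mul, abs_of_pos hz₀,
      abs_of_pos hw₀, mul_inv]
    gcongr
  calc dist (radialProjection N z) (radialProjection N w)
      = ‖(N z)⁻¹ • (z - w) + ((N z)⁻¹ - (N w)⁻¹) • w‖ := by
        rw [dist_eq_norm, radialProjection, radialProjection, smul_sub, sub_smul,
          sub_add_sub_cancel]
    _ ≤ (N z)⁻¹ * dist z w + |(N z)⁻¹ - (N w)⁻¹| * ‖w‖ := by
        refine (norm_add_le _ _).trans_eq ?_
        rw [norm_smul, norm_smul, Real.norm_of_nonneg (inv_pos.2 hz₀).le, Real.norm_eq_abs,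
          dist_eq_norm]
    _ ≤ (c : ℝ)⁻¹ * dist z w + K * dist z w * ((c : ℝ)⁻¹ * (c : ℝ)⁻¹) * B := by
        gcongr
        exact hB w hw
    _ = _ := by push_cast; ring

end RadialProjection

section MaxNorm

variable {n : ℕ}

/-- The maximum norm on `ℝⁿ`. -/
def maxNorm (n : ℕ) : Seminorm ℝ (Rn n) :=
  (normSeminorm ℝ (Fin n → ℝ)).comp (WithLp.linearEquiv 2 ℝ (Fin n → ℝ)).toLinearMap

theorem maxNorm_apply (z : Rn n) : maxNorm n z = ‖WithLp.ofLp z‖ := rfl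

theorem abs_apply_le_maxNorm (z : Rn n) (i : Fin n) : |z i| ≤ maxNorm n z :=
  norm_le_pi_norm (WithLp.ofLp z) i

theorem maxNorm_le_norm (z : Rn n) : maxNorm n z ≤ ‖z‖ := by
  simpa [maxNorm_apply] using (PiLp.lipschitzWith_ofLp 2 fun _ : Fin n ↦ ℝ).norm_le_mul (by simp) z

theorem lipschitzWith_maxNorm : LipschitzWith 1 (maxNorm n) := by
  simpa only [one_mul] using!
    lipschitzWith_one_norm.comp (PiLp.lipschitzWith_ofLp 2 fun _ : Fin n ↦ ℝ)

/-- The Lipschitz constant `√n` of the identity from the maximum norm to the Euclidean norm. -/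
def normConst (n : ℕ) : ℝ≥0 := (Fintype.card (Fin n) : ℝ≥0) ^ (1 / (2 : ℝ≥0∞)).toReal

theorem normConst_pos [NeZero n] : 0 < normConst n :=
  NNReal.rpow_pos (by simpa using NeZero.pos n)

theorem norm_le_normConst_mul (z : Rn n) : ‖z‖ ≤ normConst n * maxNorm n z :=
  (PiLp.lipschitzWith_toLp 2 fun _ : Fin n ↦ ℝ).norm_le_mul (by simp) (WithLp.ofLp z)

theorem exists_abs_eq_maxNorm [NeZero n] (z : Rn n) : ∃ i, |z i| = maxNorm n z := by
  obtain ⟨i, hi⟩ := Finite.exists_max fun i ↦ ‖z i‖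
  exact ⟨i, (abs_apply_le_maxNorm z i).antisymm
    ((pi_norm_le_iff_of_nonneg (norm_nonneg _)).2 hi)⟩

theorem frontier_cube (x : Rn n) {t : ℝ} (ht : 0 < t) :
    frontier (cube x t) = {z | maxNorm n (z - x) = t} := by
  have hcube : cube x t = EuclideanSpace.equiv (Fin n) ℝ ⁻¹'
      closedBall (EuclideanSpace.equiv (Fin n) ℝ x) t := by
    ext z
    simp [cube, dist_pi_le_iff ht.le, Real.dist_eq]
  rw [hcube]
  refine ((EuclideanSpace.equiv (Fin n) ℝ).toHomeomorph.preimage_frontier _).symm.trans ?_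
  rw [frontier_closedBall _ ht.ne']
  ext z
  simp only [maxNorm_apply, WithLp.ofLp_sub, Set.mem_preimage, mem_sphere_iff_norm,
    Set.mem_ofPred_eq]
  rfl

end MaxNorm

section Faces

variable {d : ℕ}

/-- The parametrization of the coordinate hyperplane `z i = ε`. -/
def hyperplane (i : Fin (d + 1)) (ε : ℝ) (y : Fin d → ℝ) : Rn (d + 1) :=
  WithLp.toLp 2 (i.insertNth ε y)

/-- The coordinate projection that forgets the coordinate `i`. -/
def forgetCoord (i : Fin (d + 1)) (z : Rn (d + 1)) : Fin d → ℝ := i.removeNth (WithLp.ofLp z)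

theorem hyperplane_forgetCoord (i : Fin (d + 1)) (z : Rn (d + 1)) :
    hyperplane i (z i) (forgetCoord i z) = z := by
  rw [hyperplane, forgetCoord, Fin.insertNth_self_removeNth]

theorem forgetCoord_hyperplane (i : Fin (d + 1)) (ε : ℝ) (y : Fin d → ℝ) :
    forgetCoord i (hyperplane i ε y) = y := by
  rw [hyperplane, forgetCoord, Fin.removeNth_insertNth]

theorem lipschitzWith_hyperplane (i : Fin (d + 1)) (ε : ℝ) :
    LipschitzWith (normConst (d + 1)) (hyperplane i ε) := by
  have hinsert : LipschitzWith 1 fun y : Fin d → ℝ ↦ (i.insertNth ε y : Fin (d + 1) → ℝ) :=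
    LipschitzWith.of_dist_le_mul fun y z ↦ by
      rw [Fin.dist_insertNth_insertNth, dist_self, NNReal.coe_one, one_mul,
        max_eq_right dist_nonneg]
  simpa only [mul_one] using! (PiLp.lipschitzWith_toLp 2 fun _ : Fin (d + 1) ↦ ℝ).comp hinsert

theorem lipschitzWith_forgetCoord (i : Fin (d + 1)) : LipschitzWith 1 (forgetCoord i) := by
  refine LipschitzWith.of_dist_le_mul fun z w ↦ ?_
  refine le_trans ?_ ((PiLp.lipschitzWith_ofLp 2 fun _ : Fin (d + 1) ↦ ℝ).dist_le_mul z w)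
  exact (dist_pi_le_iff dist_nonneg).2 fun j ↦ dist_le_pi_dist (WithLp.ofLp z) (WithLp.ofLp w) _

theorem hausdorffMeasure_fin (d : ℕ) :
    (Measure.hausdorffMeasure d : Measure (Fin d → ℝ)) = volume := by
  rw [← hausdorffMeasure_pi_real, Fintype.card_fin]

theorem hausdorffMeasure_hyperplane_image_ball_le (i : Fin (d + 1)) (ε : ℝ) (y : Fin d → ℝ)
    {r : ℝ} (hr : 0 < r) :
    Measure.hausdorffMeasure d (hyperplane i ε '' ball y r) ≤
      (normConst (d + 1) * 2 * ENNReal.ofReal r) ^ d := by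
  refine ((lipschitzWith_hyperplane i ε).hausdorffMeasure_image_le d.cast_nonneg _).trans_eq ?_
  rw [hausdorffMeasure_fin, Real.volume_pi_ball _ hr, Fintype.card_fin, ENNReal.rpow_natCast,
    ENNReal.ofReal_pow (by positivity), ENNReal.ofReal_mul zero_le_two, ENNReal.ofReal_ofNat,
    ← mul_pow, mul_assoc]

theorem ball_inter_maxNorm_eq_one_subset (x : Rn (d + 1)) (r : ℝ) :
    ball x r ∩ {z | maxNorm (d + 1) z = 1} ⊆ ⋃ i, (hyperplane i 1 '' ball (forgetCoord i x) r ∪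
      hyperplane i (-1) '' ball (forgetCoord i x) r) := by
  rintro z ⟨hzx, hz : maxNorm (d + 1) z = 1⟩
  obtain ⟨i, hi⟩ := exists_abs_eq_maxNorm z
  have hforget : forgetCoord i z ∈ ball (forgetCoord i x) r := by
    simpa using (lipschitzWith_forgetCoord i).mapsTo_ball one_ne_zero x r hzx
  refine Set.mem_iUnion.2 ⟨i, ?_⟩
  rcases (abs_eq zero_le_one).1 (hi.trans hz) with hi | hi
  · exact .inl ⟨_, hforget, by rw [← hi, hyperplane_forgetCoord]⟩
  · exact .inr ⟨_, hforget, by rw [← hi, hyperplane_forgetCoord]⟩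

theorem exists_upperRegular_maxNorm_eq_one (d : ℕ) : ∃ M, UpperRegular d
    ((Measure.hausdorffMeasure d).restrict {z : Rn (d + 1) | maxNorm (d + 1) z = 1}) M := by
  refine ⟨(d + 1 : ℕ) * (2 * (normConst (d + 1) * 2) ^ d), fun x r hr ↦ ?_⟩
  rw [Measure.restrict_apply measurableSet_ball]
  calc Measure.hausdorffMeasure d (ball x r ∩ {z | maxNorm (d + 1) z = 1})
      ≤ ∑ i, Measure.hausdorffMeasure d (hyperplane i 1 '' ball (forgetCoord i x) r ∪
          hyperplane i (-1) '' ball (forgetCoord i x) r) :=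
        (measure_mono (ball_inter_maxNorm_eq_one_subset x r)).trans (measure_iUnion_fintype_le _ _)
    _ ≤ ∑ _ : Fin (d + 1), 2 * (normConst (d + 1) * 2 * ENNReal.ofReal r) ^ d := by
        refine Finset.sum_le_sum fun i _ ↦ (measure_union_le _ _).trans ?_
        rw [two_mul]
        exact add_le_add (hausdorffMeasure_hyperplane_image_ball_le i 1 _ hr)
          (hausdorffMeasure_hyperplane_image_ball_le i (-1) _ hr)
    _ = _ := by
        rw [Finset.sum_const, Finset.card_univ, Fintype.card_fin, nsmul_eq_mul, mul_pow]
        push_cast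
        ring

theorem hausdorffMeasure_maxNorm_eq_one_ne_zero (d : ℕ) :
    Measure.hausdorffMeasure d {z : Rn (d + 1) | maxNorm (d + 1) z = 1} ≠ 0 := by
  have hsub : ball (0 : Fin d → ℝ) 1 ⊆ forgetCoord 0 '' {z | maxNorm (d + 1) z = 1} := by
    intro y hy
    have hy' : ‖y‖ ≤ 1 := (mem_ball_zero_iff.1 hy).le
    refine ⟨hyperplane 0 1 y, le_antisymm ?_ ?_, forgetCoord_hyperplane 0 1 y⟩
    · refine (pi_norm_le_iff_of_nonneg zero_le_one).2 (Fin.cases ?_ fun j ↦ ?_)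
      · simp [hyperplane]
      · simpa [hyperplane] using (norm_le_pi_norm y j).trans hy'
    · simpa [hyperplane] using abs_apply_le_maxNorm (hyperplane 0 1 y) 0
  intro hzero
  have hball := (measure_mono hsub).trans
    ((lipschitzWith_forgetCoord 0).hausdorffMeasure_image_le d.cast_nonneg _)
  rw [hzero, mul_zero, hausdorffMeasure_fin] at hball
  exact (measure_ball_pos volume (0 : Fin d → ℝ) one_pos).ne' (le_antisymm hball zero_le)

end Faces

section Examples

variable {d : ℕ}

theorem frontier_cube_zero_one :
    frontier (cube (0 : Rn (d + 1)) 1) = {z | maxNorm (d + 1) z = 1} := by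
  simpa only [sub_zero] using frontier_cube (0 : Rn (d + 1)) one_pos

theorem image_dilation_frontier_cube (x : Rn (d + 1)) {t : ℝ} (ht : 0 < t) :
    dilation t ht.ne' x '' frontier (cube 0 1) = frontier (cube x t) := by
  rw [frontier_cube_zero_one, frontier_cube x ht, image_dilation_levelSet _ x ht]

theorem image_dilation_sphere {E : Type*} [NormedAddCommGroup E] [NormedSpace ℝ E] (x : E) {t : ℝ}
    (ht : 0 < t) : dilation t ht.ne' x '' sphere 0 1 = sphere x t := by
  simpa [sphere, dist_eq_norm] using image_dilation_levelSet (normSeminorm ℝ E) x ht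

theorem exists_isSphericalLike_frontier_cube :
    ∃ R M, IsSphericalLike (normalizedHausdorff (frontier (cube (0 : Rn (d + 1)) 1))) R M := by
  obtain ⟨M, hM⟩ := exists_upperRegular_maxNorm_eq_one d
  rw [← frontier_cube_zero_one] at hM
  refine ⟨normConst (d + 1), exists_isSphericalLike_normalizedHausdorff hM isClosed_frontier ?_ ?_⟩
  · rw [frontier_cube_zero_one]
    intro z (hz : maxNorm (d + 1) z = 1)
    simpa [hz] using norm_le_normConst_mul z
  · rw [frontier_cube_zero_one]
    exact hausdorffMeasure_maxNorm_eq_one_ne_zero d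

theorem inv_normConst_le_maxNorm {z : Rn (d + 1)} (hz : z ∈ sphere 0 1) :
    ((normConst (d + 1))⁻¹ : ℝ≥0) ≤ maxNorm (d + 1) z := by
  have hnorm := norm_le_normConst_mul z
  rw [mem_sphere_zero_iff_norm.1 hz] at hnorm
  rw [NNReal.coe_inv]
  exact (inv_le_iff_one_le_mul₀' (by exact_mod_cast normConst_pos)).2 hnorm

theorem exists_lipschitzOnWith_radialProjection_maxNorm :
    ∃ L, LipschitzOnWith L (radialProjection (maxNorm (d + 1))) (sphere 0 1) :=
  ⟨_, lipschitzOnWith_radialProjection (B := 1) (inv_pos.2 normConst_pos) lipschitzWith_maxNorm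
    (fun _ ↦ inv_normConst_le_maxNorm) fun _ hz ↦ (mem_sphere_zero_iff_norm.1 hz).le⟩

theorem exists_lipschitzOnWith_radialProjection_norm :
    ∃ L, LipschitzOnWith L (radialProjection (normSeminorm ℝ (Rn (d + 1))))
      {z | maxNorm (d + 1) z = 1} :=
  ⟨_, lipschitzOnWith_radialProjection (B := normConst (d + 1)) one_pos lipschitzWith_one_norm
    (fun z (hz : maxNorm (d + 1) z = 1) ↦ by simpa [hz] using maxNorm_le_norm z)
    fun z (hz : maxNorm (d + 1) z = 1) ↦ by simpa [hz] using norm_le_normConst_mul z⟩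

/-- Radial projection between the unit sphere and the boundary of the cube is bi-Lipschitz, so both
the growth and the positivity of the Hausdorff measure carry over from the cube. -/
theorem exists_isSphericalLike_sphere :
    ∃ R M, IsSphericalLike (normalizedHausdorff (sphere (0 : Rn (d + 1)) 1)) R M := by
  obtain ⟨M, hM⟩ := exists_upperRegular_maxNorm_eq_one d
  obtain ⟨K, hK⟩ := exists_lipschitzOnWith_radialProjection_norm (d := d)
  obtain ⟨L, hL⟩ := exists_lipschitzOnWith_radialProjection_maxNorm (d := d)
  have hmax : ∀ z ∈ sphere (0 : Rn (d + 1)) 1, maxNorm (d + 1) z ≠ 0 := fun z hz ↦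
    ((NNReal.coe_pos.2 (inv_pos.2 normConst_pos)).trans_le (inv_normConst_le_maxNorm hz)).ne'
  have hnorm : ∀ z ∈ {z | maxNorm (d + 1) z = 1}, normSeminorm ℝ (Rn (d + 1)) z ≠ 0 :=
    fun z (hz : maxNorm (d + 1) z = 1) ↦ (one_pos.trans_le (hz ▸ maxNorm_le_norm z)).ne'
  obtain ⟨M', hM'⟩ := hM.exists_restrict_of_lipschitzOnWith hK hL (mapsTo_radialProjection hmax)
    fun z hz ↦ radialProjection_radialProjection (by simpa using hz) (hmax z hz)
  refine ⟨1, exists_isSphericalLike_normalizedHausdorff hM' isClosed_sphere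
    sphere_subset_closedBall fun hzero ↦ hausdorffMeasure_maxNorm_eq_one_ne_zero d ?_⟩
  have hsub : {z | maxNorm (d + 1) z = 1} ⊆
      radialProjection (maxNorm (d + 1)) '' sphere (0 : Rn (d + 1)) 1 := fun z hz ↦
    ⟨radialProjection (normSeminorm ℝ _) z, by simpa using mapsTo_radialProjection hnorm hz,
      radialProjection_radialProjection hz (hnorm z hz)⟩
  have hle := (measure_mono hsub).trans (hL.hausdorffMeasure_image_le d.cast_nonneg)
  rwa [hzero, mul_zero, nonpos_iff_eq_zero] at hle

end Examples

end SphericalLike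

end

theorem theorem1p3 (n : ℕ) (hn : 2 ≤ n) :
    -- the pointwise estimate, with a constant `C` that depends only on `n`
    (∃ C : ℝ, 0 < C ∧
      ∀ (μ : Measure (SphericalLike.Rn n)) (R M : ℝ), SphericalLike.IsSphericalLike μ R M →
      ∀ p : ℝ, 1 < p → p < n →
      ∀ (u : SphericalLike.Rn n → ℝ) (g : SphericalLike.Rn n → SphericalLike.Rn n),
        SphericalLike.IsSobolev p u g →
      ∀ x : SphericalLike.Rn n,
        SphericalLike.maximalOp μ (SphericalLike.preciseRep u) x ≤
          ENNReal.ofReal (C * R ^ (n - 1) * M) *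
            (SphericalLike.hardyLittlewood u x + SphericalLike.rieszPotential g x)) ∧
    -- boundedness from `W^{1,p}` to `L^{p*}`
    (∀ (μ : Measure (SphericalLike.Rn n)) (R M : ℝ), SphericalLike.IsSphericalLike μ R M →
      ∀ p : ℝ, 1 < p → p < n →
        SphericalLike.BoundedSobolevLebesgue p (SphericalLike.maximalOp μ)) ∧
    -- the spherical maximal operator is covered
    ((∃ R M : ℝ, SphericalLike.IsSphericalLike
        (SphericalLike.normalizedHausdorff (Metric.sphere (0 : SphericalLike.Rn n) 1)) R M) ∧
      ∀ v : SphericalLike.Rn n → EReal,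
        SphericalLike.maximalOp
          (SphericalLike.normalizedHausdorff (Metric.sphere (0 : SphericalLike.Rn n) 1)) v =
            SphericalLike.sphericalMaximal v) ∧
    -- averages over boundaries of cubes are covered
    ((∃ R M : ℝ, SphericalLike.IsSphericalLike
        (SphericalLike.normalizedHausdorff
          (frontier (SphericalLike.cube (0 : SphericalLike.Rn n) 1))) R M) ∧
      ∀ v : SphericalLike.Rn n → EReal,
        SphericalLike.maximalOp
          (SphericalLike.normalizedHausdorff
            (frontier (SphericalLike.cube (0 : SphericalLike.Rn n) 1))) v =
            SphericalLike.cubeBoundaryMaximal v) := by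
  obtain ⟨d, rfl⟩ : ∃ d, n = d + 1 := ⟨n - 1, by omega⟩
  obtain ⟨C, hC, hle⟩ := SphericalLike.exists_maximalOp_preciseRep_le hn
  refine ⟨⟨C, hC, fun μ R M hμ p hp _ ↦ hle μ R M hμ p hp⟩,
    fun μ R M hμ p hp hpn ↦ SphericalLike.boundedSobolevLebesgue_maximalOp hn hμ hp hpn,
    ⟨SphericalLike.exists_isSphericalLike_sphere, fun v ↦ funext fun x ↦ ?_⟩,
    ⟨SphericalLike.exists_isSphericalLike_frontier_cube, fun v ↦ funext fun x ↦ ?_⟩⟩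
  · exact SphericalLike.maximalOp_normalizedHausdorff
      (fun x _ ht ↦ SphericalLike.image_dilation_sphere x ht) v x
  · exact SphericalLike.maximalOp_normalizedHausdorff
      (fun x _ ht ↦ SphericalLike.image_dilation_frontier_cube x ht) v x
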